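/- Let $d\ge 3$, $m\in(0,1)$, $m\neq m_*:=\frac{d-4}{d-2}$. For $D>0$ let $$V_D(x)=\Big(D+\tfrac{1-m}{2m}|x|^2\Big)^{-\frac1{1-m}},\qquad x\in\mathbb R^d .$$ Hardy–Poincaré constant: let $$\lambda_{m,d}=m\,\inf_h\frac{\int_{\mathbb R^d}|\nabla h|^2\,V_D\,dx}{\int_{\mathbb R^d}|h-\bar h|^2\,V_D^{2-m}\,dx},$$ where $h$ runs over the functions in $C_c^\infty(\mathbb R^d)$ with nonzero denominator, with $\bar h=\int hV_D^{2-m}dx\big/\int V_D^{2-m}dx$ if $m>m_*$, while $\bar h=0$ and $\operatorname{supp}h\subset\mathbb R^d\setminus\{0\}$ if $m<m_*$. Let $D_0>D_1>0$, $D_*\in[D_1,D_0]$, and put $W_0=\inf_x V_{D_0}(x)/V_{D_*}(x)$, $W_1=\sup_x V_{D_1}(x)/V_{D_*}(x)$. We say that $w:\mathbb R^d\to[0,\infty)$, $w\in L^1_{\rm loc}(\mathbb R^d)$, is admissible (for $D_*,D_0,D_1$) if * (H1'') $V_{D_0}/V_{D_*}\le w\le V_{D_1}/V_{D_*}$ on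 $\mathbb R^d$; * (H2'') $w=1+f/V_{D_*}$ on $\mathbb R^d$ for some $f\in L^1(\mathbb R^d)$; * if $m>m_*$, $\int_{\mathbb R^d}(w-1)V_{D_*}\,dx=0$. Let $$F[w]=\frac1{1-m}\int_{\mathbb R^d}\Big[(w-1)-\frac1m(w^m-1)\Big]V_{D_*}^m\,dx,$$ $$I[w]=\frac m{(m-1)^2}\int_{\mathbb R^d}\Big|\nabla\big[(w^{m-1}-1)V_{D_*}^{m-1}\big]\Big|^2\,w\,V_{D_*}\,dx\in[0,\infty],$$ with the weak gradient, and $I[w]=\infty$ if $(w^{m-1}-1)V_{D_*}^{m-1}$ has no weak gradient in $L^1_{\rm loc}$. **Theorem (entropy–entropy production inequality).** The number $\lambda_{m,d}$ is positive and does not depend on $D$, the integral defining $F[w]$ converges absolutely for the admissible $w$ considered below, and: 1. There are $\varepsilon>0$ and $\gamma>0$, depending only on $m$ and $d$, such that for all $D_0>D_1>0$ and $D_*\in[D_1,D_0]$ with $1-W_0<\varepsilon$ and $W_1-1<\varepsilon$, every admissible $w$ satisfies $\gamma\,F[w]\le I[w]$. 2. Explicitly, whenever $$\frac{W_1}{W_0}<\Big(1+\frac{\lambda_{m,d}}{d(1-m)}\Big)^{\frac1{2(2-m)}},$$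 then, with $\mathcal C_{m,d}=m/\lambda_{m,d}$, $$\gamma_0:=2\,\frac{m-\mathcal C_{m,d}\,d\,(1-m)\Big[\big(\tfrac{W_1}{W_0}\big)^{2(2-m)}-1\Big]}{\mathcal C_{m,d}\,W_0^{m-3}\,W_1^{2(2-m)}}>0,$$ and there is $\gamma\ge\gamma_0$ such that every admissible $w$ satisfies $\gamma\,F[w]\le I[w]$. -/

import Mathlib

open MeasureTheory
open scoped ContDiff ENNReal

noncomputable section

namespace FastDiffusion

/-- The critical exponent `m_* = (d - 4) / (d - 2)` (used for `d ≥ 3`). -/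
def mStar (d : ℕ) : ℝ := ((d : ℝ) - 4) / ((d : ℝ) - 2)

/-- The Barenblatt profile `V_D(x) = (D + (1 - m) / (2 m) |x|²) ^ (-1 / (1 - m))`. -/
def barenblatt {d : ℕ} (m D : ℝ) (x : EuclideanSpace ℝ (Fin d)) : ℝ :=
  (D + (1 - m) / (2 * m) * ‖x‖ ^ 2) ^ (-(1 / (1 - m)))

/-- `W_0 = inf_x V_{D_0}(x) / V_{D_*}(x)`. -/
def lowerRatio (d : ℕ) (m Dstar D₀ : ℝ) : ℝ :=
  ⨅ x : EuclideanSpace ℝ (Fin d), barenblatt m D₀ x / barenblatt m Dstar x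

/-- `W_1 = sup_x V_{D_1}(x) / V_{D_*}(x)`. -/
def upperRatio (d : ℕ) (m Dstar D₁ : ℝ) : ℝ :=
  ⨆ x : EuclideanSpace ℝ (Fin d), barenblatt m D₁ x / barenblatt m Dstar x

/-- The assumptions on the relative density `w = v / V_{D_*}`. -/
structure IsAdmissible (d : ℕ) (m Dstar D₀ D₁ : ℝ)
    (w : EuclideanSpace ℝ (Fin d) → ℝ) : Prop where
  nonneg : ∀ x, 0 ≤ w x
  locallyIntegrable : LocallyIntegrable w volume
  lower : ∀ x, barenblatt m D₀ x / barenblatt m Dstar x ≤ w x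
  upper : ∀ x, w x ≤ barenblatt m D₁ x / barenblatt m Dstar x
  /-- `w` is an integrable perturbation of the profile: `w = 1 + f / V_{D_*}`, `f ∈ L¹`. -/
  perturbation : ∃ f : EuclideanSpace ℝ (Fin d) → ℝ, Integrable f volume ∧
    ∀ x, w x = 1 + f x / barenblatt m Dstar x
  /-- For `m > m_*` the parameter `D_*` is the one with zero relative mass. -/
  mass : mStar d < m → ∫ x, (w x - 1) * barenblatt m Dstar x = 0

/-- `G` is the weak (distributional) gradient of `u` on `ℝ^d`. -/
def IsWeakGradient {d : ℕ} (u : EuclideanSpace ℝ (Fin d) → ℝ)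
    (G : EuclideanSpace ℝ (Fin d) → EuclideanSpace ℝ (Fin d)) : Prop :=
  LocallyIntegrable u volume ∧ LocallyIntegrable G volume ∧
    ∀ φ : EuclideanSpace ℝ (Fin d) → ℝ, ContDiff ℝ ∞ φ → HasCompactSupport φ →
      ∫ x, u x • gradient φ x = - ∫ x, φ x • G x

/-- The integrand of the relative entropy. -/
def entropyDensity {d : ℕ} (m Dstar : ℝ) (w : EuclideanSpace ℝ (Fin d) → ℝ)
    (x : EuclideanSpace ℝ (Fin d)) : ℝ :=
  ((w x - 1) - 1 / m * (w x ^ m - 1)) * barenblatt m Dstar x ^ m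

/-- The relative entropy
`F[w] = 1 / (1 - m) ∫ [(w - 1) - (w ^ m - 1) / m] V_{D_*} ^ m dx`. -/
def relativeEntropy {d : ℕ} (m Dstar : ℝ) (w : EuclideanSpace ℝ (Fin d) → ℝ) : ℝ :=
  1 / (1 - m) * ∫ x, entropyDensity m Dstar w x

/-- The relative Fisher information
`I[w] = m / (m - 1)² ∫ |∇[(w ^ (m - 1) - 1) V_{D_*} ^ (m - 1)]|² w V_{D_*} dx ∈ [0, ∞]`.
The gradient is the weak one. It is unique almost everywhere, so the infimum is just the value of
the integral at that gradient, and it is `∞` when there is no (locally integrable) weak gradient. -/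
def relativeFisher {d : ℕ} (m Dstar : ℝ) (w : EuclideanSpace ℝ (Fin d) → ℝ) : ℝ≥0∞ :=
  ⨅ (G : EuclideanSpace ℝ (Fin d) → EuclideanSpace ℝ (Fin d))
    (_ : IsWeakGradient
      (fun x => (w x ^ (m - 1) - 1) * barenblatt m Dstar x ^ (m - 1)) G),
    ∫⁻ x, ENNReal.ofReal (m / (m - 1) ^ 2 * (‖G x‖ ^ 2 * w x * barenblatt m Dstar x))

/-- The number `h̄` in the Hardy-Poincaré quotient: the mean of `h` for the weight `V_D ^ (2 - m)`
if `m > m_*`, and `0` otherwise. -/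
def weightedMean {d : ℕ} (m D : ℝ) (h : EuclideanSpace ℝ (Fin d) → ℝ) : ℝ :=
  open Classical in
  if mStar d < m then
    (∫ x, h x * barenblatt m D x ^ (2 - m)) /
      ∫ x : EuclideanSpace ℝ (Fin d), barenblatt m D x ^ (2 - m)
  else 0

/-- Test functions of the Hardy-Poincaré quotient: smooth with compact support, and supported
away from the origin if `m < m_*`. -/
def IsTestFunction {d : ℕ} (m : ℝ) (h : EuclideanSpace ℝ (Fin d) → ℝ) : Prop :=
  ContDiff ℝ ∞ h ∧ HasCompactSupport h ∧ (m < mStar d → (0 : EuclideanSpace ℝ (Fin d)) ∉ tsupport h)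

/-- The Hardy-Poincaré constant
`m inf_h (∫ |∇h|² V_D dx) / (∫ |h - h̄|² V_D ^ (2 - m) dx)`,
the infimum being over the test functions for which the denominator does not vanish. -/
def hardyPoincare (d : ℕ) (m D : ℝ) : ℝ :=
  m * sInf {r : ℝ | ∃ h : EuclideanSpace ℝ (Fin d) → ℝ, IsTestFunction m h ∧
    (∫ x, |h x - weightedMean m D h| ^ 2 * barenblatt m D x ^ (2 - m)) ≠ 0 ∧
    r = (∫ x, ‖gradient h x‖ ^ 2 * barenblatt m D x) /
      ∫ x, |h x - weightedMean m D h| ^ 2 * barenblatt m D x ^ (2 - m)}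

/-- The explicit lower bound
`2 (m - C d (1 - m) [(W₁ / W₀) ^ (2 (2 - m)) - 1]) / (C W₀ ^ (m - 3) W₁ ^ (2 (2 - m)))`. -/
def rateBound (d : ℕ) (m C W₀ W₁ : ℝ) : ℝ :=
  2 * ((m - C * d * (1 - m) * ((W₁ / W₀) ^ (2 * (2 - m)) - 1)) /
    (C * W₀ ^ (m - 3) * W₁ ^ (2 * (2 - m))))

end FastDiffusion

end

/-! Write `D` for `D_*`, `c = (1-m)/(2m)`, `p = 1/(1-m)`, `U = V_D^(m-1) = D + c|x|²`, so that `V_D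
= U^(-p)` and `∇U = 2cx`. The entropy is quadratic to leading order: `F[w] ≤ ½ W₀^(m-2) J` with `J =
∫ (w-1)² V_D^m` (`IsAdmissible.entropy_bound`). For `h = (w-1)U` one has `∫ h² V_D^(2-m) = J`, and
`∫ h V_D^(2-m) = ∫ (w-1) V_D` vanishes if `m > m_*`, so the Hardy–Poincaré inequality gives `λ J ≤ m
∫ |∇h|² V_D`. It remains to bound this last integral by `I[w]`.

Put `X = U∇w`, `Y = ∇U`, `π(s) = (s^(m-1)-1)/(m-1)`. Then `∇h = X + (w-1)Y`, while the gradient in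
`I[w]` is `(m-1)(w^(m-2) X + π(w) Y)`. With `κ = W₁^(2(2-m))/W₀`, the coefficients of `|X|²` and
`|Y|²` in `|∇h|²` are dominated by those in `κ w |w^(m-2) X + π(w) Y|²`. The cross terms differ by
`Z'(w)⟨X,Y⟩ = 2cU x·∇Z(w)`, where `0 ≤ Z(s) ≤ ζ(s-1)²` and `ζ = (W₁/W₀)^(2(2-m)) - 1`
(`exists_fisher_comparison`). Integration by parts against the Euler field `x` bounds their
contribution by `2cd ∫ Z(w) V_D^m`, because `V_D^m` is radially nonincreasing. As `2cmd = d(1-m)`,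
this yields `(λ - d(1-m)ζ) J ≤ κ I[w]` (`hardyPoincare_le_fisher`), and the entropy bound turns it
into the rate `γ₀`.

Only a weak gradient is available, so `k = w^(m-1) U` is mollified and every integral is passed to
the limit. The test functions are cut off near infinity and, for the sake of `m < m_*`, near the
origin. The cutoff errors vanish since `|x||∇χ|` and `|w-1|U` are bounded and `|x|^(-2)` is locally
integrable for `d ≥ 3`.

Positivity of `λ` also rests on the Euler field (`integral_hardy_identity`): it gives a Hardy
inequality for `m < m_*`, and for `m > m_*` an estimate outside a large ball, completed by the
Poincaré inequality inside. Independence of `D` is a scaling (`hardyPoincareQuotients_subset`). -/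

noncomputable section

namespace FastDiffusion

set_option linter.unusedSectionVars false

open Set Filter Topology Module RealInnerProductSpace

section Euclidean

variable {E : Type*} [NormedAddCommGroup E] [InnerProductSpace ℝ E] [FiniteDimensional ℝ E]
  [MeasurableSpace E] [BorelSpace E]

/-! ### Integration by parts against the Euler field -/

/-- The integral of the divergence of `F x • x` vanishes for compactly supported `F`. -/
theorem integral_euler_eq_zero_of_hasCompactSupport {F : E → ℝ} (hF : ContDiff ℝ 1 F)
    (hc : HasCompactSupport F) : ∫ x, (finrank ℝ E * F x + fderiv ℝ F x x) = 0 := by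
  set b := stdOrthonormalBasis ℝ E with hb
  have hFd : Differentiable ℝ F := hF.differentiable one_ne_zero
  have hcont : Continuous (fderiv ℝ F) := hF.continuous_fderiv one_ne_zero
  have hc' : HasCompactSupport (fderiv ℝ F) := hc.fderiv ℝ
  have hint : ∀ i, Integrable (fun x => fderiv ℝ F x (b i) * ⟪b i, x⟫) := fun i => by
    apply Continuous.integrable_of_hasCompactSupport
    · fun_prop
    · apply HasCompactSupport.mul_right
      exact hc'.comp_left (g := fun L : E →L[ℝ] ℝ => L (b i)) rfl
  have hparts : ∀ i, ∫ x, F x = - ∫ x, fderiv ℝ F x (b i) * ⟪b i, x⟫ := fun i => by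
    have hd : ∀ x, fderiv ℝ (fun y : E => ⟪b i, y⟫) x (b i) = 1 := fun x => by
      have : HasFDerivAt (fun y : E => ⟪b i, y⟫) (innerSL ℝ (b i)) x :=
        (innerSL ℝ (b i)).hasFDerivAt
      rw [this.fderiv]
      simp
    rw [← integral_mul_fderiv_eq_neg_fderiv_mul_of_integrable (hint i)]
    · simp [hd]
    · simp only [hd, mul_one]
      exact hF.continuous.integrable_of_hasCompactSupport hc
    · apply Continuous.integrable_of_hasCompactSupport
      · fun_prop
      · exact hc.mul_right
    · intro x _; exact hFd x
    · intro x _; exact ((innerSL ℝ (b i)).differentiableAt)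
  have hsum : ∀ x, fderiv ℝ F x x = ∑ i, fderiv ℝ F x (b i) * ⟪b i, x⟫ := fun x => by
    have h := congrArg (fderiv ℝ F x) (b.sum_repr' x)
    rw [← h, map_sum]
    simp [mul_comm]
  have hintF : Integrable F := hF.continuous.integrable_of_hasCompactSupport hc
  simp_rw [hsum]
  rw [integral_add (hintF.const_mul _) (integrable_finsetSum _ fun i _ => hint i),
    integral_const_mul, integral_finsetSum _ fun i _ => hint i]
  have : ∀ i, ∫ x, fderiv ℝ F x (b i) * ⟪b i, x⟫ = - ∫ x, F x := fun i => by
    rw [hparts i, neg_neg]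
  simp [this]

/-! ### Cutoff functions -/

theorem hasFDerivAt_norm_sq (x : E) :
    HasFDerivAt (fun y : E => ‖y‖ ^ 2) ((2 : ℕ) • (innerSL ℝ x : E →L[ℝ] ℝ)) x :=
  (hasStrictFDerivAt_norm_sq x).hasFDerivAt

/-- A bound for the derivative of the smooth transition function. -/
theorem exists_bound_deriv_smoothTransition :
    ∃ C, 0 ≤ C ∧ ∀ t, |deriv Real.smoothTransition t| ≤ C := by
  have hc : Continuous (deriv Real.smoothTransition) :=
    (Real.smoothTransition.contDiff (n := 1)).continuous_deriv le_rfl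
  obtain ⟨C, hC⟩ := (isCompact_Icc (a := (-1 : ℝ)) (b := 2)).exists_bound_of_continuousOn
    hc.continuousOn
  refine ⟨C, (norm_nonneg _).trans (hC 0 (by norm_num)), fun t => ?_⟩
  by_cases ht : t ∈ Icc (-1 : ℝ) 2
  · exact hC t ht
  · have h0 : deriv Real.smoothTransition t = 0 := by
      rw [mem_Icc, not_and_or, not_le, not_le] at ht
      rcases ht with ht | ht
      · have : Real.smoothTransition =ᶠ[𝓝 t] fun _ => 0 := by
          filter_upwards [gt_mem_nhds ht] with s hs
          exact Real.smoothTransition.zero_of_nonpos (by linarith)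
        rw [this.deriv_eq]; simp
      · have : Real.smoothTransition =ᶠ[𝓝 t] fun _ => 1 := by
          filter_upwards [lt_mem_nhds ht] with s hs
          exact Real.smoothTransition.one_of_one_le (by linarith)
        rw [this.deriv_eq]; simp
    rw [h0, abs_zero]
    exact (norm_nonneg _).trans (hC 0 (by norm_num))

/-- The radial cutoff function equal to one for `2 / N ≤ ‖x‖² ≤ N`, and to zero outside
`1 / N ≤ ‖x‖² ≤ 2 N`. -/
def cutoff (N : ℝ) (x : E) : ℝ :=
  Real.smoothTransition (N * ‖x‖ ^ 2 - 1) * Real.smoothTransition (2 - N⁻¹ * ‖x‖ ^ 2)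

theorem contDiff_cutoff (N : ℝ) : ContDiff ℝ ∞ (cutoff N : E → ℝ) := by
  unfold cutoff
  have h1 : ContDiff ℝ ∞ fun x : E => ‖x‖ ^ 2 := contDiff_norm_sq ℝ
  exact (Real.smoothTransition.contDiff.comp ((contDiff_const.mul h1).sub contDiff_const)).mul
    (Real.smoothTransition.contDiff.comp (contDiff_const.sub (contDiff_const.mul h1)))

theorem cutoff_nonneg (N : ℝ) (x : E) : 0 ≤ cutoff N x :=
  mul_nonneg (Real.smoothTransition.nonneg _) (Real.smoothTransition.nonneg _)

theorem cutoff_le_one (N : ℝ) (x : E) : cutoff N x ≤ 1 :=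
  mul_le_one₀ (Real.smoothTransition.le_one _) (Real.smoothTransition.nonneg _)
    (Real.smoothTransition.le_one _)

theorem cutoff_eq_zero_of_large {N : ℝ} (hN : 0 < N) {x : E} (hx : 2 * N ≤ ‖x‖ ^ 2) :
    cutoff N x = 0 := by
  unfold cutoff
  rw [Real.smoothTransition.zero_of_nonpos (x := 2 - N⁻¹ * ‖x‖ ^ 2), mul_zero]
  have : N⁻¹ * (2 * N) ≤ N⁻¹ * ‖x‖ ^ 2 := by gcongr
  have h2 : N⁻¹ * (2 * N) = 2 := by field_simp
  linarith

theorem hasCompactSupport_cutoff {N : ℝ} (hN : 0 < N) :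
    HasCompactSupport (cutoff N : E → ℝ) := by
  refine HasCompactSupport.of_support_subset_isCompact
    (isCompact_closedBall (0 : E) (2 * N + 1)) fun x hx => ?_
  rw [mem_closedBall_zero_iff]
  by_contra h
  push Not at h
  exact hx (cutoff_eq_zero_of_large hN (by nlinarith))

theorem zero_notMem_tsupport_cutoff (N : ℝ) : (0 : E) ∉ tsupport (cutoff N : E → ℝ) := by
  rw [notMem_tsupport_iff_eventuallyEq]
  have : ∀ᶠ x : E in 𝓝 0, N * ‖x‖ ^ 2 < 1 := by
    have hc : Continuous fun x : E => N * ‖x‖ ^ 2 := by fun_prop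
    exact hc.continuousAt.eventually_lt continuousAt_const (by simp)
  filter_upwards [this] with x hx
  unfold cutoff
  rw [Real.smoothTransition.zero_of_nonpos (by linarith), zero_mul]; rfl

theorem eventually_cutoff_eq_one {x : E} (hx : x ≠ 0) :
    ∀ᶠ N : ℝ in atTop, cutoff N =ᶠ[𝓝 x] fun _ => 1 := by
  have hx2 : 0 < ‖x‖ ^ 2 := by positivity
  filter_upwards [eventually_gt_atTop (2 / ‖x‖ ^ 2), eventually_gt_atTop (‖x‖ ^ 2),
    eventually_gt_atTop 0] with N h1 h2 h3
  have hc : ∀ M : ℝ, Continuous fun x : E => M * ‖x‖ ^ 2 := fun M => by fun_prop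
  have e1 : 2 < N * ‖x‖ ^ 2 := by rwa [div_lt_iff₀ hx2] at h1
  have e2 : N⁻¹ * ‖x‖ ^ 2 < 1 := by rw [inv_mul_lt_iff₀ h3]; linarith
  filter_upwards [(hc N).continuousAt.eventually_const_lt e1,
    (hc N⁻¹).continuousAt.eventually_lt_const e2] with y h1 h2
  unfold cutoff
  rw [Real.smoothTransition.one_of_one_le (by linarith),
    Real.smoothTransition.one_of_one_le (by linarith), mul_one]

/-- The gradients of the cutoff functions are bounded by `C / ‖x‖`. -/
theorem exists_bound_fderiv_cutoff :
    ∃ C, 0 ≤ C ∧ ∀ N, 0 < N → ∀ x : E, ‖x‖ * ‖fderiv ℝ (cutoff N) x‖ ≤ C := by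
  obtain ⟨C, hC0, hC⟩ := exists_bound_deriv_smoothTransition
  -- The derivative of the transition vanishes as soon as `s > 2`. With `s = N‖x‖²` or `s = ‖x‖²/N`
  -- this makes the bound uniform in `N`.
  have key : ∀ t s : ℝ, s = t + 1 ∨ s = 2 - t → 0 ≤ s →
      |deriv Real.smoothTransition t| * s ≤ 2 * C := by
    intro t s hs h0
    by_cases h2 : s ≤ 2
    · nlinarith [hC t, abs_nonneg (deriv Real.smoothTransition t)]
    · push Not at h2
      have : deriv Real.smoothTransition t = 0 := by
        rcases hs with hs | hs
        · have : Real.smoothTransition =ᶠ[𝓝 t] fun _ => 1 := by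
            filter_upwards [lt_mem_nhds (show 1 < t by linarith)] with s hs
            exact Real.smoothTransition.one_of_one_le (by linarith)
          rw [this.deriv_eq]; simp
        · have : Real.smoothTransition =ᶠ[𝓝 t] fun _ => 0 := by
            filter_upwards [gt_mem_nhds (show t < 0 by linarith)] with s hs
            exact Real.smoothTransition.zero_of_nonpos (by linarith)
          rw [this.deriv_eq]; simp
      simp [this, hC0]
  refine ⟨8 * C, by positivity, fun N hN x => ?_⟩
  set a := N * ‖x‖ ^ 2 - 1
  set b := 2 - N⁻¹ * ‖x‖ ^ 2
  have hS : Differentiable ℝ Real.smoothTransition :=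
    (Real.smoothTransition.contDiff (n := 1)).differentiable one_ne_zero
  have d1 : HasFDerivAt (fun y : E => Real.smoothTransition (N * ‖y‖ ^ 2 - 1))
      (deriv Real.smoothTransition a • (N • ((2 : ℕ) • (innerSL ℝ x : E →L[ℝ] ℝ)))) x :=
    HasDerivAt.comp_hasFDerivAt (f := fun y : E => N * ‖y‖ ^ 2 - 1) x (hS a).hasDerivAt
      (((hasFDerivAt_norm_sq x).const_mul N).sub_const 1)
  have d2 : HasFDerivAt (fun y : E => Real.smoothTransition (2 - N⁻¹ * ‖y‖ ^ 2))
      (deriv Real.smoothTransition b • (-(N⁻¹ • ((2 : ℕ) • (innerSL ℝ x : E →L[ℝ] ℝ))))) x :=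
    HasDerivAt.comp_hasFDerivAt (f := fun y : E => 2 - N⁻¹ * ‖y‖ ^ 2) x (hS b).hasDerivAt
      (((hasFDerivAt_norm_sq x).const_mul N⁻¹).const_sub 2)
  have d3 : HasFDerivAt (cutoff N : E → ℝ) _ x := d1.mul d2
  rw [d3.fderiv]
  have hn : ‖(innerSL ℝ x : E →L[ℝ] ℝ)‖ = ‖x‖ := innerSL_apply_norm ℝ x
  have n1 : ‖deriv Real.smoothTransition a • (N • ((2 : ℕ) • (innerSL ℝ x : E →L[ℝ] ℝ)))‖
      ≤ |deriv Real.smoothTransition a| * (N * (2 * ‖x‖)) := by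
    rw [norm_smul, norm_smul, Real.norm_eq_abs, Real.norm_eq_abs, abs_of_pos hN, ← hn]
    gcongr
    simpa using norm_nsmul_le (n := 2) (a := (innerSL ℝ x : E →L[ℝ] ℝ))
  have n2 : ‖deriv Real.smoothTransition b • (-(N⁻¹ • ((2 : ℕ) • (innerSL ℝ x : E →L[ℝ] ℝ))))‖
      ≤ |deriv Real.smoothTransition b| * (N⁻¹ * (2 * ‖x‖)) := by
    rw [norm_smul, norm_neg, norm_smul, Real.norm_eq_abs, Real.norm_eq_abs,
      abs_of_pos (inv_pos.2 hN), ← hn]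
    gcongr
    simpa using norm_nsmul_le (n := 2) (a := (innerSL ℝ x : E →L[ℝ] ℝ))
  have k1 := key a (N * ‖x‖ ^ 2) (Or.inl (by simp [a])) (by positivity)
  have k2 := key b (N⁻¹ * ‖x‖ ^ 2) (Or.inr (by simp [b])) (by positivity)
  have sa := Real.smoothTransition.le_one a
  have sb := Real.smoothTransition.le_one b
  have sa0 := Real.smoothTransition.nonneg a
  have sb0 := Real.smoothTransition.nonneg b
  calc ‖x‖ * ‖_‖ ≤ ‖x‖ * (1 * (|deriv Real.smoothTransition b| * (N⁻¹ * (2 * ‖x‖))) +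
        1 * (|deriv Real.smoothTransition a| * (N * (2 * ‖x‖)))) := by
        gcongr
        refine (norm_add_le _ _).trans ?_
        refine add_le_add ?_ ?_
        · rw [norm_smul, Real.norm_of_nonneg sa0]
          gcongr
        · rw [norm_smul, Real.norm_of_nonneg sb0]
          gcongr
    _ = 2 * (|deriv Real.smoothTransition b| * (N⁻¹ * ‖x‖ ^ 2)) +
        2 * (|deriv Real.smoothTransition a| * (N * ‖x‖ ^ 2)) := by ring
    _ ≤ 8 * C := by linarith

/-- The integral of the divergence of `F x • x` vanishes as soon as `F` and the divergence are
integrable. -/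
theorem integral_euler_eq_zero [Nontrivial E] {F : E → ℝ} (hF : ContDiff ℝ 1 F)
    (hFi : Integrable F) (hdi : Integrable fun x => finrank ℝ E * F x + fderiv ℝ F x x) :
    ∫ x, (finrank ℝ E * F x + fderiv ℝ F x x) = 0 := by
  obtain ⟨C, hC0, hC⟩ := exists_bound_fderiv_cutoff (E := E)
  have hne : ∀ᵐ x : E, x ≠ 0 := by
    simp [ae_iff]
  have hn : ∀ n : ℕ, (0 : ℝ) < (n : ℝ) + 1 := fun n => by positivity
  have htop : Tendsto (fun n : ℕ => (n : ℝ) + 1) atTop atTop :=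
    tendsto_atTop_add_const_right _ _ tendsto_natCast_atTop_atTop
  have hFd : Differentiable ℝ F := hF.differentiable one_ne_zero
  have hχ : ∀ N, ContDiff ℝ 1 (cutoff N : E → ℝ) := fun N => (contDiff_cutoff N).of_le (by simp)
  have hχd : ∀ N, Differentiable ℝ (cutoff N : E → ℝ) :=
    fun N => (hχ N).differentiable one_ne_zero
  have hχf : ∀ N, Continuous (fun x : E => fderiv ℝ (cutoff N) x x) := fun N =>
    ((hχ N).continuous_fderiv one_ne_zero).clm_apply continuous_id
  have hFf : Continuous (fun x : E => fderiv ℝ F x x) :=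
    (hF.continuous_fderiv one_ne_zero).clm_apply continuous_id
  have hz : ∀ n : ℕ, ∫ x : E, (cutoff ((n : ℝ) + 1) x * (finrank ℝ E * F x + fderiv ℝ F x x)
      + fderiv ℝ (cutoff ((n : ℝ) + 1)) x x * F x) = 0 := fun n => by
    rw [← integral_euler_eq_zero_of_hasCompactSupport ((hχ ((n : ℝ) + 1)).mul hF)
      ((hasCompactSupport_cutoff (hn n)).mul_right)]
    congr 1
    ext x
    change _ = _ + fderiv ℝ (cutoff ((n : ℝ) + 1) * F) x x
    rw [fderiv_mul (hχd _ x) (hFd x)]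
    simp only [add_apply, smul_apply, smul_eq_mul]
    ring
  -- The bound on `‖x‖ ‖∇χ‖` dominates the commutator term by `C|F|`, so integrability of `F`
  -- replaces any decay assumption.
  have hlim := tendsto_integral_of_dominated_convergence (μ := (volume : Measure E))
    (F := fun n : ℕ => fun x : E =>
      cutoff ((n : ℝ) + 1) x * (finrank ℝ E * F x + fderiv ℝ F x x)
      + fderiv ℝ (cutoff ((n : ℝ) + 1)) x x * F x)
    (f := fun x => finrank ℝ E * F x + fderiv ℝ F x x)
    (fun x => ‖finrank ℝ E * F x + fderiv ℝ F x x‖ + C * ‖F x‖)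
    (fun n => by
      apply Continuous.aestronglyMeasurable
      have := (hχ ((n : ℝ) + 1)).continuous
      have := hF.continuous
      have := hχf ((n : ℝ) + 1)
      fun_prop)
    (hdi.norm.add (hFi.norm.const_mul C))
    (fun n => ae_of_all _ fun x => by
      refine (norm_add_le _ _).trans (add_le_add ?_ ?_)
      · rw [norm_mul, Real.norm_of_nonneg (cutoff_nonneg _ _)]
        exact mul_le_of_le_one_left (norm_nonneg _) (cutoff_le_one _ _)
      · rw [norm_mul]
        gcongr
        refine (ContinuousLinearMap.le_opNorm _ _).trans ?_
        rw [mul_comm]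
        exact hC _ (hn n) x)
    (by
      filter_upwards [hne] with x hx
      refine tendsto_const_nhds.congr' ?_
      filter_upwards [htop.eventually (eventually_cutoff_eq_one hx)] with n hn
      rw [hn.fderiv_eq, hn.self_of_nhds]
      simp)
  simp only [hz] at hlim
  exact (tendsto_nhds_unique hlim tendsto_const_nhds)

/-! ### The Poincaré inequality on balls -/

theorem lintegral_comp_add_smul (q : E → ℝ≥0∞) (hq : Measurable q) (a : E) {t : ℝ}
    (ht : 0 < t) :
    ∫⁻ x, q (a + t • x) = ENNReal.ofReal ((t ^ finrank ℝ E)⁻¹) * ∫⁻ x, q x := by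
  have h1 : ∫⁻ x, q (a + t • x) = ∫⁻ y, q (a + y) ∂(Measure.map (fun x : E => t • x) volume) := by
    rw [lintegral_map (by fun_prop) (by fun_prop)]
  rw [h1, Measure.map_addHaar_smul volume ht.ne', lintegral_smul_measure,
    lintegral_add_left_eq_self, abs_of_pos (by positivity), smul_eq_mul]

/-- Cauchy-Schwarz on the unit interval. -/
theorem sq_intervalIntegral_le {g : ℝ → ℝ} (hg : Continuous g) :
    (∫ t in (0 : ℝ)..1, g t) ^ 2 ≤ ∫ t in (0 : ℝ)..1, g t ^ 2 := by
  set a := ∫ t in (0 : ℝ)..1, g t with ha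
  have h0 : 0 ≤ ∫ t in (0 : ℝ)..1, (g t - a) ^ 2 :=
    intervalIntegral.integral_nonneg zero_le_one fun t _ => sq_nonneg _
  have h1 : ∫ t in (0 : ℝ)..1, (g t - a) ^ 2 =
      (∫ t in (0 : ℝ)..1, g t ^ 2) - 2 * a * a + a ^ 2 := by
    have : ∀ t, (g t - a) ^ 2 = g t ^ 2 - 2 * a * g t + a ^ 2 := fun t => by ring
    simp_rw [this]
    rw [intervalIntegral.integral_add, intervalIntegral.integral_sub,
      intervalIntegral.integral_const_mul, ← ha]
    · simp
    all_goals exact Continuous.intervalIntegrable (by fun_prop) _ _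
  nlinarith

/-- Integrate the derivative along the segment from `y` to `x` and apply Cauchy–Schwarz in `t`; the
diameter `2R` gives the constant. By convexity the indicator costs nothing, and it allows later
changes of variables over the whole space. -/
theorem ofReal_sq_sub_le {f : E → ℝ} (hf : ContDiff ℝ 1 f) {R : ℝ} {x y : E}
    (hx : x ∈ Metric.closedBall (0 : E) R) (hy : y ∈ Metric.closedBall (0 : E) R) :
    ENNReal.ofReal ((f x - f y) ^ 2) ≤ ENNReal.ofReal (4 * R ^ 2) * ∫⁻ t in Icc (0 : ℝ) 1,
      (Metric.closedBall (0 : E) R).indicator (fun z => ENNReal.ofReal (‖fderiv ℝ f z‖ ^ 2))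
        ((1 - t) • y + t • x) := by
  have hcont : Continuous (fderiv ℝ f) := hf.continuous_fderiv one_ne_zero
  have hγ : ∀ t : ℝ, HasDerivAt (fun t : ℝ => (1 - t) • y + t • x) (x - y) t := fun t => by
    have := (((hasDerivAt_id t).const_sub 1).smul_const y).add ((hasDerivAt_id t).smul_const x)
    rw [show x - y = (-1 : ℝ) • y + (1 : ℝ) • x by rw [neg_one_smul, one_smul, neg_add_eq_sub]]
    exact this
  have hγc : Continuous fun t : ℝ => (1 - t) • y + t • x := by fun_prop
  set g : ℝ → ℝ := fun t => fderiv ℝ f ((1 - t) • y + t • x) (x - y) with hg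
  have hgc : Continuous g := (hcont.comp hγc).clm_apply continuous_const
  have hftc : ∫ t in (0 : ℝ)..1, g t = f x - f y := by
    rw [intervalIntegral.integral_eq_sub_of_hasDerivAt
      (f := fun t : ℝ => f ((1 - t) • y + t • x)) (fun t _ => ?_) (hgc.intervalIntegrable _ _)]
    · simp
    · exact ((hf.differentiable one_ne_zero _).hasFDerivAt).comp_hasDerivAt t (hγ t)
  have hxy : ‖x - y‖ ^ 2 ≤ 4 * R ^ 2 := by
    rw [mem_closedBall_zero_iff] at hx hy
    have := norm_sub_le x y
    have h0 := norm_nonneg (x - y)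
    nlinarith
  have hmem : ∀ t ∈ Icc (0 : ℝ) 1, (1 - t) • y + t • x ∈ Metric.closedBall (0 : E) R :=
    fun t ht => convex_closedBall 0 R hy hx (by linarith [ht.2]) ht.1 (by ring)
  have hle : (f x - f y) ^ 2 ≤
      ∫ t in (0 : ℝ)..1, 4 * R ^ 2 * ‖fderiv ℝ f ((1 - t) • y + t • x)‖ ^ 2 := by
    rw [← hftc]
    refine (sq_intervalIntegral_le hgc).trans ?_
    refine intervalIntegral.integral_mono_on zero_le_one ?_ ?_ fun t _ => ?_
    · exact (hgc.pow 2).intervalIntegrable _ _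
    · exact (continuous_const.mul ((hcont.comp hγc).norm.pow 2)).intervalIntegrable _ _
    · have h := (fderiv ℝ f ((1 - t) • y + t • x)).le_opNorm (x - y)
      rw [← sq_abs, ← Real.norm_eq_abs]
      calc ‖g t‖ ^ 2 ≤ (‖fderiv ℝ f ((1 - t) • y + t • x)‖ * ‖x - y‖) ^ 2 := by gcongr
        _ = ‖x - y‖ ^ 2 * ‖fderiv ℝ f ((1 - t) • y + t • x)‖ ^ 2 := by ring
        _ ≤ _ := by gcongr
  refine (ENNReal.ofReal_le_ofReal hle).trans ?_
  rw [intervalIntegral.integral_of_le zero_le_one, ← integral_Icc_eq_integral_Ioc,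
    integral_const_mul, ENNReal.ofReal_mul (by positivity)]
  gcongr
  rw [ofReal_integral_eq_lintegral_ofReal]
  · refine setLIntegral_mono' measurableSet_Icc fun t ht => ?_
    rw [indicator_of_mem (hmem t ht)]
  · exact ((hcont.comp hγc).norm.pow 2).continuousOn.integrableOn_compact isCompact_Icc
  · exact ae_of_all _ fun t => by positivity

/-- One of `t` and `1 - t` is at least `1/2`. Changing variables in the endpoint that carries this
factor costs at most `2 ^ finrank ℝ E`. -/
theorem lintegral_segment_le (q : E → ℝ≥0∞) (hq : Measurable q) (R t : ℝ) :
    ∫⁻ y in Metric.closedBall (0 : E) R, ∫⁻ x in Metric.closedBall (0 : E) R,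
      q ((1 - t) • y + t • x) ≤
      ENNReal.ofReal (2 ^ finrank ℝ E) * volume (Metric.closedBall (0 : E) R) * ∫⁻ z, q z := by
  have key : ∀ s : ℝ, 1 / 2 ≤ s → ∀ a : E, ∫⁻ x in Metric.closedBall (0 : E) R,
      q (a + s • x) ≤ ENNReal.ofReal (2 ^ finrank ℝ E) * ∫⁻ z, q z := fun s hs a => by
    refine (setLIntegral_le_lintegral _ _).trans ?_
    rw [lintegral_comp_add_smul q hq a (by linarith)]
    gcongr
    rw [← inv_pow]
    gcongr
    rw [inv_le_comm₀ (by linarith) (by norm_num)]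
    linarith
  have key2 : ∀ s : ℝ, 1 / 2 ≤ s → ∀ r : ℝ, ∫⁻ y in Metric.closedBall (0 : E) R,
      ∫⁻ x in Metric.closedBall (0 : E) R, q (r • y + s • x) ≤
      ENNReal.ofReal (2 ^ finrank ℝ E) * volume (Metric.closedBall (0 : E) R) * ∫⁻ z, q z :=
    fun s hs r => by
      refine (lintegral_mono fun y => key s hs (r • y)).trans ?_
      rw [lintegral_const, Measure.restrict_apply_univ]
      exact le_of_eq (by ring)
  rcases le_total (1 / 2) t with h | h
  · exact key2 t h (1 - t)
  · rw [lintegral_lintegral_swap (by fun_prop)]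
    refine le_trans (le_of_eq ?_) (key2 (1 - t) (by linarith) t)
    simp_rw [add_comm]

/-- The Poincaré inequality on a ball; the constant is a value of the function. -/
theorem poincare_closedBall {R : ℝ} (hR : 0 < R) {f : E → ℝ} (hf : ContDiff ℝ 1 f) :
    ∃ a : ℝ, ∫ x in Metric.closedBall (0 : E) R, (f x - a) ^ 2 ≤
      4 * R ^ 2 * 2 ^ finrank ℝ E * ∫ x in Metric.closedBall (0 : E) R, ‖fderiv ℝ f x‖ ^ 2 := by
  set B := Metric.closedBall (0 : E) R with hB
  have hcont : Continuous (fderiv ℝ f) := hf.continuous_fderiv one_ne_zero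
  have hfc := hf.continuous
  set q : E → ℝ≥0∞ := B.indicator fun z => ENNReal.ofReal (‖fderiv ℝ f z‖ ^ 2) with hq
  have hqm : Measurable q :=
    (ENNReal.measurable_ofReal.comp (hcont.norm.pow 2).measurable).indicator
      Metric.isClosed_closedBall.measurableSet
  have hBm : MeasurableSet B := Metric.isClosed_closedBall.measurableSet
  have hB0 : volume B ≠ 0 := (Metric.measure_closedBall_pos volume 0 hR).ne'
  have hBt : volume B ≠ ⊤ := (isCompact_closedBall (0 : E) R).measure_ne_top
  set K := ENNReal.ofReal (4 * R ^ 2) * ENNReal.ofReal (2 ^ finrank ℝ E) * ∫⁻ z, q z with hK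
  have hdouble : ∫⁻ y in B, ∫⁻ x in B, ENNReal.ofReal ((f x - f y) ^ 2) ≤ K * volume B := by
    calc ∫⁻ y in B, ∫⁻ x in B, ENNReal.ofReal ((f x - f y) ^ 2)
        ≤ ∫⁻ y in B, ∫⁻ x in B, ENNReal.ofReal (4 * R ^ 2) * ∫⁻ t in Icc (0 : ℝ) 1,
            q ((1 - t) • y + t • x) :=
          setLIntegral_mono' hBm fun y hy => setLIntegral_mono' hBm fun x hx =>
            ofReal_sq_sub_le hf hx hy
      _ = ENNReal.ofReal (4 * R ^ 2) * ∫⁻ y in B, ∫⁻ x in B, ∫⁻ t in Icc (0 : ℝ) 1,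
            q ((1 - t) • y + t • x) := by
          rw [← lintegral_const_mul' _ _ ENNReal.ofReal_ne_top]
          congr 1; ext y
          rw [lintegral_const_mul' _ _ ENNReal.ofReal_ne_top]
      _ = ENNReal.ofReal (4 * R ^ 2) * ∫⁻ t in Icc (0 : ℝ) 1, ∫⁻ y in B, ∫⁻ x in B,
            q ((1 - t) • y + t • x) := by
          congr 1
          rw [lintegral_lintegral_swap (f := fun (t : ℝ) (y : E) => ∫⁻ x in B,
            q ((1 - t) • y + t • x))]
          · congr 1; ext y
            rw [lintegral_lintegral_swap]
            fun_prop
          · apply Measurable.aemeasurable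
            apply Measurable.lintegral_prod_right' (f := fun z : (ℝ × E) × E =>
              q ((1 - z.1.1) • z.1.2 + z.1.1 • z.2))
            fun_prop
      _ ≤ ENNReal.ofReal (4 * R ^ 2) * ∫⁻ t in Icc (0 : ℝ) 1,
            ENNReal.ofReal (2 ^ finrank ℝ E) * volume B * ∫⁻ z, q z := by
          refine mul_le_mul_right ?_ _
          exact setLIntegral_mono' measurableSet_Icc fun t _ => lintegral_segment_le q hqm R t
      _ = K * volume B := by
          rw [setLIntegral_const]
          simp [hK]
          ring
  -- Some `y` does no worse than the average over the ball; `f y` is then the constant to subtract.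
  obtain ⟨y, -, hy⟩ := exists_le_setLAverage hB0 hBt
    (f := fun y => ∫⁻ x in B, ENNReal.ofReal ((f x - f y) ^ 2)) (by
      apply Measurable.aemeasurable
      apply Measurable.lintegral_prod_right' (f := fun z : E × E =>
              ENNReal.ofReal ((f z.2 - f z.1) ^ 2))
      fun_prop)
  refine ⟨f y, ?_⟩
  have hy' : ∫⁻ x in B, ENNReal.ofReal ((f x - f y) ^ 2) ≤ K := by
    refine hy.trans ?_
    rw [setLAverage_eq]
    exact ENNReal.div_le_of_le_mul hdouble
  have hqi : ∫⁻ z, q z = ENNReal.ofReal (∫ x in B, ‖fderiv ℝ f x‖ ^ 2) := by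
    rw [hq, lintegral_indicator hBm, ofReal_integral_eq_lintegral_ofReal]
    · exact ((hcont.norm.pow 2).continuousOn.integrableOn_compact (isCompact_closedBall _ _))
    · exact ae_of_all _ fun t => by positivity
  have hfi : Integrable (fun x => (f x - f y) ^ 2) (volume.restrict B) := by
    have : Continuous fun x => (f x - f y) ^ 2 := by fun_prop
    exact this.continuousOn.integrableOn_compact (isCompact_closedBall _ _)
  rw [← ofReal_integral_eq_lintegral_ofReal hfi (ae_of_all _ fun t => by positivity), hK, hqi,
    ← ENNReal.ofReal_mul (by positivity), ← ENNReal.ofReal_mul (by positivity)] at hy'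
  rwa [ENNReal.ofReal_le_ofReal_iff] at hy'
  have : 0 ≤ ∫ x in B, ‖fderiv ℝ f x‖ ^ 2 := integral_nonneg fun x => by positivity
  positivity

/-! ### Powers of a radial quadratic polynomial -/

/-- The radial polynomial `D + c ‖x‖²`. -/
def quad (c D : ℝ) (x : E) : ℝ := D + c * ‖x‖ ^ 2

/-- The weight `(D + c ‖x‖²) ^ (-q)`. -/
def weight (c D q : ℝ) (x : E) : ℝ := quad c D x ^ (-q)

section Weight

variable {c D : ℝ} (hc : 0 < c) (hD : 0 < D)
include hc hD

theorem le_quad (x : E) : D ≤ quad c D x := by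
  unfold quad; nlinarith [sq_nonneg ‖x‖, mul_nonneg hc.le (sq_nonneg ‖x‖)]

theorem quad_pos (x : E) : 0 < quad c D x := hD.trans_le (le_quad hc hD x)

theorem mul_norm_sq_le_quad (x : E) : c * ‖x‖ ^ 2 ≤ quad c D x := by
  unfold quad; linarith

theorem weight_pos (q : ℝ) (x : E) : 0 < weight c D q x :=
  Real.rpow_pos_of_pos (quad_pos hc hD x) _

theorem weight_add (q r : ℝ) (x : E) :
    weight c D (q + r) x = weight c D q x * weight c D r x := by
  unfold weight
  rw [← Real.rpow_add (quad_pos hc hD x)]; ring_nf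

theorem weight_neg_one (x : E) : weight c D (-1) x = quad c D x := by
  unfold weight; simp

theorem weight_one (x : E) : weight c D 1 x = (quad c D x)⁻¹ := by
  unfold weight; rw [Real.rpow_neg_one]

theorem weight_add_one (q : ℝ) (x : E) : weight c D (q + 1) x = weight c D q x / quad c D x := by
  rw [weight_add hc hD, weight_one hc hD, div_eq_mul_inv]

theorem weight_sub_one (q : ℝ) (x : E) : weight c D (q - 1) x = weight c D q x * quad c D x := by
  rw [sub_eq_add_neg, weight_add hc hD, weight_neg_one hc hD]

theorem norm_sq_mul_weight_le (q : ℝ) (x : E) :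
    ‖x‖ ^ 2 * weight c D q x ≤ c⁻¹ * weight c D (q - 1) x := by
  rw [weight_sub_one hc hD, inv_mul_eq_div, le_div_iff₀ hc]
  nlinarith [mul_norm_sq_le_quad hc hD x, weight_pos hc hD q x]

omit hc hD in
theorem contDiff_quad : ContDiff ℝ ∞ (quad c D : E → ℝ) := by
  unfold quad
  exact contDiff_const.add (contDiff_const.mul (contDiff_norm_sq ℝ))

theorem contDiff_weight (q : ℝ) : ContDiff ℝ ∞ (weight c D q : E → ℝ) :=
  contDiff_quad.rpow_const_of_ne fun x => (quad_pos hc hD x).ne'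

omit hc hD in
theorem hasFDerivAt_quad (x : E) :
    HasFDerivAt (quad c D : E → ℝ) ((2 * c) • (innerSL ℝ x : E →L[ℝ] ℝ)) x := by
  have := ((hasFDerivAt_norm_sq x).const_mul c).const_add D
  refine this.congr_fderiv ?_
  rw [← Nat.cast_smul_eq_nsmul ℝ, smul_smul]
  congr 1
  push_cast; ring

theorem hasFDerivAt_weight (q : ℝ) (x : E) :
    HasFDerivAt (weight c D q : E → ℝ)
      ((-(2 * c * q) * weight c D (q + 1) x) • (innerSL ℝ x : E →L[ℝ] ℝ)) x := by
  have := (hasFDerivAt_quad (c := c) (D := D) x).rpow_const (p := -q)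
    (Or.inl (quad_pos hc hD x).ne')
  refine this.congr_fderiv ?_
  rw [smul_smul]
  congr 1
  unfold weight
  ring_nf

/-- Since `c‖x‖² = U - D`, the Euler derivative splits into a multiple of the same weight and a term
of lower order at infinity. -/
theorem fderiv_weight_self (q : ℝ) (x : E) :
    fderiv ℝ (weight c D q : E → ℝ) x x =
      -(2 * q) * weight c D q x + 2 * q * D * weight c D (q + 1) x := by
  rw [(hasFDerivAt_weight hc hD q x).fderiv]
  have h1 : weight c D q x = weight c D (q + 1) x * quad c D x := by
    rw [← weight_sub_one hc hD]; ring_nf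
  simp only [smul_apply, innerSL_apply_apply, real_inner_self_eq_norm_sq, smul_eq_mul]
  rw [h1]
  unfold quad
  ring

theorem integrable_weight {q : ℝ} (hq : finrank ℝ E < 2 * q) :
    Integrable (weight c D q : E → ℝ) := by
  have h := (integrable_rpow_neg_one_add_norm_sq (μ := (volume : Measure E)) hq)
  have hq0 : 0 ≤ q := by
    have : (0 : ℝ) ≤ finrank ℝ E := by positivity
    linarith
  refine (h.const_mul (min c D ^ (-q))).mono'
    (contDiff_weight hc hD q).continuous.aestronglyMeasurable (ae_of_all _ fun x => ?_)
  rw [Real.norm_of_nonneg (weight_pos hc hD q x).le]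
  have hm : 0 < min c D := lt_min hc hD
  rw [show -(2 * q) / 2 = -q by ring, ← Real.mul_rpow hm.le (by positivity)]
  refine Real.rpow_le_rpow_of_nonpos (by positivity) ?_ (by linarith)
  unfold quad
  nlinarith [min_le_left c D, min_le_right c D, sq_nonneg ‖x‖]

theorem weight_le (q : ℝ) (hq : 0 ≤ q) (x : E) : weight c D q x ≤ D ^ (-q) :=
  Real.rpow_le_rpow_of_nonpos hD (le_quad hc hD x) (by linarith)

end Weight

/-! ### Weighted Hardy and Poincaré inequalities -/

section Hardy

variable {c D : ℝ} (hc : 0 < c) (hD : 0 < D)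
include hc hD

/-- The divergence of `f² U^(-q) x` has integral zero. For `q ≥ 0` and `2q` below the dimension, the
`D`-term has the favourable sign; for `2q` above the dimension it has to be absorbed, which its
faster decaying weight permits away from the origin. -/
theorem integral_hardy_identity [Nontrivial E] (q : ℝ) {f : E → ℝ} (hf : ContDiff ℝ 1 f)
    (h1 : Integrable fun x => f x ^ 2 * weight c D q x)
    (h2 : Integrable fun x => f x * fderiv ℝ f x x * weight c D q x) :
    (finrank ℝ E - 2 * q) * ∫ x, f x ^ 2 * weight c D q x =
      -(2 * q * D) * (∫ x, f x ^ 2 * weight c D (q + 1) x) -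
      2 * ∫ x, f x * fderiv ℝ f x x * weight c D q x := by
  have h3 : Integrable fun x => f x ^ 2 * weight c D (q + 1) x := by
    refine (h1.const_mul D⁻¹).mono' ?_ (ae_of_all _ fun x => ?_)
    · exact ((hf.continuous.pow 2).mul
        (contDiff_weight hc hD (q + 1)).continuous).aestronglyMeasurable
    · have hw := weight_pos hc hD (q + 1) x
      rw [Real.norm_of_nonneg (by positivity), inv_mul_eq_div, le_div_iff₀ hD]
      have h1 : weight c D q x = weight c D (q + 1) x * quad c D x := by
        rw [← weight_sub_one hc hD]; ring_nf
      rw [h1, mul_assoc]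
      gcongr
      exact le_quad hc hD x
  have hd : ∀ x, finrank ℝ E * (f x ^ 2 * weight c D q x) +
      fderiv ℝ (fun x => f x ^ 2 * weight c D q x) x x =
      (finrank ℝ E - 2 * q) * (f x ^ 2 * weight c D q x) +
      (2 * q * D) * (f x ^ 2 * weight c D (q + 1) x) +
      2 * (f x * fderiv ℝ f x x * weight c D q x) := fun x => by
    have hfd := (hf.differentiable one_ne_zero x).hasFDerivAt
    have hwd := (((contDiff_weight (E := E) hc hD q).differentiable (by simp)) x).hasFDerivAt
    have := (hfd.pow 2).mul hwd
    have h4 : fderiv ℝ (fun x => f x ^ 2 * weight c D q x) x = _ := this.fderiv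
    rw [h4]
    simp only [add_apply, smul_apply, smul_eq_mul, fderiv_weight_self hc hD]
    simp
    ring
  have hI1 : Integrable fun x => (finrank ℝ E - 2 * q) * (f x ^ 2 * weight c D q x) +
      (2 * q * D) * (f x ^ 2 * weight c D (q + 1) x) :=
    (h1.const_mul (finrank ℝ E - 2 * q)).add (h3.const_mul (2 * q * D))
  have hI := hI1.add (h2.const_mul 2)
  have hz := integral_euler_eq_zero
    ((hf.pow 2).mul ((contDiff_weight hc hD q).of_le (by simp))) h1
    (hI.congr (ae_of_all _ fun x => (hd x).symm))
  rw [integral_congr_ae (ae_of_all _ hd)] at hz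
  rw [integral_add hI1 (h2.const_mul _),
    integral_add (h1.const_mul _) (h3.const_mul _), integral_const_mul, integral_const_mul,
    integral_const_mul] at hz
  linarith

/-- Young's inequality with parameter `δ`; the factor `‖x‖²` is paid for by one power of `U`. -/
theorem abs_euler_mul_weight_le (q : ℝ) {δ : ℝ} (hδ : 0 < δ) (f : E → ℝ) (x : E) :
    |2 * (f x * fderiv ℝ f x x * weight c D q x)| ≤ δ * (f x ^ 2 * weight c D q x) +
      (δ * c)⁻¹ * (‖fderiv ℝ f x‖ ^ 2 * weight c D (q - 1) x) := by
  have hw := weight_pos hc hD q x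
  have h1 := norm_sq_mul_weight_le hc hD q x
  have h2 : |fderiv ℝ f x x| ≤ ‖fderiv ℝ f x‖ * ‖x‖ := (fderiv ℝ f x).le_opNorm x
  have h3 : 2 * (|f x| * |fderiv ℝ f x x|) ≤
      δ * f x ^ 2 + δ⁻¹ * (‖fderiv ℝ f x‖ * ‖x‖) ^ 2 := by
    have h5 : fderiv ℝ f x x ^ 2 ≤ (‖fderiv ℝ f x‖ * ‖x‖) ^ 2 := by
      rw [← sq_abs]; gcongr
    have h6 : 0 ≤ δ⁻¹ * (δ * |f x| - |fderiv ℝ f x x|) ^ 2 := by positivity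
    have h7 : δ⁻¹ * (δ * |f x| - |fderiv ℝ f x x|) ^ 2 = δ * f x ^ 2 -
        2 * (|f x| * |fderiv ℝ f x x|) + δ⁻¹ * fderiv ℝ f x x ^ 2 := by
      rw [← sq_abs (f x), ← sq_abs (fderiv ℝ f x x)]
      field_simp
      ring
    have h8 : δ⁻¹ * fderiv ℝ f x x ^ 2 ≤ δ⁻¹ * (‖fderiv ℝ f x‖ * ‖x‖) ^ 2 := by gcongr
    linarith
  rw [abs_mul, abs_mul, abs_mul, abs_of_pos hw, abs_two]
  calc 2 * (|f x| * |fderiv ℝ f x x| * weight c D q x)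
      = 2 * (|f x| * |fderiv ℝ f x x|) * weight c D q x := by ring
    _ ≤ (δ * f x ^ 2 + δ⁻¹ * (‖fderiv ℝ f x‖ * ‖x‖) ^ 2) * weight c D q x := by gcongr
    _ = δ * (f x ^ 2 * weight c D q x) +
        δ⁻¹ * ‖fderiv ℝ f x‖ ^ 2 * (‖x‖ ^ 2 * weight c D q x) := by ring
    _ ≤ δ * (f x ^ 2 * weight c D q x) +
        δ⁻¹ * ‖fderiv ℝ f x‖ ^ 2 * (c⁻¹ * weight c D (q - 1) x) := by gcongr
    _ = _ := by rw [mul_inv]; ring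

theorem abs_integral_euler_mul_weight_le (q : ℝ) {δ : ℝ} (hδ : 0 < δ) {f : E → ℝ}
    (h1 : Integrable fun x => f x ^ 2 * weight c D q x)
    (h2 : Integrable fun x => ‖fderiv ℝ f x‖ ^ 2 * weight c D (q - 1) x) :
    |2 * ∫ x, f x * fderiv ℝ f x x * weight c D q x| ≤ δ * (∫ x, f x ^ 2 * weight c D q x) +
      (δ * c)⁻¹ * ∫ x, ‖fderiv ℝ f x‖ ^ 2 * weight c D (q - 1) x := by
  rw [← integral_const_mul, ← integral_const_mul, ← integral_const_mul,
    ← integral_add (h1.const_mul _) (h2.const_mul _), ← Real.norm_eq_abs]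
  refine norm_integral_le_of_norm_le ((h1.const_mul _).add (h2.const_mul _))
    (ae_of_all _ fun x => abs_euler_mul_weight_le hc hD q hδ f x)

/-- The weighted Hardy inequality below the critical exponent. -/
theorem hardy_inequality [Nontrivial E] {q : ℝ} (hq0 : 0 ≤ q) (hq : 2 * q < finrank ℝ E)
    {f : E → ℝ} (hf : ContDiff ℝ 1 f) (hfc : HasCompactSupport f) :
    (∫ x, f x ^ 2 * weight c D q x) ≤ 4 / ((finrank ℝ E - 2 * q) ^ 2 * c) *
      ∫ x, ‖fderiv ℝ f x‖ ^ 2 * weight c D (q - 1) x := by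
  have hcont : Continuous (fderiv ℝ f) := hf.continuous_fderiv one_ne_zero
  have hfcont := hf.continuous
  have hw : ∀ r, Continuous (weight c D r : E → ℝ) := fun r => (contDiff_weight hc hD r).continuous
  have hw0 := hw q
  have hw1 := hw (q - 1)
  have h1 : Integrable fun x => f x ^ 2 * weight c D q x := by
    apply Continuous.integrable_of_hasCompactSupport (by fun_prop)
    exact (hfc.comp_left (g := fun t : ℝ => t ^ 2) (by simp)).mul_right
  have h3 : Integrable fun x => f x * fderiv ℝ f x x * weight c D q x := by
    apply Continuous.integrable_of_hasCompactSupport (by fun_prop)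
    exact (hfc.mul_right).mul_right
  have h2 : Integrable fun x => ‖fderiv ℝ f x‖ ^ 2 * weight c D (q - 1) x := by
    apply Continuous.integrable_of_hasCompactSupport (by fun_prop)
    exact ((hfc.fderiv ℝ).comp_left (g := fun t : E →L[ℝ] ℝ => ‖t‖ ^ 2) (by simp)).mul_right
  set δ := finrank ℝ E - 2 * q with hδ
  have hδ0 : 0 < δ := by linarith
  have hid := integral_hardy_identity hc hD q hf h1 h3
  rw [← hδ] at hid
  have hle := abs_integral_euler_mul_weight_le hc hD q (half_pos hδ0) h1 h2
  have hpos : 0 ≤ ∫ x, f x ^ 2 * weight c D (q + 1) x :=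
    integral_nonneg fun x => mul_nonneg (sq_nonneg _) (weight_pos hc hD _ x).le
  have hpos2 : 0 ≤ 2 * q * D * ∫ x, f x ^ 2 * weight c D (q + 1) x := by positivity
  have hab := neg_le_of_abs_le hle
  set A := ∫ x, f x ^ 2 * weight c D q x
  set B := ∫ x, ‖fderiv ℝ f x‖ ^ 2 * weight c D (q - 1) x
  have hfin : δ / 2 * A ≤ (δ / 2 * c)⁻¹ * B := by linarith
  calc A = (δ / 2)⁻¹ * (δ / 2 * A) := by field_simp
    _ ≤ (δ / 2)⁻¹ * ((δ / 2 * c)⁻¹ * B) := by gcongr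
    _ = 4 / (δ ^ 2 * c) * B := by field_simp; ring

/-- The weighted Poincaré inequality above the critical exponent. -/
theorem exists_weighted_poincare [Nontrivial E] {q : ℝ} (hq : finrank ℝ E < 2 * q)
    (hq1 : 1 ≤ q) :
    ∃ K, 0 < K ∧ ∀ h : E → ℝ, ContDiff ℝ 1 h → HasCompactSupport h → ∃ a : ℝ,
      (∫ x, (h x - a) ^ 2 * weight c D q x) ≤
        K * ∫ x, ‖fderiv ℝ h x‖ ^ 2 * weight c D (q - 1) x := by
  set δ := 2 * q - finrank ℝ E with hδ
  have hδ0 : 0 < δ := by linarith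
  have hq0 : 0 < q := by linarith
  -- Outside the ball of radius `R` the `D`-term is at most `δ/4` times the main term. Young's
  -- inequality takes another `δ/4`, so `δ/2` is left.
  obtain ⟨R, hR0, hR⟩ : ∃ R : ℝ, 0 < R ∧ 2 * q * D ≤ δ / 4 * (c * R ^ 2) := by
    refine ⟨8 * q * D / (δ * c) + 1, by positivity, ?_⟩
    set y := 8 * q * D / (δ * c) with hy
    have hy0 : 0 ≤ y := by positivity
    have : 2 * q * D = δ / 4 * (c * y) := by rw [hy]; field_simp; norm_num
    rw [this]
    gcongr
    nlinarith
  set B := Metric.closedBall (0 : E) R with hB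
  have hBm : MeasurableSet B := Metric.isClosed_closedBall.measurableSet
  set M := (D + c * R ^ 2) ^ (q - 1) with hM
  have hM0 : 0 < M := by positivity
  set P := 4 * R ^ 2 * 2 ^ finrank ℝ E with hP
  have hP0 : 0 < P := by positivity
  set K := (δ / 2)⁻¹ * ((δ / 4 * c)⁻¹ + 2 * q * D * (D ^ (-(q + 1)) * (P * M))) with hK
  refine ⟨K, by positivity, fun h hh hhc => ?_⟩
  obtain ⟨a, ha⟩ := poincare_closedBall (E := E) hR0 hh
  refine ⟨a, ?_⟩
  have hcont : Continuous (fderiv ℝ h) := hh.continuous_fderiv one_ne_zero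
  have hhcont := hh.continuous
  have hw : ∀ r, Continuous (weight c D r : E → ℝ) := fun r => (contDiff_weight hc hD r).continuous
  have hw0 := hw q
  have hw1 := hw (q - 1)
  have hw2 := hw (q + 1)
  -- Subtracting `a` destroys compact support. The integrability of `f²` against the weight comes
  -- from its decay, and the version of the Euler identity without compact support is needed.
  set f : E → ℝ := fun x => h x - a with hf
  have hfderiv : ∀ x, fderiv ℝ f x = fderiv ℝ h x := fun x => by
    rw [hf, fderiv_sub_const]
  have hfC : ContDiff ℝ 1 f := hh.sub contDiff_const
  have hfcont := hfC.continuous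
  have hfb : ∃ C, ∀ x, ‖f x‖ ≤ C := by
    obtain ⟨C, hC⟩ := hhcont.bounded_above_of_compact_support hhc
    exact ⟨C + ‖a‖, fun x => (norm_sub_le _ _).trans (by linarith [hC x])⟩
  obtain ⟨C, hC⟩ := hfb
  have h1 : ∀ r : ℝ, finrank ℝ E < 2 * r → Integrable fun x => f x ^ 2 * weight c D r x := fun r hr => by
    have hw3 := hw r
    refine ((integrable_weight hc hD hr).const_mul (C ^ 2)).mono' ?_ (ae_of_all _ fun x => ?_)
    · exact Continuous.aestronglyMeasurable (by fun_prop)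
    · rw [norm_mul, Real.norm_of_nonneg (weight_pos hc hD r x).le, norm_pow]
      have := weight_pos hc hD r x
      gcongr
      exact hC x
  have h3 : Integrable fun x => f x * fderiv ℝ f x x * weight c D q x := by
    simp_rw [hfderiv]
    apply Continuous.integrable_of_hasCompactSupport (by fun_prop)
    refine HasCompactSupport.mul_right (HasCompactSupport.mul_left ?_)
    refine (hhc.fderiv ℝ).mono fun x hx => ?_
    simp only [Function.mem_support, ne_eq] at hx ⊢
    intro h0
    simp [h0] at hx
  have h2 : Integrable fun x => ‖fderiv ℝ f x‖ ^ 2 * weight c D (q - 1) x := by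
    simp_rw [hfderiv]
    apply Continuous.integrable_of_hasCompactSupport (by fun_prop)
    exact ((hhc.fderiv ℝ).comp_left (g := fun t : E →L[ℝ] ℝ => ‖t‖ ^ 2) (by simp)).mul_right
  have hid := integral_hardy_identity hc hD q hfC (h1 q hq) h3
  have hle := abs_integral_euler_mul_weight_le hc hD q (show 0 < δ / 4 by positivity) (h1 q hq) h2
  have hab := le_of_abs_le hle
  have hloc : Integrable (B.indicator fun x => f x ^ 2) := by
    rw [integrable_indicator_iff hBm]
    exact (hfcont.pow 2).continuousOn.integrableOn_compact (isCompact_closedBall _ _)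
  have hsplit : 2 * q * D * ∫ x, f x ^ 2 * weight c D (q + 1) x ≤
      δ / 4 * (∫ x, f x ^ 2 * weight c D q x) +
        2 * q * D * D ^ (-(q + 1)) * ∫ x, B.indicator (fun x => f x ^ 2) x := by
    rw [← integral_const_mul, ← integral_const_mul, ← integral_const_mul,
      ← integral_add ((h1 q hq).const_mul _) (hloc.const_mul _)]
    refine integral_mono ((h1 (q + 1) (by linarith)).const_mul _)
      (((h1 q hq).const_mul _).add (hloc.const_mul _)) fun x => ?_
    have w0 := weight_pos hc hD q x
    have w1 := weight_pos hc hD (q + 1) x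
    by_cases hx : x ∈ B
    · simp only [indicator_of_mem hx]
      have := weight_le hc hD (q + 1) (by linarith) x
      have e1 : 2 * q * D * (f x ^ 2 * weight c D (q + 1) x) ≤
          2 * q * D * (f x ^ 2 * D ^ (-(q + 1))) := by gcongr
      have e2 : 0 ≤ δ / 4 * (f x ^ 2 * weight c D q x) := by positivity
      linarith
    · simp only [indicator_of_notMem hx, mul_zero, add_zero]
      have hx' : R < ‖x‖ := by
        rw [hB, mem_closedBall_zero_iff] at hx; exact not_le.1 hx
      have e0 : weight c D q x = weight c D (q + 1) x * quad c D x := by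
        rw [← weight_sub_one hc hD]; ring_nf
      have e1 : c * R ^ 2 ≤ quad c D x := by
        refine le_trans ?_ (mul_norm_sq_le_quad hc hD x)
        gcongr
      rw [e0]
      calc 2 * q * D * (f x ^ 2 * weight c D (q + 1) x)
          ≤ δ / 4 * (c * R ^ 2) * (f x ^ 2 * weight c D (q + 1) x) := by gcongr
        _ ≤ δ / 4 * quad c D x * (f x ^ 2 * weight c D (q + 1) x) := by gcongr
        _ = _ := by ring
  have hball : ∫ x, B.indicator (fun x => f x ^ 2) x ≤
      P * (M * ∫ x, ‖fderiv ℝ f x‖ ^ 2 * weight c D (q - 1) x) := by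
    rw [integral_indicator hBm]
    refine ha.trans ?_
    gcongr
    rw [← integral_const_mul, ← integral_indicator hBm]
    refine integral_mono_of_nonneg (ae_of_all _ fun x => indicator_nonneg (fun x _ => by positivity) _)
      (h2.const_mul _) (ae_of_all _ fun x => ?_)
    have w1 := weight_pos hc hD (q - 1) x
    by_cases hx : x ∈ B
    · simp only [indicator_of_mem hx, hfderiv]
      have e1 : quad c D x ≤ D + c * R ^ 2 := by
        rw [hB, mem_closedBall_zero_iff] at hx
        unfold quad; gcongr
      have e2 : 1 ≤ M * weight c D (q - 1) x := by
        unfold weight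
        rw [Real.rpow_neg (quad_pos hc hD x).le, ← div_eq_mul_inv,
          le_div_iff₀ (Real.rpow_pos_of_pos (quad_pos hc hD x) _), one_mul]
        exact Real.rpow_le_rpow (quad_pos hc hD x).le e1 (by linarith)
      nlinarith [sq_nonneg ‖fderiv ℝ h x‖]
    · simp only [indicator_of_notMem hx]
      positivity
  have hfder2 : ∫ x, ‖fderiv ℝ h x‖ ^ 2 * weight c D (q - 1) x =
      ∫ x, ‖fderiv ℝ f x‖ ^ 2 * weight c D (q - 1) x := by simp_rw [hfderiv]
  rw [hfder2]
  set A := ∫ x, f x ^ 2 * weight c D q x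
  set G := ∫ x, ‖fderiv ℝ f x‖ ^ 2 * weight c D (q - 1) x
  set L := ∫ x, B.indicator (fun x => f x ^ 2) x
  have hDq : 0 < D ^ (-(q + 1)) := by positivity
  have hball2 : 2 * q * D * D ^ (-(q + 1)) * L ≤ 2 * q * D * D ^ (-(q + 1)) * (P * (M * G)) := by
    gcongr
  have hfin : δ / 2 * A ≤ (δ / 4 * c)⁻¹ * G + 2 * q * D * D ^ (-(q + 1)) * (P * (M * G)) := by
    have : finrank ℝ E - 2 * q = -δ := by rw [hδ]; ring
    rw [this] at hid
    linarith
  calc A = (δ / 2)⁻¹ * (δ / 2 * A) := by field_simp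
    _ ≤ (δ / 2)⁻¹ * ((δ / 4 * c)⁻¹ * G + 2 * q * D * D ^ (-(q + 1)) * (P * (M * G))) := by gcongr
    _ = K * G := by rw [hK]; ring

end Hardy

/-! ### The Hardy-Poincaré constant -/

section HardyPoincare

variable {d : ℕ}

theorem barenblatt_eq_weight (m D : ℝ) (x : EuclideanSpace ℝ (Fin d)) :
    barenblatt m D x = weight ((1 - m) / (2 * m)) D (1 / (1 - m)) x := rfl

theorem barenblatt_rpow {m D : ℝ} (hm0 : 0 < m) (hm1 : m < 1) (hD : 0 < D) (r : ℝ)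
    (x : EuclideanSpace ℝ (Fin d)) :
    barenblatt m D x ^ r = weight ((1 - m) / (2 * m)) D (1 / (1 - m) * r) x := by
  have hc : 0 < (1 - m) / (2 * m) := by
    have : 0 < 1 - m := by linarith
    positivity
  rw [barenblatt_eq_weight]
  unfold weight
  rw [← Real.rpow_mul (quad_pos hc hD x).le]
  ring_nf

theorem barenblatt_rpow_two_sub {m D : ℝ} (hm0 : 0 < m) (hm1 : m < 1) (hD : 0 < D)
    (x : EuclideanSpace ℝ (Fin d)) :
    barenblatt m D x ^ (2 - m) = weight ((1 - m) / (2 * m)) D (1 / (1 - m) + 1) x := by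
  have : 1 - m ≠ 0 := by linarith
  rw [barenblatt_rpow hm0 hm1 hD]
  congr 1
  field_simp
  ring

theorem mStar_lt_iff {m : ℝ} (hd : 3 ≤ d) (hm1 : m < 1) :
    mStar d < m ↔ (d : ℝ) < 2 * (1 / (1 - m) + 1) := by
  have h1 : 0 < 1 - m := by linarith
  have hd' : (3 : ℝ) ≤ d := by exact_mod_cast hd
  have h2 : 0 < (d : ℝ) - 2 := by linarith
  have e : 2 * (1 / (1 - m) + 1) = (2 + 2 * (1 - m)) / (1 - m) := by field_simp
  rw [mStar, div_lt_iff₀ h2, e, lt_div_iff₀ h1]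
  constructor <;> intro h <;> nlinarith

theorem lt_mStar_iff {m : ℝ} (hd : 3 ≤ d) (hm1 : m < 1) :
    m < mStar d ↔ 2 * (1 / (1 - m) + 1) < (d : ℝ) := by
  have h1 : 0 < 1 - m := by linarith
  have hd' : (3 : ℝ) ≤ d := by exact_mod_cast hd
  have h2 : 0 < (d : ℝ) - 2 := by linarith
  have e : 2 * (1 / (1 - m) + 1) = (2 + 2 * (1 - m)) / (1 - m) := by field_simp
  rw [mStar, lt_div_iff₀ h2, e, div_lt_iff₀ h1]
  constructor <;> intro h <;> nlinarith

theorem norm_gradient_eq (h : EuclideanSpace ℝ (Fin d) → ℝ) (x : EuclideanSpace ℝ (Fin d)) :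
    ‖gradient h x‖ = ‖fderiv ℝ h x‖ := by
  simp [gradient]

/-- The quotients whose infimum defines the Hardy-Poincaré constant. -/
def hardyPoincareQuotients (d : ℕ) (m D : ℝ) : Set ℝ :=
  {r : ℝ | ∃ h : EuclideanSpace ℝ (Fin d) → ℝ, IsTestFunction m h ∧
    (∫ x, |h x - weightedMean m D h| ^ 2 * barenblatt m D x ^ (2 - m)) ≠ 0 ∧
    r = (∫ x, ‖gradient h x‖ ^ 2 * barenblatt m D x) /
      ∫ x, |h x - weightedMean m D h| ^ 2 * barenblatt m D x ^ (2 - m)}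

theorem hardyPoincare_eq (m D : ℝ) :
    hardyPoincare d m D = m * sInf (hardyPoincareQuotients d m D) := rfl

/-- With `t = D / D'` one has `U_D(√t x) = t U_{D'}(x)`. -/
theorem barenblatt_smul {m D D' : ℝ} (hm0 : 0 < m) (hm1 : m < 1) (hD : 0 < D) (hD' : 0 < D')
    (x : EuclideanSpace ℝ (Fin d)) :
    barenblatt m D' x = (D / D') ^ (1 / (1 - m)) * barenblatt m D (√(D / D') • x) := by
  have hc : 0 < (1 - m) / (2 * m) := by
    have : 0 < 1 - m := by linarith
    positivity
  have hs : 0 < D / D' := by positivity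
  have h0 := quad_pos hc hD' x
  have e : quad ((1 - m) / (2 * m)) D (√(D / D') • x) =
      D / D' * quad ((1 - m) / (2 * m)) D' x := by
    unfold quad
    rw [norm_smul, mul_pow, Real.norm_of_nonneg (Real.sqrt_nonneg _), Real.sq_sqrt hs.le]
    field_simp
  rw [barenblatt_eq_weight, barenblatt_eq_weight, weight, weight, e,
    Real.mul_rpow hs.le h0.le, ← mul_assoc, ← Real.rpow_add hs]
  simp

/-- Replace `h` by `h(√t ·)` with `t = D / D'`. The denominator gains a factor `t` because `p(2-m) =
p + 1`, the numerator gains the same factor from the squared gradient, and the remaining factors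
agree, so the quotient is unchanged. -/
theorem hardyPoincareQuotients_subset {m D D' : ℝ} (hm0 : 0 < m) (hm1 : m < 1) (hD : 0 < D)
    (hD' : 0 < D') : hardyPoincareQuotients d m D ⊆ hardyPoincareQuotients d m D' := by
  rintro r ⟨h, ⟨hh, hhc, hh0⟩, hne, rfl⟩
  set t := D / D' with ht
  have ht0 : 0 < t := by positivity
  set s := √t with hs
  have hs0 : 0 < s := Real.sqrt_pos.2 ht0
  have hs2 : s ^ 2 = t := Real.sq_sqrt ht0.le
  set J := |(s ^ finrank ℝ (EuclideanSpace ℝ (Fin d)))⁻¹| with hJ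
  have hJ0 : 0 < J := by positivity
  have hch : ∀ F : EuclideanSpace ℝ (Fin d) → ℝ, ∫ x, F (s • x) = J * ∫ x, F x := fun F => by
    rw [Measure.integral_comp_smul, smul_eq_mul]
  set k : EuclideanSpace ℝ (Fin d) → ℝ := fun x => h (s • x) with hk
  set p := 1 / (1 - m) with hp
  have hb : ∀ x : EuclideanSpace ℝ (Fin d),
      barenblatt m D' x = t ^ p * barenblatt m D (s • x) := fun x =>
    barenblatt_smul hm0 hm1 hD hD' x
  have hb2 : ∀ x : EuclideanSpace ℝ (Fin d), barenblatt m D' x ^ (2 - m) =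
      (t ^ p) ^ (2 - m) * barenblatt m D (s • x) ^ (2 - m) := fun x => by
    have hc : 0 < (1 - m) / (2 * m) := by
      have : 0 < 1 - m := by linarith
      positivity
    rw [hb, Real.mul_rpow (by positivity)]
    rw [barenblatt_eq_weight]
    exact (weight_pos hc hD _ _).le
  have htp : (t ^ p) ^ (2 - m) = t ^ p * t := by
    have : 1 - m ≠ 0 := by linarith
    rw [← Real.rpow_mul ht0.le, ← Real.rpow_add_one ht0.ne']
    congr 1
    rw [hp]; field_simp; ring
  rw [htp] at hb2
  set T := t ^ p with hT
  have hT0 : 0 < T := by positivity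
  have hmean : weightedMean m D' k = weightedMean m D h := by
    unfold weightedMean
    split_ifs
    · simp_rw [hb2]
      have e1 : ∫ x, k x * (T * t * barenblatt m D (s • x) ^ (2 - m)) =
          T * t * (J * ∫ x, h x * barenblatt m D x ^ (2 - m)) := by
        rw [← hch fun x => h x * barenblatt m D x ^ (2 - m), ← integral_const_mul]
        congr 1; ext x; simp only [hk]; ring
      have e2 : ∫ x : EuclideanSpace ℝ (Fin d), T * t * barenblatt m D (s • x) ^ (2 - m) =
          T * t * (J * ∫ x : EuclideanSpace ℝ (Fin d), barenblatt m D x ^ (2 - m)) := by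
        rw [← hch fun x => barenblatt m D x ^ (2 - m), ← integral_const_mul]
      rw [e1, e2, ← mul_assoc, ← mul_assoc, mul_div_mul_left _ _ (by positivity)]
    · rfl
  have hden : ∫ x, |k x - weightedMean m D' k| ^ 2 * barenblatt m D' x ^ (2 - m) =
      T * t * J * ∫ x, |h x - weightedMean m D h| ^ 2 * barenblatt m D x ^ (2 - m) := by
    rw [mul_assoc, ← hch fun x => |h x - weightedMean m D h| ^ 2 * barenblatt m D x ^ (2 - m),
      ← integral_const_mul, hmean]
    congr 1; ext x; rw [hb2]; simp only [hk]; ring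
  have hderiv : ∀ x, fderiv ℝ k x = s • fderiv ℝ h (s • x) := fun x => by
    rw [hk, fderiv_comp_smul]
  have hnum : ∫ x, ‖gradient k x‖ ^ 2 * barenblatt m D' x =
      T * t * J * ∫ x, ‖gradient h x‖ ^ 2 * barenblatt m D x := by
    rw [mul_assoc, ← hch fun x => ‖gradient h x‖ ^ 2 * barenblatt m D x,
      ← integral_const_mul]
    congr 1; ext x
    rw [hb, norm_gradient_eq, norm_gradient_eq, hderiv, norm_smul, mul_pow,
      Real.norm_of_nonneg hs0.le, hs2]
    ring
  refine ⟨k, ⟨?_, ?_, fun hlt => ?_⟩, ?_, ?_⟩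
  · exact hh.comp (contDiff_const_smul s)
  · exact hhc.comp_homeomorph (Homeomorph.smulOfNeZero s hs0.ne')
  · have h0 := hh0 hlt
    rw [notMem_tsupport_iff_eventuallyEq] at h0 ⊢
    have hc : Tendsto (fun x : EuclideanSpace ℝ (Fin d) => s • x) (𝓝 0) (𝓝 0) := by
      have : Continuous fun x : EuclideanSpace ℝ (Fin d) => s • x := by fun_prop
      simpa using this.tendsto 0
    exact hc.eventually h0
  · rw [hden]
    exact mul_ne_zero (by positivity) hne
  · rw [hden, hnum, mul_div_mul_left _ _ (by positivity)]

theorem hardyPoincare_congr {m D D' : ℝ} (hm0 : 0 < m) (hm1 : m < 1) (hD : 0 < D)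
    (hD' : 0 < D') : hardyPoincare d m D = hardyPoincare d m D' := by
  rw [hardyPoincare_eq, hardyPoincare_eq,
    (hardyPoincareQuotients_subset hm0 hm1 hD hD').antisymm
      (hardyPoincareQuotients_subset hm0 hm1 hD' hD)]

theorem integral_sub_sq_mul_weight {c D q : ℝ} (hc : 0 < c) (hD : 0 < D)
    (hq : finrank ℝ E < 2 * q) {h : E → ℝ} (hh : Continuous h) (hhc : HasCompactSupport h)
    (a : ℝ) :
    ∫ x, (h x - a) ^ 2 * weight c D q x = (∫ x, h x ^ 2 * weight c D q x) -
      2 * a * (∫ x, h x * weight c D q x) + a ^ 2 * ∫ x : E, weight c D q x := by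
  have hw := (contDiff_weight (E := E) hc hD q).continuous
  have i1 : Integrable fun x => h x ^ 2 * weight c D q x := by
    apply Continuous.integrable_of_hasCompactSupport (by fun_prop)
    exact (hhc.comp_left (g := fun t : ℝ => t ^ 2) (by simp)).mul_right
  have i2 : Integrable fun x => h x * weight c D q x :=
    (Continuous.mul hh hw).integrable_of_hasCompactSupport hhc.mul_right
  have i3 := integrable_weight (E := E) hc hD hq
  have i4 : Integrable fun x => h x ^ 2 * weight c D q x - 2 * a * (h x * weight c D q x) :=
    i1.sub (i2.const_mul _)
  rw [← integral_const_mul, ← integral_const_mul, ← integral_sub i1 (i2.const_mul _),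
    ← integral_add i4 (i3.const_mul _)]
  congr 1; ext x; ring

theorem integral_weight_pos {c D q : ℝ} (hc : 0 < c) (hD : 0 < D) (hq : finrank ℝ E < 2 * q) :
    0 < ∫ x : E, weight c D q x :=
  integral_pos_of_integrable_nonneg_nonzero (x := 0) (contDiff_weight hc hD q).continuous
    (integrable_weight hc hD hq) (fun x => (weight_pos hc hD q x).le) (weight_pos hc hD q 0).ne'

/-- The Hardy-Poincaré inequality with some positive constant. -/
theorem exists_hardyPoincare_le (hd : 3 ≤ d) {m : ℝ} (hm0 : 0 < m) (hm1 : m < 1)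
    (hm : m ≠ mStar d) {D : ℝ} (hD : 0 < D) :
    ∃ K, 0 < K ∧ ∀ h : EuclideanSpace ℝ (Fin d) → ℝ, IsTestFunction m h →
      (∫ x, |h x - weightedMean m D h| ^ 2 * barenblatt m D x ^ (2 - m)) ≤
        K * ∫ x, ‖gradient h x‖ ^ 2 * barenblatt m D x := by
  have h1m : 0 < 1 - m := by linarith
  have hc : 0 < (1 - m) / (2 * m) := by positivity
  have : Nontrivial (EuclideanSpace ℝ (Fin d)) := by
    have : Nonempty (Fin d) := ⟨⟨0, by omega⟩⟩
    infer_instance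
  have hfr : (finrank ℝ (EuclideanSpace ℝ (Fin d)) : ℝ) = d := by simp
  simp_rw [sq_abs, barenblatt_rpow_two_sub hm0 hm1 hD, norm_gradient_eq, barenblatt_eq_weight]
  set c := (1 - m) / (2 * m)
  set p := 1 / (1 - m) with hp
  have hp0 : 0 < p := by positivity
  rcases lt_or_gt_of_ne hm with hlt | hgt
  · have hq := (lt_mStar_iff hd hm1).1 hlt
    refine ⟨4 / ((finrank ℝ (EuclideanSpace ℝ (Fin d)) - 2 * (p + 1)) ^ 2 * c), ?_,
      fun h hh => ?_⟩
    · have : (finrank ℝ (EuclideanSpace ℝ (Fin d)) - 2 * (p + 1)) ≠ 0 := by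
        rw [hfr]; intro h0; linarith
      positivity
    · have := hardy_inequality hc hD (q := p + 1) (by positivity) (by rwa [hfr])
        (hh.1.of_le (by simp)) hh.2.1
      have hw : weightedMean m D h = 0 := if_neg (not_lt.2 hlt.le)
      simp only [hw, sub_zero]
      simpa using this
  · have hq := (mStar_lt_iff hd hm1).1 hgt
    obtain ⟨K, hK0, hK⟩ := exists_weighted_poincare (E := EuclideanSpace ℝ (Fin d)) hc hD
      (q := p + 1) (by rwa [hfr]) (by linarith)
    refine ⟨K, hK0, fun h hh => ?_⟩
    obtain ⟨a, ha⟩ := hK h (hh.1.of_le (by simp)) hh.2.1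
    rw [add_sub_cancel_right] at ha
    -- The weighted mean minimizes `a ↦ ∫ (h - a)² U^(-(p+1))`, so the inequality with some constant
    -- implies the one with the mean.
    refine le_trans ?_ ha
    have hw : weightedMean m D h = (∫ x, h x * weight c D (p + 1) x) /
        ∫ x : EuclideanSpace ℝ (Fin d), weight c D (p + 1) x := by
      unfold weightedMean
      rw [if_pos hgt]
      simp_rw [barenblatt_rpow_two_sub hm0 hm1 hD]
      rfl
    have hM := integral_weight_pos (E := EuclideanSpace ℝ (Fin d)) hc hD (q := p + 1) (by rwa [hfr])
    rw [integral_sub_sq_mul_weight hc hD (by rwa [hfr]) hh.1.continuous hh.2.1,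
      integral_sub_sq_mul_weight hc hD (by rwa [hfr]) hh.1.continuous hh.2.1, hw]
    set M := ∫ x : EuclideanSpace ℝ (Fin d), weight c D (p + 1) x
    set S := ∫ x, h x * weight c D (p + 1) x
    have e : -(2 * (S / M) * S) + (S / M) ^ 2 * M = -(S ^ 2 / M) := by field_simp; ring
    have e2 : -(2 * a * S) + a ^ 2 * M + S ^ 2 / M = M * (a - S / M) ^ 2 := by field_simp; ring
    have e3 : 0 ≤ M * (a - S / M) ^ 2 := by positivity
    linarith

/-- The infimum of the empty set of reals is `0`, so positivity of the constant requires a test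
function. A cutoff serves in both regimes: it equals `0` at the origin and `1` at `x₀`, hence is not
constant. Integrability must be checked as well, since otherwise the integral would be `0` by
convention. -/
theorem hardyPoincareQuotients_nonempty (hd : 3 ≤ d) {m : ℝ} (hm0 : 0 < m) (hm1 : m < 1)
    {D : ℝ} (hD : 0 < D) : (hardyPoincareQuotients d m D).Nonempty := by
  have h1m : 0 < 1 - m := by linarith
  have hc : 0 < (1 - m) / (2 * m) := by positivity
  have : Nontrivial (EuclideanSpace ℝ (Fin d)) := by
    have : Nonempty (Fin d) := ⟨⟨0, by omega⟩⟩
    infer_instance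
  have hfr : (finrank ℝ (EuclideanSpace ℝ (Fin d)) : ℝ) = d := by simp
  obtain ⟨x₀, hx₀⟩ := exists_ne (0 : EuclideanSpace ℝ (Fin d))
  obtain ⟨N, hN, hN0⟩ := ((eventually_cutoff_eq_one hx₀).and (eventually_gt_atTop (0 : ℝ))).exists
  generalize hh : (cutoff N : EuclideanSpace ℝ (Fin d) → ℝ) = h at hN
  have hb0 : ∀ x, 0 ≤ h x := fun x => hh ▸ cutoff_nonneg N x
  have hb1 : ∀ x, h x ≤ 1 := fun x => hh ▸ cutoff_le_one N x
  have hsm : ContDiff ℝ ∞ h := hh ▸ contDiff_cutoff N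
  have hcs : HasCompactSupport h := hh ▸ hasCompactSupport_cutoff hN0
  have h00 : (0 : EuclideanSpace ℝ (Fin d)) ∉ tsupport h := hh ▸ zero_notMem_tsupport_cutoff N
  refine ⟨_, h, ⟨hsm, hcs, fun _ => h00⟩, ?_, rfl⟩
  set a := weightedMean m D h with ha
  simp_rw [sq_abs, barenblatt_rpow_two_sub hm0 hm1 hD]
  set c := (1 - m) / (2 * m)
  set p := 1 / (1 - m) with hp
  have hw := contDiff_weight (E := EuclideanSpace ℝ (Fin d)) hc hD (p + 1)
  have hint : Integrable fun x => (h x - a) ^ 2 * weight c D (p + 1) x := by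
    by_cases hlt : mStar d < m
    · have hq := (mStar_lt_iff hd hm1).1 hlt
      refine ((integrable_weight (E := EuclideanSpace ℝ (Fin d)) hc hD (q := p + 1)
        (by rwa [hfr])).const_mul ((1 + |a|) ^ 2)).mono'
        (((hsm.continuous.sub continuous_const).pow 2).mul hw.continuous).aestronglyMeasurable
        (ae_of_all _ fun x => ?_)
      have := weight_pos hc hD (p + 1) x
      rw [norm_mul, norm_pow, Real.norm_of_nonneg this.le]
      gcongr
      refine (norm_sub_le _ _).trans (add_le_add ?_ le_rfl)
      rw [Real.norm_of_nonneg (hb0 x)]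
      exact hb1 x
    · have hw0 : a = 0 := if_neg hlt
      simp only [hw0, sub_zero]
      have hcont : Continuous fun x => h x ^ 2 * weight c D (p + 1) x :=
        (hsm.continuous.pow 2).mul hw.continuous
      have hcs2 : HasCompactSupport fun x => h x ^ 2 :=
        hcs.comp_left (g := fun t : ℝ => t ^ 2) (by simp)
      exact hcont.integrable_of_hasCompactSupport hcs2.mul_right
  have hex : ∃ x, (h x - a) ^ 2 * weight c D (p + 1) x ≠ 0 := by
    by_contra! hall
    have h1 : h x₀ = 1 := hN.self_of_nhds
    have h0 : h 0 = 0 := image_eq_zero_of_notMem_tsupport h00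
    have e : ∀ x, h x = a := fun x => by
      rcases mul_eq_zero.1 (hall x) with h | h
      · exact sub_eq_zero.1 (pow_eq_zero_iff two_ne_zero |>.1 h)
      · exact absurd h (weight_pos hc hD _ x).ne'
    rw [e] at h1 h0
    linarith
  obtain ⟨x, hx⟩ := hex
  exact (integral_pos_of_integrable_nonneg_nonzero (x := x)
    (((hsm.continuous.sub continuous_const).pow 2).mul hw.continuous) hint
    (fun x => mul_nonneg (sq_nonneg _) (weight_pos hc hD _ x).le) hx).ne'

theorem integral_quotient_nonneg {m D : ℝ} (hm0 : 0 < m) (hm1 : m < 1) (hD : 0 < D)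
    (h : EuclideanSpace ℝ (Fin d) → ℝ) :
    0 ≤ ∫ x, |h x - weightedMean m D h| ^ 2 * barenblatt m D x ^ (2 - m) := by
  have hc : 0 < (1 - m) / (2 * m) := by
    have : 0 < 1 - m := by linarith
    positivity
  refine integral_nonneg fun x => ?_
  simp only [barenblatt_rpow_two_sub hm0 hm1 hD]
  have := weight_pos hc hD (1 / (1 - m) + 1) x
  positivity

theorem integral_gradient_nonneg {m D : ℝ} (hm0 : 0 < m) (hm1 : m < 1) (hD : 0 < D)
    (h : EuclideanSpace ℝ (Fin d) → ℝ) :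
    0 ≤ ∫ x, ‖gradient h x‖ ^ 2 * barenblatt m D x := by
  have hc : 0 < (1 - m) / (2 * m) := by
    have : 0 < 1 - m := by linarith
    positivity
  refine integral_nonneg fun x => ?_
  have := weight_pos hc hD (1 / (1 - m)) x
  simp only [barenblatt_eq_weight]
  positivity

theorem hardyPoincare_pos (hd : 3 ≤ d) {m : ℝ} (hm0 : 0 < m) (hm1 : m < 1)
    (hm : m ≠ mStar d) {D : ℝ} (hD : 0 < D) : 0 < hardyPoincare d m D := by
  obtain ⟨K, hK0, hK⟩ := exists_hardyPoincare_le hd hm0 hm1 hm hD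
  rw [hardyPoincare_eq]
  refine mul_pos hm0 (lt_of_lt_of_le (inv_pos.2 hK0)
    (le_csInf (hardyPoincareQuotients_nonempty hd hm0 hm1 hD) ?_))
  rintro r ⟨h, hh, hne, rfl⟩
  have hpos := lt_of_le_of_ne (integral_quotient_nonneg hm0 hm1 hD h) hne.symm
  rw [le_div_iff₀ hpos, inv_mul_le_iff₀ hK0]
  exact hK h hh

theorem hardyPoincare_mul_le {m D : ℝ} (hm0 : 0 < m) (hm1 : m < 1) (hD : 0 < D)
    {h : EuclideanSpace ℝ (Fin d) → ℝ} (hh : IsTestFunction m h) :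
    hardyPoincare d m D *
      (∫ x, |h x - weightedMean m D h| ^ 2 * barenblatt m D x ^ (2 - m)) ≤
      m * ∫ x, ‖gradient h x‖ ^ 2 * barenblatt m D x := by
  have hN := integral_gradient_nonneg hm0 hm1 hD h
  have hpos := integral_quotient_nonneg hm0 hm1 hD h
  rcases hpos.eq_or_lt with h0 | h0
  · rw [← h0, mul_zero]; positivity
  · rw [hardyPoincare_eq, mul_assoc]
    gcongr
    rw [← le_div_iff₀ h0]
    refine csInf_le ⟨0, ?_⟩ ⟨h, hh, h0.ne', rfl⟩
    rintro r ⟨h, -, -, rfl⟩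
    exact div_nonneg (integral_gradient_nonneg hm0 hm1 hD h)
      (integral_quotient_nonneg hm0 hm1 hD h)

/-- The Hardy-Poincaré inequality with the mean value expanded. -/
theorem exists_hardyPoincare_expanded (hd : 3 ≤ d) {m D : ℝ} (hm0 : 0 < m) (hm1 : m < 1)
    (hm : m ≠ mStar d) (hD : 0 < D) :
    ∃ θ, 0 ≤ θ ∧ (¬ mStar d < m → θ = 0) ∧ ∀ h : EuclideanSpace ℝ (Fin d) → ℝ,
      IsTestFunction m h → hardyPoincare d m D *
        (∫ x, h x ^ 2 * weight ((1 - m) / (2 * m)) D (1 / (1 - m) + 1) x) ≤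
        m * (∫ x, ‖fderiv ℝ h x‖ ^ 2 * weight ((1 - m) / (2 * m)) D (1 / (1 - m)) x) +
        θ * (∫ x, h x * weight ((1 - m) / (2 * m)) D (1 / (1 - m) + 1) x) ^ 2 := by
  have h1m : 0 < 1 - m := by linarith
  have hc : 0 < (1 - m) / (2 * m) := by positivity
  have hfr : (finrank ℝ (EuclideanSpace ℝ (Fin d)) : ℝ) = d := by simp
  have hpos := hardyPoincare_pos hd hm0 hm1 hm hD
  have key := fun h (hh : IsTestFunction m h) => hardyPoincare_mul_le (d := d) hm0 hm1 hD hh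
  simp_rw [sq_abs, barenblatt_rpow_two_sub hm0 hm1 hD, norm_gradient_eq, barenblatt_eq_weight]
    at key
  set c := (1 - m) / (2 * m)
  set p := 1 / (1 - m) with hp
  by_cases hlt : mStar d < m
  · have hq := (mStar_lt_iff hd hm1).1 hlt
    have hM := integral_weight_pos (E := EuclideanSpace ℝ (Fin d)) hc hD (q := p + 1) (by rwa [hfr])
    -- This `θ` comes from `∫ (h - h̄)² μ = ∫ h² μ - (∫ h μ)² / ∫ μ`. In the expanded form the mean
    -- is an explicit error term that can be followed through the limits.
    refine ⟨hardyPoincare d m D / ∫ x : EuclideanSpace ℝ (Fin d), weight c D (p + 1) x,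
      by positivity, fun h => absurd hlt h, fun h hh => ?_⟩
    have hk := key h hh
    have hw : weightedMean m D h = (∫ x, h x * weight c D (p + 1) x) /
        ∫ x : EuclideanSpace ℝ (Fin d), weight c D (p + 1) x := by
      unfold weightedMean
      rw [if_pos hlt]
      simp_rw [barenblatt_rpow_two_sub hm0 hm1 hD]
      rfl
    rw [integral_sub_sq_mul_weight hc hD (by rwa [hfr]) hh.1.continuous hh.2.1, hw] at hk
    set M := ∫ x : EuclideanSpace ℝ (Fin d), weight c D (p + 1) x
    set S := ∫ x, h x * weight c D (p + 1) x
    have e : ∀ A, A - 2 * (S / M) * S + (S / M) ^ 2 * M = A - S ^ 2 / M := fun A => by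
      field_simp; ring
    rw [e, mul_sub] at hk
    have e2 : hardyPoincare d m D / M * S ^ 2 = hardyPoincare d m D * (S ^ 2 / M) := by
      field_simp
    rw [e2]
    linarith
  · refine ⟨0, le_rfl, fun _ => rfl, fun h hh => ?_⟩
    have hk := key h hh
    have hw : weightedMean m D h = 0 := if_neg hlt
    simp only [hw, sub_zero] at hk
    linarith

end HardyPoincare

end Euclidean

/-! ### A generalized dominated convergence theorem -/

section Pratt

variable {α : Type*} [MeasurableSpace α] {μ : Measure α}

/-- Scheffé's argument: the positive part of `H₀ - H n` is dominated by `|H₀|`, and `|u| = 2u⁺ - u`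
reduces the rest to the convergence of the integrals. -/
theorem tendsto_integral_abs_sub_of_tendsto_integral {H : ℕ → α → ℝ} {H₀ : α → ℝ}
    (hH : ∀ n, Integrable (H n) μ) (hH₀ : Integrable H₀ μ) (hpos : ∀ n x, 0 ≤ H n x)
    (hae : ∀ᵐ x ∂μ, Tendsto (fun n => H n x) atTop (𝓝 (H₀ x)))
    (hint : Tendsto (fun n => ∫ x, H n x ∂μ) atTop (𝓝 (∫ x, H₀ x ∂μ))) :
    Tendsto (fun n => ∫ x, |H n x - H₀ x| ∂μ) atTop (𝓝 0) := by
  have h1 : Tendsto (fun n => ∫ x, max (H₀ x - H n x) 0 ∂μ) atTop (𝓝 (∫ _, (0 : ℝ) ∂μ)) := by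
    refine tendsto_integral_of_dominated_convergence (fun x => |H₀ x|)
      (fun n => ((hH₀.sub (hH n)).pos_part).aestronglyMeasurable) hH₀.abs
      (fun n => ae_of_all _ fun x => ?_) ?_
    · rw [Real.norm_of_nonneg (le_max_right _ _)]
      refine max_le ?_ (abs_nonneg _)
      have := hpos n x
      have := le_abs_self (H₀ x)
      linarith
    · filter_upwards [hae] with x hx
      have := ((tendsto_const_nhds (x := H₀ x)).sub hx).max (tendsto_const_nhds (x := (0 : ℝ)))
      simpa using this
  have h2 : ∀ n, ∫ x, |H n x - H₀ x| ∂μ = 2 * (∫ x, max (H₀ x - H n x) 0 ∂μ) -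
      ((∫ x, H₀ x ∂μ) - ∫ x, H n x ∂μ) := fun n => by
    have i1 : Integrable (fun x => H₀ x - H n x) μ := hH₀.sub (hH n)
    rw [← integral_sub hH₀ (hH n), ← integral_const_mul,
      ← integral_sub (i1.pos_part.const_mul 2) i1]
    congr 1; ext x
    rcases le_total (H₀ x) (H n x) with h | h
    · rw [max_eq_right (by simpa using h), abs_of_nonneg (by linarith)]; simp
    · change _ = 2 * max (H₀ x - H n x) 0 - (H₀ x - H n x)
      rw [max_eq_left (by simpa using h), abs_of_nonpos (by linarith)]; ring
  simp_rw [h2]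
  have := (h1.const_mul 2).sub ((tendsto_const_nhds (x := ∫ x, H₀ x ∂μ)).sub hint)
  simpa using this

/-- Dominated convergence with a convergent sequence of dominating functions. -/
theorem tendsto_integral_of_tendsto_dominating {F H : ℕ → α → ℝ} {f H₀ : α → ℝ}
    (hF : ∀ n, AEStronglyMeasurable (F n) μ)
    (hH : ∀ n, Integrable (H n) μ) (hH₀ : Integrable H₀ μ) (hle : ∀ n x, |F n x| ≤ H n x)
    (hFae : ∀ᵐ x ∂μ, Tendsto (fun n => F n x) atTop (𝓝 (f x)))
    (hae : ∀ᵐ x ∂μ, Tendsto (fun n => H n x) atTop (𝓝 (H₀ x)))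
    (hint : Tendsto (fun n => ∫ x, H n x ∂μ) atTop (𝓝 (∫ x, H₀ x ∂μ))) :
    Integrable f μ ∧ Tendsto (fun n => ∫ x, F n x ∂μ) atTop (𝓝 (∫ x, f x ∂μ)) := by
  have hfle : ∀ᵐ x ∂μ, |f x| ≤ H₀ x := by
    filter_upwards [hFae, hae] with x h1 h2
    exact le_of_tendsto_of_tendsto' h1.abs h2 fun n => hle n x
  have hfm : AEStronglyMeasurable f μ := aestronglyMeasurable_of_tendsto_ae atTop hF hFae
  have hfi : Integrable f μ := hH₀.mono' hfm hfle
  have hFi : ∀ n, Integrable (F n) μ := fun n => (hH n).mono' (hF n) (ae_of_all _ (hle n))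
  refine ⟨hfi, ?_⟩
  -- Truncation to `[-H₀, H₀]` puts ordinary dominated convergence within reach; the truncation
  -- error is at most `|H n - H₀|`.
  set G : ℕ → α → ℝ := fun n x => max (-H₀ x) (min (F n x) (H₀ x)) with hG
  have hGm : ∀ n, AEStronglyMeasurable (G n) μ := fun n =>
    hH₀.aestronglyMeasurable.neg.sup ((hF n).inf hH₀.aestronglyMeasurable)
  have hGle : ∀ n, ∀ᵐ x ∂μ, ‖G n x‖ ≤ H₀ x := fun n => by
    filter_upwards [hfle] with x hx
    have h0 : 0 ≤ H₀ x := (abs_nonneg _).trans hx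
    rw [Real.norm_eq_abs, abs_le]
    exact ⟨le_max_left _ _, max_le (by linarith) (min_le_right _ _)⟩
  have h1 : Tendsto (fun n => ∫ x, G n x ∂μ) atTop (𝓝 (∫ x, f x ∂μ)) := by
    refine tendsto_integral_of_dominated_convergence H₀ hGm hH₀ hGle ?_
    filter_upwards [hFae, hfle] with x h1 h2
    have := (tendsto_const_nhds (x := -H₀ x)).max (h1.min (tendsto_const_nhds (x := H₀ x)))
    rw [abs_le] at h2
    rwa [min_eq_left h2.2, max_eq_right h2.1] at this
  have h2 : Tendsto (fun n => ∫ x, (F n x - G n x) ∂μ) atTop (𝓝 0) := by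
    refine squeeze_zero_norm (fun n => ?_) (tendsto_integral_abs_sub_of_tendsto_integral hH hH₀
      (fun n x => (abs_nonneg _).trans (hle n x)) hae hint)
    refine norm_integral_le_of_norm_le ((hH n).sub hH₀).abs ?_
    filter_upwards [hfle] with x hx
    have h0 : 0 ≤ H₀ x := (abs_nonneg _).trans hx
    have h3 := abs_le.1 (hle n x)
    have h4 := le_abs_self (H n x - H₀ x)
    have h5 := abs_nonneg (H n x - H₀ x)
    simp only [hG, Real.norm_eq_abs]
    rcases le_total (F n x) (H₀ x) with h | h
    · rw [min_eq_left h]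
      rcases le_total (-H₀ x) (F n x) with h' | h'
      · rw [max_eq_right h', sub_self, abs_zero]; exact h5
      · rw [max_eq_left h', abs_of_nonpos (by linarith)]; exact le_trans (by linarith) h4
    · rw [min_eq_right h, max_eq_right (by linarith), abs_of_nonneg (by linarith)]
      exact le_trans (by linarith) h4
  have h3 := h1.add h2
  rw [add_zero] at h3
  refine h3.congr fun n => ?_
  have hGi : Integrable (G n) μ := hH₀.mono' (hGm n) (hGle n)
  rw [integral_sub (hFi n) hGi]
  ring

end Pratt

/-! ### Mollification -/

section Mollification

variable {E : Type*} [NormedAddCommGroup E] [InnerProductSpace ℝ E] [FiniteDimensional ℝ E]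
  [MeasurableSpace E] [BorelSpace E]

/-- The bump functions used as mollifiers. -/
def mollifierBump (E : Type*) [NormedAddCommGroup E] (n : ℕ) : ContDiffBump (0 : E) where
  rIn := 1 / ((n : ℝ) + 1)
  rOut := 2 / ((n : ℝ) + 1)
  rIn_pos := by positivity
  rIn_lt_rOut := by gcongr; norm_num

/-- The standard mollifiers. -/
def mollifier (E : Type*) [NormedAddCommGroup E] [InnerProductSpace ℝ E] [FiniteDimensional ℝ E]
    [MeasurableSpace E] [BorelSpace E] (n : ℕ) : E → ℝ :=
  (mollifierBump E n).normed volume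

theorem mollifier_nonneg (n : ℕ) (x : E) : 0 ≤ mollifier E n x :=
  ContDiffBump.nonneg_normed _ _

theorem contDiff_mollifier (n : ℕ) : ContDiff ℝ ∞ (mollifier E n) :=
  ContDiffBump.contDiff_normed _

theorem hasCompactSupport_mollifier (n : ℕ) : HasCompactSupport (mollifier E n) :=
  ContDiffBump.hasCompactSupport_normed _

theorem integral_mollifier (n : ℕ) : ∫ x, mollifier E n x = 1 :=
  ContDiffBump.integral_normed _

/-- The outer radius `2/(n+1)` never exceeds `2`, so enlarging balls by `2` serves all `n` at once.
-/
theorem mollifier_eq_zero {n : ℕ} {x : E} (hx : 2 ≤ ‖x‖) : mollifier E n x = 0 := by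
  by_contra h
  have : x ∈ Function.support (mollifier E n) := h
  rw [mollifier, ContDiffBump.support_normed_eq, mem_ball_zero_iff] at this
  have h2 : (2 : ℝ) / ((n : ℝ) + 1) ≤ 2 := div_le_self (by norm_num) (by linarith [n.cast_nonneg (α := ℝ)])
  exact absurd (hx.trans_lt this) (not_lt.2 h2)

variable {F : Type*} [NormedAddCommGroup F] [NormedSpace ℝ F] [CompleteSpace F]

/-- Convolution with the standard mollifier. -/
def mollify (n : ℕ) (f : E → F) (x : E) : F := ∫ t, mollifier E n (x - t) • f t

theorem mollify_eq_convolution (n : ℕ) (f : E → F) :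
    mollify n f = convolution (mollifier E n) f (ContinuousLinearMap.lsmul ℝ ℝ) volume := by
  ext x
  rw [convolution_lsmul_swap]
  rfl

theorem integrable_mollifier_smul (n : ℕ) {f : E → F} (hf : LocallyIntegrable f) (x : E) :
    Integrable fun t => mollifier E n (x - t) • f t := by
  refine LocallyIntegrable.integrable_smul_left_of_hasCompactSupport hf ?_ ?_
  · have := (contDiff_mollifier (E := E) n).continuous
    fun_prop
  · exact (hasCompactSupport_mollifier (E := E) n).comp_homeomorph (Homeomorph.subLeft x)

theorem integral_mollifier_sub (n : ℕ) (x : E) : ∫ t, mollifier E n (x - t) = 1 := by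
  rw [integral_sub_left_eq_self (mollifier E n) volume x, integral_mollifier]

theorem integrable_mollifier_sub (n : ℕ) (x : E) : Integrable fun t => mollifier E n (x - t) := by
  have := integrable_mollifier_smul (F := ℝ) n (f := fun _ => 1) (locallyIntegrable_const 1) x
  simpa using this

theorem ae_tendsto_mollify {f : E → F} (hf : LocallyIntegrable f) :
    ∀ᵐ x, Tendsto (fun n => mollify n f x) atTop (𝓝 (f x)) := by
  simp_rw [mollify_eq_convolution]
  refine ContDiffBump.ae_convolution_tendsto_right_of_locallyIntegrable (K := 2) ?_ ?_ hf
  · change Tendsto (fun n : ℕ => 2 / ((n : ℝ) + 1)) atTop (𝓝 0)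
    have := tendsto_one_div_add_atTop_nhds_zero_nat (𝕜 := ℝ)
    simpa [div_eq_mul_inv] using this.const_mul 2
  · refine Eventually.of_forall fun n => ?_
    change 2 / ((n : ℝ) + 1) ≤ 2 * (1 / ((n : ℝ) + 1))
    rw [mul_one_div]

theorem contDiff_mollify (n : ℕ) {f : E → F} (hf : LocallyIntegrable f) :
    ContDiff ℝ ∞ (mollify n f) := by
  rw [mollify_eq_convolution]
  exact HasCompactSupport.contDiff_convolution_left _ (hasCompactSupport_mollifier n)
    (contDiff_mollifier n) hf

theorem le_mollify (n : ℕ) {f : E → ℝ} (hf : LocallyIntegrable f) {a : ℝ} (ha : ∀ x, a ≤ f x)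
    (x : E) : a ≤ mollify n f x := by
  have h := integral_mono ((integrable_mollifier_sub n x).mul_const a)
    (integrable_mollifier_smul n hf x)
    fun t => mul_le_mul_of_nonneg_left (ha t) (mollifier_nonneg n (x - t))
  rwa [integral_mul_const, integral_mollifier_sub, one_mul] at h

theorem mollify_congr (n : ℕ) {f g : E → F} {x : E} (h : ∀ t, ‖t‖ ≤ ‖x‖ + 2 → f t = g t) :
    mollify n f x = mollify n g x := by
  unfold mollify
  congr 1; ext t
  by_cases ht : ‖t‖ ≤ ‖x‖ + 2
  · rw [h t ht]
  · have : 2 ≤ ‖x - t‖ := by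
      have := norm_sub_norm_le t x
      rw [norm_sub_rev] at this
      linarith
    rw [mollifier_eq_zero this, zero_smul, zero_smul]

theorem mollify_le (n : ℕ) {f : E → ℝ} (hf : LocallyIntegrable f) {a : ℝ} {x : E}
    (ha : ∀ t, ‖t‖ ≤ ‖x‖ + 2 → f t ≤ a) : mollify n f x ≤ a := by
  have h := integral_mono (integrable_mollifier_smul n hf x)
    ((integrable_mollifier_sub n x).mul_const a) fun t => by
      by_cases ht : ‖t‖ ≤ ‖x‖ + 2
      · exact mul_le_mul_of_nonneg_left (ha t ht) (mollifier_nonneg n (x - t))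
      · have : 2 ≤ ‖x - t‖ := by
          have := norm_sub_norm_le t x
          rw [norm_sub_rev] at this
          linarith
        simp [mollifier_eq_zero this]
  rwa [integral_mul_const, integral_mollifier_sub, one_mul] at h

/-- Jensen's inequality for mollification. -/
theorem norm_sq_mollify_le (n : ℕ) {f : E → E} (hf : LocallyIntegrable f)
    (hf2 : LocallyIntegrable fun x => ‖f x‖ ^ 2) (x : E) :
    ‖mollify n f x‖ ^ 2 ≤ mollify n (fun x => ‖f x‖ ^ 2) x := by
  set a := mollify n f x with ha
  have i1 := integrable_mollifier_smul n hf x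
  have i2 := integrable_mollifier_smul n hf2 x
  have i3 : Integrable fun t => mollifier E n (x - t) * ⟪a, f t⟫ := by
    have := i1.const_inner (𝕜 := ℝ) a
    simpa [inner_smul_right] using this
  have e3 : ∫ t, mollifier E n (x - t) * ⟪a, f t⟫ = ‖a‖ ^ 2 := by
    have := integral_inner (𝕜 := ℝ) i1 a
    simp_rw [inner_smul_right] at this
    rw [this, ← real_inner_self_eq_norm_sq]
    rfl
  -- Average `‖f t - a‖² ≥ 0` against the mollifier, with `a` the mollified value.
  have h : ∫ t, (2 * (mollifier E n (x - t) * ⟪a, f t⟫) - mollifier E n (x - t) * ‖a‖ ^ 2) ≤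
      ∫ t, mollifier E n (x - t) • ‖f t‖ ^ 2 := by
    refine integral_mono ((i3.const_mul 2).sub ((integrable_mollifier_sub n x).mul_const _)) i2
      fun t => ?_
    have h1 : 2 * ⟪a, f t⟫ - ‖a‖ ^ 2 ≤ ‖f t‖ ^ 2 := by
      have := norm_sub_sq_real a (f t)
      nlinarith [sq_nonneg ‖a - f t‖]
    have := mul_le_mul_of_nonneg_left h1 (mollifier_nonneg n (x - t))
    simp only [smul_eq_mul]
    linarith
  rw [integral_sub (i3.const_mul 2) ((integrable_mollifier_sub n x).mul_const _),
    integral_const_mul, e3, integral_mul_const, integral_mollifier_sub] at h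
  calc ‖a‖ ^ 2 = 2 * ‖a‖ ^ 2 - 1 * ‖a‖ ^ 2 := by ring
    _ ≤ _ := h

theorem integrable_mollify (n : ℕ) {f : E → ℝ} (hf : Integrable f) : Integrable (mollify n f) := by
  rw [mollify_eq_convolution]
  exact Integrable.integrable_convolution _
    ((contDiff_mollifier n).continuous.integrable_of_hasCompactSupport
      (hasCompactSupport_mollifier n)) hf

theorem integral_mollify (n : ℕ) {f : E → ℝ} (hf : Integrable f) :
    ∫ x, mollify n f x = ∫ x, f x := by
  rw [mollify_eq_convolution, integral_convolution _
    ((contDiff_mollifier n).continuous.integrable_of_hasCompactSupport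
      (hasCompactSupport_mollifier n)) hf, integral_mollifier]
  simp

end Mollification

section EuclideanSpace

variable {d : ℕ}

local notation "𝔼" => EuclideanSpace ℝ (Fin d)

/-! ### Weak gradients -/

section WeakGradient

theorem inner_gradient (v : 𝔼) (φ : 𝔼 → ℝ) (x : 𝔼) : ⟪v, gradient φ x⟫ = fderiv ℝ φ x v := by
  rw [real_inner_comm, gradient, InnerProductSpace.toDual_symm_apply]

theorem continuous_gradient {φ : 𝔼 → ℝ} (hφ : ContDiff ℝ 1 φ) : Continuous (gradient φ) :=
  (InnerProductSpace.toDual ℝ 𝔼).symm.continuous.comp (hφ.continuous_fderiv one_ne_zero)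

theorem hasCompactSupport_gradient {φ : 𝔼 → ℝ} (hφ : HasCompactSupport φ) :
    HasCompactSupport (gradient φ) :=
  (hφ.fderiv ℝ).comp_left (g := fun L => (InnerProductSpace.toDual ℝ 𝔼).symm L) (by simp)

theorem integral_smul_gradient {U φ : 𝔼 → ℝ} (hU : ContDiff ℝ 1 U) (hφ : ContDiff ℝ 1 φ)
    (hc : HasCompactSupport φ) :
    ∫ x, U x • gradient φ x = - ∫ x, φ x • gradient U x := by
  have i1 : Integrable fun x => U x • gradient φ x :=
    (hU.continuous.smul (continuous_gradient hφ)).integrable_of_hasCompactSupport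
      (hasCompactSupport_gradient hc).smul_left
  have i2 : Integrable fun x => φ x • gradient U x :=
    (hφ.continuous.smul (continuous_gradient hU)).integrable_of_hasCompactSupport hc.smul_right
  refine ext_inner_left ℝ fun v => ?_
  have j1 := i1.const_inner (𝕜 := ℝ) v
  have j2 := i2.const_inner (𝕜 := ℝ) v
  rw [inner_neg_right, ← integral_inner i1, ← integral_inner i2]
  simp_rw [inner_smul_right, inner_gradient] at j1 j2 ⊢
  rw [integral_mul_fderiv_eq_neg_fderiv_mul_of_integrable]
  · simp_rw [mul_comm]
  · simpa only [mul_comm] using j2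
  · exact j1
  · exact (hU.continuous.mul hφ.continuous).integrable_of_hasCompactSupport hc.mul_left
  · exact fun x _ => hU.differentiable one_ne_zero x
  · exact fun x _ => hφ.differentiable one_ne_zero x

theorem IsWeakGradient.add_contDiff {g U : 𝔼 → ℝ} {G : 𝔼 → 𝔼} (hg : IsWeakGradient g G)
    (hU : ContDiff ℝ 1 U) : IsWeakGradient (fun x => g x + U x) (fun x => G x + gradient U x) := by
  refine ⟨hg.1.add hU.continuous.locallyIntegrable,
    hg.2.1.add (continuous_gradient hU).locallyIntegrable, fun φ hφ hc => ?_⟩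
  have hφ1 : ContDiff ℝ 1 φ := hφ.of_le (by simp)
  have i1 : Integrable fun x => U x • gradient φ x :=
    (hU.continuous.smul (continuous_gradient hφ1)).integrable_of_hasCompactSupport
      (hasCompactSupport_gradient hc).smul_left
  have i2 : Integrable fun x => φ x • gradient U x :=
    (hφ.continuous.smul (continuous_gradient hU)).integrable_of_hasCompactSupport hc.smul_right
  have i3 : Integrable fun x => g x • gradient φ x :=
    hg.1.integrable_smul_right_of_hasCompactSupport (continuous_gradient hφ1)
      (hasCompactSupport_gradient hc)
  have i4 : Integrable fun x => φ x • G x :=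
    hg.2.1.integrable_smul_left_of_hasCompactSupport hφ.continuous hc
  simp_rw [add_smul, smul_add]
  rw [integral_add i3 i1, integral_add i4 i2, hg.2.2 φ hφ hc, integral_smul_gradient hU hφ1 hc]
  abel

/-- Mollification commutes with taking the (weak) gradient. -/
theorem IsWeakGradient.gradient_mollify {k : 𝔼 → ℝ} {K : 𝔼 → 𝔼} (hk : IsWeakGradient k K)
    (n : ℕ) (x : 𝔼) : gradient (mollify n k) x = mollify n K x := by
  have hρ : ContDiff ℝ 1 (mollifier 𝔼 n) := (contDiff_mollifier n).of_le (by simp)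
  -- The reflection in `t ↦ x - t` reverses the sign of the gradient, which cancels the sign in the
  -- definition of the weak gradient.
  set φ : 𝔼 → ℝ := fun t => mollifier 𝔼 n (x - t) with hφ
  have hφs : ContDiff ℝ ∞ φ := (contDiff_mollifier n).comp (contDiff_const.sub contDiff_id)
  have hφc : HasCompactSupport φ :=
    (hasCompactSupport_mollifier (E := 𝔼) n).comp_homeomorph (Homeomorph.subLeft x)
  have hφg : ∀ t v, fderiv ℝ φ t v = - fderiv ℝ (mollifier 𝔼 n) (x - t) v := fun t v => by
    have h1 := (hρ.differentiable one_ne_zero (x - t)).hasFDerivAt.comp t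
      ((hasFDerivAt_id t).const_sub x)
    have h2 : HasFDerivAt φ _ t := h1
    rw [h2.fderiv]
    simp
  have hweak := hk.2.2 φ hφs hφc
  have i1 : Integrable fun t => k t • gradient φ t :=
    hk.1.integrable_smul_right_of_hasCompactSupport
      (continuous_gradient (hφs.of_le (by simp))) (hasCompactSupport_gradient hφc)
  have hder := HasCompactSupport.hasFDerivAt_convolution_left (ContinuousLinearMap.lsmul ℝ ℝ)
    (hasCompactSupport_mollifier n) hρ hk.1 x
  rw [← mollify_eq_convolution] at hder
  refine ext_inner_left ℝ fun v => ?_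
  rw [inner_gradient, hder.fderiv]
  have hK : mollify n K x = - ∫ t, k t • gradient φ t := by
    rw [hweak, neg_neg]; rfl
  rw [hK, inner_neg_right, ← integral_inner i1]
  simp_rw [inner_smul_right, inner_gradient, hφg]
  have hex := ((hasCompactSupport_mollifier (E := 𝔼) n).fderiv ℝ).convolutionExists_left
    (ContinuousLinearMap.precompL 𝔼 (ContinuousLinearMap.lsmul ℝ ℝ : ℝ →L[ℝ] ℝ →L[ℝ] ℝ))
    (hρ.continuous_fderiv one_ne_zero) hk.1 x
  rw [convolution_def, ContinuousLinearMap.integral_apply hex.integrable, ← integral_neg,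
    ← integral_sub_left_eq_self _ volume x]
  congr 1; ext t
  simp [ContinuousLinearMap.precompL_apply, mul_comm]

/-- Smooth approximation of a function with a locally square integrable weak gradient. -/
structure IsSmoothApproximation (c₀ : ℝ) (k : 𝔼 → ℝ) (K : 𝔼 → 𝔼) (kn : ℕ → 𝔼 → ℝ) : Prop where
  contDiff : ∀ n, ContDiff ℝ ∞ (kn n)
  lower : ∀ n x, c₀ ≤ kn n x
  upper : ∀ R, ∃ C, ∀ n x, ‖x‖ ≤ R → kn n x ≤ C
  ae_tendsto : ∀ᵐ x, Tendsto (fun n => kn n x) atTop (𝓝 (k x))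
  ae_tendsto_gradient : ∀ᵐ x, Tendsto (fun n => gradient (kn n) x) atTop (𝓝 (K x))
  dominated : ∀ R, ∃ (Q : ℕ → 𝔼 → ℝ) (Q₀ : 𝔼 → ℝ), (∀ n, Integrable (Q n)) ∧ Integrable Q₀ ∧
    (∀ n x, 0 ≤ Q n x) ∧ (∀ᵐ x, Tendsto (fun n => Q n x) atTop (𝓝 (Q₀ x))) ∧
    Tendsto (fun n => ∫ x, Q n x) atTop (𝓝 (∫ x, Q₀ x)) ∧
    ∀ n x, ‖x‖ ≤ R → ‖gradient (kn n) x‖ ^ 2 ≤ Q n x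

theorem IsWeakGradient.isSmoothApproximation {k : 𝔼 → ℝ} {K : 𝔼 → 𝔼} (hk : IsWeakGradient k K)
    (hK : LocallyIntegrable fun x => ‖K x‖ ^ 2) {c₀ : ℝ} (hc₀ : ∀ x, c₀ ≤ k x)
    (hup : ∀ R, ∃ C, ∀ x, ‖x‖ ≤ R → k x ≤ C) :
    IsSmoothApproximation c₀ k K fun n => mollify n k where
  contDiff n := contDiff_mollify n hk.1
  lower n x := le_mollify n hk.1 hc₀ x
  upper R := by
    obtain ⟨C, hC⟩ := hup (R + 2)
    exact ⟨C, fun n x hx => mollify_le n hk.1 fun t ht => hC t (by linarith)⟩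
  ae_tendsto := ae_tendsto_mollify hk.1
  ae_tendsto_gradient := by
    simp_rw [hk.gradient_mollify]
    exact ae_tendsto_mollify hk.2.1
  -- By Jensen, `‖∇k_n‖²` is at most the mollification of `‖K‖²` truncated to the ball of radius `R
  -- + 2`. Mollification preserves integrals, so the dominating functions have constant integral.
  dominated R := by
    set B := Metric.closedBall (0 : 𝔼) (R + 2)
    set Q₀ : 𝔼 → ℝ := B.indicator fun x => ‖K x‖ ^ 2 with hQ₀
    have hQi : Integrable Q₀ := by
      rw [integrable_indicator_iff Metric.isClosed_closedBall.measurableSet]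
      exact hK.integrableOn_isCompact (isCompact_closedBall _ _)
    have hQ0 : ∀ x, 0 ≤ Q₀ x := fun x => indicator_nonneg (fun x _ => by positivity) x
    refine ⟨fun n => mollify n Q₀, Q₀, fun n => integrable_mollify n hQi, hQi,
      fun n x => le_mollify n hQi.locallyIntegrable hQ0 x,
      ae_tendsto_mollify hQi.locallyIntegrable, ?_, fun n x hx => ?_⟩
    · simp_rw [integral_mollify _ hQi]
      exact tendsto_const_nhds
    · rw [hk.gradient_mollify]
      refine (norm_sq_mollify_le n hk.2.1 hK x).trans (le_of_eq (mollify_congr n fun t ht => ?_))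
      rw [hQ₀, indicator_of_mem]
      rw [mem_closedBall_zero_iff]
      linarith

/-- Passage to the limit in integrals that are quadratic in the gradient. -/
theorem IsSmoothApproximation.tendsto_integral {c₀ : ℝ} {k : 𝔼 → ℝ} {K : 𝔼 → 𝔼}
    {kn : ℕ → 𝔼 → ℝ} (h : IsSmoothApproximation c₀ k K kn) (hc₀ : 0 < c₀)
    {a₀ a₂ : 𝔼 → ℝ → ℝ} {a₁ : 𝔼 → ℝ → 𝔼} {R : ℝ}
    (h₀ : ContinuousOn (fun z : 𝔼 × ℝ => a₀ z.1 z.2) (univ ×ˢ Ioi 0))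
    (h₁ : ContinuousOn (fun z : 𝔼 × ℝ => a₁ z.1 z.2) (univ ×ˢ Ioi 0))
    (h₂ : ContinuousOn (fun z : 𝔼 × ℝ => a₂ z.1 z.2) (univ ×ˢ Ioi 0))
    (hz₀ : ∀ x s, R < ‖x‖ → a₀ x s = 0) (hz₁ : ∀ x s, R < ‖x‖ → a₁ x s = 0)
    (hz₂ : ∀ x s, R < ‖x‖ → a₂ x s = 0) :
    Integrable (fun x => a₀ x (k x) + ⟪a₁ x (k x), K x⟫ + a₂ x (k x) * ‖K x‖ ^ 2) ∧
    Tendsto (fun n => ∫ x, (a₀ x (kn n x) + ⟪a₁ x (kn n x), gradient (kn n) x⟫ +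
      a₂ x (kn n x) * ‖gradient (kn n) x‖ ^ 2)) atTop
      (𝓝 (∫ x, (a₀ x (k x) + ⟪a₁ x (k x), K x⟫ + a₂ x (k x) * ‖K x‖ ^ 2))) := by
  obtain ⟨C, hC⟩ := h.upper R
  obtain ⟨Q, Q₀, hQ, hQ₀, hQpos, hQae, hQint, hQle⟩ := h.dominated R
  -- For `‖x‖ ≤ R` the pairs `(x, kn n x)` stay in this compact set, where the coefficients are
  -- bounded. The lower bound `c₀ > 0` keeps it away from the singularity at `s = 0`.
  set S := Metric.closedBall (0 : 𝔼) R ×ˢ Icc c₀ C with hS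
  have hSc : IsCompact S := (isCompact_closedBall _ _).prod isCompact_Icc
  have hSsub : S ⊆ univ ×ˢ Ioi 0 := fun z hz => ⟨mem_univ _, hc₀.trans_le hz.2.1⟩
  obtain ⟨A₀, hA₀⟩ := hSc.exists_bound_of_continuousOn (h₀.mono hSsub)
  obtain ⟨A₁, hA₁⟩ := hSc.exists_bound_of_continuousOn (h₁.mono hSsub)
  obtain ⟨A₂, hA₂⟩ := hSc.exists_bound_of_continuousOn (h₂.mono hSsub)
  set A := max (max A₀ A₁) (max A₂ 0) with hA
  have hA0 : 0 ≤ A := (le_max_right _ _).trans (le_max_right _ _)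
  set B := Metric.closedBall (0 : 𝔼) R with hB
  have hBm : MeasurableSet B := Metric.isClosed_closedBall.measurableSet
  have hBi : Integrable (B.indicator fun _ : 𝔼 => (1 : ℝ)) := by
    rw [integrable_indicator_iff hBm]
    exact continuous_const.continuousOn.integrableOn_compact (isCompact_closedBall _ _)
  have hcomp : ∀ {Y : Type} [TopologicalSpace Y] {a : 𝔼 → ℝ → Y},
      ContinuousOn (fun z : 𝔼 × ℝ => a z.1 z.2) (univ ×ˢ Ioi 0) → ∀ n,
      Continuous fun x => a x (kn n x) := fun ha n => by
    have hk := (h.contDiff n).continuous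
    exact ha.comp_continuous (f := fun x => (x, kn n x)) (by fun_prop)
      fun x => ⟨mem_univ _, hc₀.trans_le (h.lower n x)⟩
  have hlim : ∀ {Y : Type} [TopologicalSpace Y] {a : 𝔼 → ℝ → Y},
      ContinuousOn (fun z : 𝔼 × ℝ => a z.1 z.2) (univ ×ˢ Ioi 0) → ∀ x,
      Tendsto (fun n => kn n x) atTop (𝓝 (k x)) →
      Tendsto (fun n => a x (kn n x)) atTop (𝓝 (a x (k x))) := fun ha x hx => by
    have hpos : 0 < k x := hc₀.trans_le (ge_of_tendsto' hx fun n => h.lower n x)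
    have hopen : IsOpen ((univ : Set 𝔼) ×ˢ Ioi (0 : ℝ)) := isOpen_univ.prod isOpen_Ioi
    have hcont := (ha.continuousAt (hopen.mem_nhds (x := (x, k x)) ⟨mem_univ _, hpos⟩)).tendsto
    exact hcont.comp (tendsto_const_nhds.prodMk_nhds hx)
  refine tendsto_integral_of_tendsto_dominating
    (H := fun n x => 2 * A * (B.indicator (fun _ => (1 : ℝ)) x + Q n x))
    (H₀ := fun x => 2 * A * (B.indicator (fun _ => (1 : ℝ)) x + Q₀ x))
    (fun n => ?_) (fun n => (hBi.add (hQ n)).const_mul _) ((hBi.add hQ₀).const_mul _)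
    (fun n x => ?_) ?_ ?_ ?_
  · have c0 := hcomp h₀ n
    have c1 := hcomp h₁ n
    have c2 := hcomp h₂ n
    have c3 := continuous_gradient ((h.contDiff n).of_le (m := 1) (by simp))
    exact ((c0.add (c1.inner c3)).add (c2.mul (c3.norm.pow 2))).aestronglyMeasurable
  · by_cases hx : ‖x‖ ≤ R
    · have hxB : x ∈ B := mem_closedBall_zero_iff.2 hx
      have hmem : (x, kn n x) ∈ S := ⟨hxB, h.lower n x, hC n x hx⟩
      have b0 : |a₀ x (kn n x)| ≤ A :=
        (hA₀ _ hmem).trans ((le_max_left _ _).trans (le_max_left _ _))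
      have b1 : ‖a₁ x (kn n x)‖ ≤ A :=
        (hA₁ _ hmem).trans ((le_max_right _ _).trans (le_max_left _ _))
      have b2 : |a₂ x (kn n x)| ≤ A :=
        (hA₂ _ hmem).trans ((le_max_left _ _).trans (le_max_right _ _))
      have hq := hQle n x hx
      rw [indicator_of_mem hxB]
      set y := gradient (kn n) x
      have e1 : |⟪a₁ x (kn n x), y⟫| ≤ A * ‖y‖ :=
        (abs_real_inner_le_norm _ _).trans (by gcongr)
      have e2 : |a₂ x (kn n x) * ‖y‖ ^ 2| ≤ A * ‖y‖ ^ 2 := by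
        rw [abs_mul, abs_of_nonneg (sq_nonneg ‖y‖)]
        gcongr
      have e3 : A * ‖y‖ ≤ A * (1 + ‖y‖ ^ 2) := by
        gcongr
        nlinarith [sq_nonneg (‖y‖ - 1)]
      have e4 : A * ‖y‖ ^ 2 ≤ A * Q n x := by gcongr
      calc _ ≤ |a₀ x (kn n x)| + |⟪a₁ x (kn n x), y⟫| + |a₂ x (kn n x) * ‖y‖ ^ 2| :=
            abs_add_three _ _ _
        _ ≤ _ := by linarith
    · rw [hz₀ x _ (not_le.1 hx), hz₁ x _ (not_le.1 hx), hz₂ x _ (not_le.1 hx)]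
      simp only [inner_zero_left, zero_mul, add_zero, abs_zero]
      have := hQpos n x
      have := indicator_nonneg (s := B) (f := fun _ : 𝔼 => (1 : ℝ)) (fun _ _ => zero_le_one) x
      positivity
  · filter_upwards [h.ae_tendsto, h.ae_tendsto_gradient] with x hx hg
    exact ((hlim h₀ x hx).add ((hlim h₁ x hx).inner hg)).add
      ((hlim h₂ x hx).mul (hg.norm.pow 2))
  · filter_upwards [hQae] with x hx
    exact (tendsto_const_nhds.add hx).const_mul _
  · simp_rw [integral_const_mul]
    rw [integral_add hBi hQ₀]
    simp_rw [fun n => integral_add hBi (hQ n)]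
    exact (tendsto_const_nhds.add hQint).const_mul _

end WeakGradient

/-! ### Scalar inequalities -/

section Scalar

/-- Comparison with a parabola from a comparison of the derivatives. -/
theorem le_mul_sq_of_deriv_le {f f' : ℝ → ℝ} {a b C : ℝ} (ha : a ≤ 1) (hb : 1 ≤ b)
    (hf : ∀ s ∈ Icc a b, HasDerivAt f (f' s) s) (h1 : f 1 = 0)
    (hle : ∀ s ∈ Icc a b, f' s * (s - 1) ≤ 2 * C * (s - 1) ^ 2) {s : ℝ} (hs : s ∈ Icc a b) :
    f s ≤ C * (s - 1) ^ 2 := by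
  set g : ℝ → ℝ := fun s => f s - C * (s - 1) ^ 2 with hg
  have hgd : ∀ s ∈ Icc a b, HasDerivAt g (f' s - 2 * C * (s - 1)) s := fun s hs => by
    have := (hf s hs).sub ((((hasDerivAt_id s).sub_const 1).pow 2).const_mul C)
    refine this.congr_deriv ?_
    simp; ring
  have hg1 : g 1 = 0 := by simp [hg, h1]
  suffices g s ≤ 0 by simp only [hg] at this; linarith
  rw [← hg1]
  rcases le_total 1 s with h | h
  · have hsub : Icc 1 b ⊆ Icc a b := Icc_subset_Icc_left ha
    refine antitoneOn_of_hasDerivWithinAt_nonpos (f' := fun s => f' s - 2 * C * (s - 1))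
      (convex_Icc 1 b) (fun s hs => (hgd s (hsub hs)).continuousAt.continuousWithinAt)
      (fun s hs => (hgd s (hsub (interior_subset hs))).hasDerivWithinAt) (fun s hs => ?_)
      ⟨le_rfl, hb⟩ ⟨h, hs.2⟩ h
    rw [interior_Icc] at hs
    have h0 : 0 < s - 1 := by linarith [hs.1]
    have := hle s (hsub (Ioo_subset_Icc_self hs))
    by_contra! hcon
    nlinarith
  · have hsub : Icc a 1 ⊆ Icc a b := Icc_subset_Icc_right hb
    refine monotoneOn_of_hasDerivWithinAt_nonneg (f' := fun s => f' s - 2 * C * (s - 1))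
      (convex_Icc a 1) (fun s hs => (hgd s (hsub hs)).continuousAt.continuousWithinAt)
      (fun s hs => (hgd s (hsub (interior_subset hs))).hasDerivWithinAt) (fun s hs => ?_)
      ⟨hs.1, h⟩ ⟨ha, le_rfl⟩ h
    rw [interior_Icc] at hs
    have h0 : s - 1 < 0 := by linarith [hs.2]
    have := hle s (hsub (Ioo_subset_Icc_self hs))
    by_contra! hcon
    nlinarith

variable {m : ℝ} (hm0 : 0 < m) (hm1 : m < 1) {a b : ℝ} (ha0 : 0 < a) (ha : a ≤ 1) (hb : 1 ≤ b)

/-- The function `(s ^ (m - 1) - 1) / (m - 1)`. -/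
def pressure (m s : ℝ) : ℝ := (s ^ (m - 1) - 1) / (m - 1)

include hm1 in
theorem hasDerivAt_pressure {s : ℝ} (hs : 0 < s) :
    HasDerivAt (pressure m) (s ^ (m - 2)) s := by
  have := ((Real.hasDerivAt_rpow_const (p := m - 1) (Or.inl hs.ne')).sub_const 1).div_const (m - 1)
  refine this.congr_deriv ?_
  have : m - 1 ≠ 0 := by linarith
  rw [show m - 1 - 1 = m - 2 by ring]
  field_simp

include hm1 ha0 ha hb in
-- Mean value theorem: `t` is the derivative `ξ ^ (m - 2)` at a point between `1` and `s`. For `s =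
-- 1` any `t` in the range will do.
theorem exists_pressure_eq {s : ℝ} (hs : s ∈ Icc a b) :
    ∃ t, b ^ (m - 2) ≤ t ∧ t ≤ a ^ (m - 2) ∧ pressure m s = t * (s - 1) := by
  have hmem : ∀ ξ ∈ Icc a b, b ^ (m - 2) ≤ ξ ^ (m - 2) ∧ ξ ^ (m - 2) ≤ a ^ (m - 2) :=
    fun ξ hξ => ⟨Real.rpow_le_rpow_of_nonpos (ha0.trans_le hξ.1) hξ.2 (by linarith),
      Real.rpow_le_rpow_of_nonpos ha0 hξ.1 (by linarith)⟩
  have h1 : pressure m 1 = 0 := by simp [pressure]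
  have hd : ∀ ξ ∈ Icc a b, HasDerivAt (pressure m) (ξ ^ (m - 2)) ξ := fun ξ hξ =>
    hasDerivAt_pressure hm1 (ha0.trans_le hξ.1)
  rcases lt_trichotomy s 1 with h | h | h
  · have hsub : Icc s 1 ⊆ Icc a b := Icc_subset_Icc hs.1 hb
    obtain ⟨ξ, hξ, he⟩ := exists_hasDerivAt_eq_slope (pressure m) (fun ξ => ξ ^ (m - 2)) h
      (fun ξ hξ => (hd ξ (hsub hξ)).continuousAt.continuousWithinAt)
      (fun ξ hξ => hd ξ (hsub (Ioo_subset_Icc_self hξ)))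
    have hξ' := hmem ξ (hsub (Ioo_subset_Icc_self hξ))
    refine ⟨ξ ^ (m - 2), hξ'.1, hξ'.2, ?_⟩
    rw [he, h1]
    have : 1 - s ≠ 0 := by linarith
    field_simp
    ring
  · refine ⟨b ^ (m - 2), le_rfl, ?_, by rw [h, h1]; ring⟩
    exact Real.rpow_le_rpow_of_nonpos ha0 (ha.trans hb) (by linarith)
  · have hsub : Icc 1 s ⊆ Icc a b := Icc_subset_Icc ha hs.2
    obtain ⟨ξ, hξ, he⟩ := exists_hasDerivAt_eq_slope (pressure m) (fun ξ => ξ ^ (m - 2)) h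
      (fun ξ hξ => (hd ξ (hsub hξ)).continuousAt.continuousWithinAt)
      (fun ξ hξ => hd ξ (hsub (Ioo_subset_Icc_self hξ)))
    have hξ' := hmem ξ (hsub (Ioo_subset_Icc_self hξ))
    refine ⟨ξ ^ (m - 2), hξ'.1, hξ'.2, ?_⟩
    rw [he, h1]
    have : s - 1 ≠ 0 := by linarith
    field_simp
    ring

include hm0 hm1 ha0 ha hb in
/-- The relative entropy density is comparable with the square of `s - 1`. -/
theorem entropy_bounds {s : ℝ} (hs : s ∈ Icc a b) :
    0 ≤ 1 / (1 - m) * ((s - 1) - 1 / m * (s ^ m - 1)) ∧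
    1 / (1 - m) * ((s - 1) - 1 / m * (s ^ m - 1)) ≤ a ^ (m - 2) / 2 * (s - 1) ^ 2 := by
  have hd : ∀ s ∈ Icc a b, HasDerivAt (fun s => 1 / (1 - m) * ((s - 1) - 1 / m * (s ^ m - 1)))
      (pressure m s) s := fun s hs => by
    have h0 : 0 < s := ha0.trans_le hs.1
    have := (((hasDerivAt_id s).sub_const 1).sub
      (((Real.hasDerivAt_rpow_const (p := m) (Or.inl h0.ne')).sub_const 1).const_mul
        (1 / m))).const_mul (1 / (1 - m))
    refine this.congr_deriv ?_
    have h1 : 1 - m ≠ 0 := by linarith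
    have h2 : m - 1 ≠ 0 := by linarith
    rw [pressure]
    field_simp
    ring
  constructor
  · have := le_mul_sq_of_deriv_le (C := 0) ha hb (fun s hs => (hd s hs).neg) (by simp)
      (fun s hs => ?_) hs
    · simpa using this
    · obtain ⟨t, h1, -, h3⟩ := exists_pressure_eq hm1 ha0 ha hb hs
      have : 0 < t := lt_of_lt_of_le (Real.rpow_pos_of_pos (by linarith) _) h1
      rw [h3]
      nlinarith [mul_nonneg this.le (sq_nonneg (s - 1))]
  · refine le_mul_sq_of_deriv_le ha hb hd (by simp) (fun s hs => ?_) hs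
    obtain ⟨t, -, h2, h3⟩ := exists_pressure_eq hm1 ha0 ha hb hs
    rw [h3]
    nlinarith [mul_le_mul_of_nonneg_right h2 (sq_nonneg (s - 1))]

include hm1 in
theorem continuousOn_pressure : ContinuousOn (pressure m) (Ioi 0) := fun _ hs =>
  (hasDerivAt_pressure hm1 hs).continuousAt.continuousWithinAt

include hm1 in
theorem continuousOn_rpow_mul_pressure :
    ContinuousOn (fun s => 2 * s ^ (m - 1) * pressure m s) (Ioi 0) :=
  (continuousOn_const.mul (continuousOn_id.rpow_const fun _ hs => Or.inl (ne_of_gt hs))).mul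
    (continuousOn_pressure hm1)

include hm1 in
/-- A primitive of `2 s ^ (m - 1) * pressure m s`. -/
theorem exists_primitive_pressure : ∃ ψ : ℝ → ℝ, ψ 1 = 0 ∧
    ∀ s, 0 < s → HasDerivAt ψ (2 * s ^ (m - 1) * pressure m s) s := by
  refine ⟨fun s => ∫ τ in (1 : ℝ)..s, 2 * τ ^ (m - 1) * pressure m τ, by simp, fun s hs => ?_⟩
  have hc := continuousOn_rpow_mul_pressure hm1
  refine intervalIntegral.integral_hasDerivAt_right ?_
    (hc.stronglyMeasurableAtFilter isOpen_Ioi s hs) (hc.continuousAt (Ioi_mem_nhds hs))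
  refine (hc.mono fun τ hτ => ?_).intervalIntegrable
  exact lt_of_lt_of_le (lt_min one_pos hs) hτ.1

variable {E : Type*} [NormedAddCommGroup E] [InnerProductSpace ℝ E]

include hm0 hm1 ha0 ha hb in
/-- The pointwise inequality between the linearized and the nonlinear Fisher informations, up to
the derivative of a function which is controlled by `(s - 1) ^ 2`. -/
theorem exists_fisher_comparison : ∃ Z Z' : ℝ → ℝ,
    (∀ s, 0 < s → HasDerivAt Z (Z' s) s) ∧ ContinuousOn Z' (Ioi 0) ∧
    (∀ s ∈ Icc a b, 0 ≤ Z s ∧ Z s ≤ ((b / a) ^ (2 * (2 - m)) - 1) * (s - 1) ^ 2) ∧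
    ∀ s ∈ Icc a b, ∀ X Y : E, ‖X + (s - 1) • Y‖ ^ 2 ≤
      b ^ (2 * (2 - m)) / a * s * ‖s ^ (m - 2) • X + pressure m s • Y‖ ^ 2 - Z' s * ⟪X, Y⟫ := by
  obtain ⟨ψ, hψ1, hψ⟩ := exists_primitive_pressure hm1
  -- This `κ` is dictated by the coefficient of `‖Y‖²`, which needs `κ s t² ≥ 1` for all `s ≥ a` and
  -- `t ≥ b ^ (m - 2)`. The coefficient of `‖X‖²` only needs `κ b ^ (2m - 3) ≥ 1`.
  set κ := b ^ (2 * (2 - m)) / a with hκ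
  have hb0 : 0 < b := by linarith
  have hκ0 : 0 < κ := by positivity
  have hab : a ≤ b := ha.trans hb
  have hκb : 1 ≤ κ * b ^ (2 * m - 3) := by
    have : κ * b ^ (2 * m - 3) = b / a := by
      rw [hκ, div_mul_eq_mul_div, ← Real.rpow_add hb0]
      congr 1
      rw [show 2 * (2 - m) + (2 * m - 3) = 1 by ring, Real.rpow_one]
    rw [this, le_div_iff₀ ha0]
    linarith
  have hκa : κ * a ^ (2 * m - 3) = (b / a) ^ (2 * (2 - m)) := by
    rw [hκ, Real.div_rpow hb0.le ha0.le, div_mul_eq_mul_div, div_eq_div_iff ha0.ne'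
      (Real.rpow_pos_of_pos ha0 _).ne', mul_assoc, ← Real.rpow_add ha0,
      show 2 * m - 3 + 2 * (2 - m) = 1 by ring, Real.rpow_one]
  have hκ1 : κ * (b ^ (m - 2)) ^ 2 * a = 1 := by
    rw [hκ, ← Real.rpow_natCast, ← Real.rpow_mul hb0.le, div_mul_eq_mul_div,
      div_mul_cancel₀ _ ha0.ne', ← Real.rpow_add hb0]
    rw [show 2 * (2 - m) + (m - 2) * (2 : ℕ) = 0 by push_cast; ring, Real.rpow_zero]
  -- The derivative of `Z` is the difference of the two cross-term coefficients. The bounds on `Z`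
  -- follow from `b^(2m-3) (s-1)² ≤ ψ s ≤ a^(2m-3) (s-1)²` and the values of `κ b^(2m-3)` and `κ
  -- a^(2m-3)` above.
  refine ⟨fun s => κ * ψ s - (s - 1) ^ 2, fun s => κ * (2 * s ^ (m - 1) * pressure m s) -
    2 * (s - 1), fun s hs => ?_, ?_, fun s hs => ⟨?_, ?_⟩, fun s hs X Y => ?_⟩
  · have := ((hψ s hs).const_mul κ).sub (((hasDerivAt_id s).sub_const 1).pow 2)
    refine this.congr_deriv ?_
    simp
  · exact (continuousOn_const.mul (continuousOn_rpow_mul_pressure hm1)).sub (by fun_prop)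
  · have := le_mul_sq_of_deriv_le (f := fun s => -ψ s) (C := -b ^ (2 * m - 3)) ha hb
      (fun s hs => (hψ s (ha0.trans_le hs.1)).neg) (by simp [hψ1]) (fun s hs => ?_) hs
    · nlinarith [sq_nonneg (s - 1), mul_le_mul_of_nonneg_right hκb (sq_nonneg (s - 1))]
    · obtain ⟨t, h1, -, h3⟩ := exists_pressure_eq hm1 ha0 ha hb hs
      have hs0 : 0 < s := ha0.trans_le hs.1
      have e1 : b ^ (m - 1) ≤ s ^ (m - 1) := Real.rpow_le_rpow_of_nonpos hs0 hs.2 (by linarith)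
      have e2 : b ^ (2 * m - 3) ≤ s ^ (m - 1) * t := by
        rw [show 2 * m - 3 = (m - 1) + (m - 2) by ring, Real.rpow_add hb0]
        gcongr
      rw [h3]
      nlinarith [mul_le_mul_of_nonneg_right e2 (sq_nonneg (s - 1))]
  · have := le_mul_sq_of_deriv_le (f := ψ) (C := a ^ (2 * m - 3)) ha hb
      (fun s hs => hψ s (ha0.trans_le hs.1)) hψ1 (fun s hs => ?_) hs
    · rw [← hκa]
      nlinarith [mul_le_mul_of_nonneg_left this hκ0.le]
    · obtain ⟨t, h1, h2, h3⟩ := exists_pressure_eq hm1 ha0 ha hb hs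
      have hs0 : 0 < s := ha0.trans_le hs.1
      have ht : 0 ≤ t := le_trans (Real.rpow_nonneg hb0.le _) h1
      have e1 : s ^ (m - 1) ≤ a ^ (m - 1) := Real.rpow_le_rpow_of_nonpos ha0 hs.1 (by linarith)
      have e2 : s ^ (m - 1) * t ≤ a ^ (2 * m - 3) := by
        rw [show 2 * m - 3 = (m - 1) + (m - 2) by ring, Real.rpow_add ha0]
        gcongr
      rw [h3]
      nlinarith [mul_le_mul_of_nonneg_right e2 (sq_nonneg (s - 1))]
  · obtain ⟨t, h1, h2, h3⟩ := exists_pressure_eq hm1 ha0 ha hb hs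
    have hs0 : 0 < s := ha0.trans_le hs.1
    have e1 : 1 ≤ κ * s * (s ^ (m - 2)) ^ 2 := by
      refine hκb.trans ?_
      rw [mul_assoc]
      gcongr
      have : s * (s ^ (m - 2)) ^ 2 = s ^ (2 * m - 3) := by
        rw [← Real.rpow_natCast, ← Real.rpow_mul hs0.le]
        nth_rewrite 1 [← Real.rpow_one s]
        rw [← Real.rpow_add hs0]
        congr 1
        push_cast; ring
      rw [this]
      exact Real.rpow_le_rpow_of_nonpos hs0 hs.2 (by linarith)
    have e2 : (s - 1) ^ 2 ≤ κ * s * pressure m s ^ 2 := by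
      have hb2 : 0 < b ^ (m - 2) := Real.rpow_pos_of_pos hb0 _
      have : 1 ≤ κ * s * t ^ 2 := by
        calc (1 : ℝ) = κ * a * (b ^ (m - 2)) ^ 2 := by rw [← hκ1]; ring
          _ ≤ κ * s * t ^ 2 := by
            have := hs.1
            gcongr
      rw [h3]
      nlinarith [mul_le_mul_of_nonneg_right this (sq_nonneg (s - 1))]
    have e3 : s * s ^ (m - 2) = s ^ (m - 1) := by
      rw [mul_comm, ← Real.rpow_add_one hs0.ne']
      congr 1; ring
    have n1 := norm_add_sq_real X ((s - 1) • Y)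
    have n2 := norm_add_sq_real (s ^ (m - 2) • X) (pressure m s • Y)
    rw [inner_smul_right, norm_smul, mul_pow, Real.norm_eq_abs, sq_abs] at n1
    rw [inner_smul_right, inner_smul_left, norm_smul, norm_smul, mul_pow, mul_pow,
      Real.norm_eq_abs, Real.norm_eq_abs, sq_abs, sq_abs] at n2
    simp only [conj_trivial] at n2
    rw [n1, n2]
    beta_reduce
    rw [← e3]
    nlinarith [mul_le_mul_of_nonneg_right e1 (sq_nonneg ‖X‖),
      mul_le_mul_of_nonneg_right e2 (sq_nonneg ‖Y‖)]

end Scalar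

/-! ### Functional inequalities for the pressure variable -/

section Pressure

theorem contDiffAt_of_hasDerivAt {Z Z' : ℝ → ℝ} (hZ : ∀ s, 0 < s → HasDerivAt Z (Z' s) s)
    (hZ' : ContinuousOn Z' (Ioi 0)) {s : ℝ} (hs : 0 < s) : ContDiffAt ℝ 1 Z s := by
  have h : ContDiffOn ℝ (0 + 1) Z (Ioi 0) := by
    rw [contDiffOn_succ_iff_deriv_of_isOpen isOpen_Ioi]
    refine ⟨fun s hs => (hZ s hs).differentiableAt.differentiableWithinAt, by simp, ?_⟩
    rw [contDiffOn_zero]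
    exact hZ'.congr fun s hs => (hZ s hs).deriv
  rw [zero_add] at h
  exact h.contDiffAt (Ioi_mem_nhds hs)

theorem exists_radius_of_hasCompactSupport {χ : 𝔼 → ℝ} (hχ : HasCompactSupport χ) :
    ∃ R, ∀ x, R < ‖x‖ → χ x = 0 ∧ gradient χ x = 0 ∧ fderiv ℝ χ x = 0 := by
  obtain ⟨R, hR⟩ := hχ.isCompact.isBounded.subset_closedBall 0
  refine ⟨R, fun x hx => ?_⟩
  have hn : x ∉ tsupport χ := fun h => by
    have := hR h
    rw [mem_closedBall_zero_iff] at this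
    linarith
  have hf : fderiv ℝ χ x = 0 := fderiv_of_notMem_tsupport ℝ hn
  refine ⟨image_eq_zero_of_notMem_tsupport hn, ?_, hf⟩
  rw [gradient, hf, map_zero]

/-- The relative density `(s / U(x)) ^ (-p)` as a function of the pressure `s`. -/
def relDensity (c D p : ℝ) (x : 𝔼) (s : ℝ) : ℝ := (s / quad c D x) ^ (-p)

variable {c D p : ℝ} (hc : 0 < c) (hD : 0 < D)
include hc hD

theorem relDensity_pos (x : 𝔼) {s : ℝ} (hs : 0 < s) : 0 < relDensity c D p x s :=
  Real.rpow_pos_of_pos (div_pos hs (quad_pos hc hD x)) _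

theorem continuousOn_relDensity :
    ContinuousOn (fun z : 𝔼 × ℝ => relDensity c D p z.1 z.2) (univ ×ˢ Ioi 0) := by
  have hq : Continuous fun z : 𝔼 × ℝ => quad c D z.1 :=
    (contDiff_quad (E := 𝔼)).continuous.comp continuous_fst
  refine (continuousOn_snd.div hq.continuousOn fun z _ => (quad_pos hc hD z.1).ne').rpow_const
    fun z hz => Or.inl (div_pos hz.2 (quad_pos hc hD z.1)).ne'

theorem contDiff_relDensity {k : 𝔼 → ℝ} (hk : ContDiff ℝ ∞ k) (hk0 : ∀ x, 0 < k x) :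
    ContDiff ℝ ∞ fun x => relDensity c D p x (k x) :=
  (hk.div contDiff_quad fun x => (quad_pos hc hD x).ne').rpow_const_of_ne
    fun x => (div_pos (hk0 x) (quad_pos hc hD x)).ne'

theorem hasFDerivAt_relDensity {k : 𝔼 → ℝ} {L : 𝔼 →L[ℝ] ℝ} {x : 𝔼} (hk : HasFDerivAt k L x)
    (hk0 : 0 < k x) :
    HasFDerivAt (fun x => relDensity c D p x (k x))
      ((-(p * relDensity c D p x (k x) * (k x)⁻¹)) • L +
        (p * relDensity c D p x (k x) * (quad c D x)⁻¹ * (2 * c)) •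
          (innerSL ℝ x : 𝔼 →L[ℝ] ℝ)) x := by
  have hU := quad_pos hc hD x
  have h1 := (hk.mul ((hasDerivAt_inv hU.ne').comp_hasFDerivAt x
    (hasFDerivAt_quad (c := c) (D := D) x))).rpow_const (p := -p)
    (Or.inl (mul_pos hk0 (inv_pos.2 hU)).ne')
  have h2 : HasFDerivAt (fun x => relDensity c D p x (k x)) _ x := h1
  refine h2.congr_fderiv ?_
  have e : (k x * (quad c D x)⁻¹) ^ (-p - 1) =
      relDensity c D p x (k x) * (quad c D x * (k x)⁻¹) := by
    rw [relDensity, Real.rpow_sub_one (mul_pos hk0 (inv_pos.2 hU)).ne', ← div_eq_mul_inv]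
    field_simp
  simp only [Pi.mul_apply, Function.comp_apply, e]
  ext v
  simp only [smul_apply, add_apply, smul_eq_mul]
  field_simp
  ring

/-- The Euler identity for `χ² Z(w)`, in the smooth case. -/
theorem integral_euler_relDensity {Z Z' : ℝ → ℝ} (hZ : ∀ s, 0 < s → HasDerivAt Z (Z' s) s)
    (hZ' : ContinuousOn Z' (Ioi 0)) {χ : 𝔼 → ℝ} (hχ : ContDiff ℝ ∞ χ) (hχc : HasCompactSupport χ)
    {k : 𝔼 → ℝ} (hk : ContDiff ℝ ∞ k) (hk0 : ∀ x, 0 < k x) :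
    ∫ x, (((d * χ x ^ 2 + 2 * χ x * fderiv ℝ χ x x) * Z (relDensity c D p x (k x)) *
        weight c D (p - 1) x +
      χ x ^ 2 * Z (relDensity c D p x (k x)) * fderiv ℝ (weight c D (p - 1)) x x +
      χ x ^ 2 * weight c D (p - 1) x * Z' (relDensity c D p x (k x)) *
        (p * relDensity c D p x (k x) * (quad c D x)⁻¹ * (2 * c) * ‖x‖ ^ 2)) +
      ⟪(-(χ x ^ 2 * weight c D (p - 1) x * Z' (relDensity c D p x (k x)) *
        (p * relDensity c D p x (k x) * (k x)⁻¹))) • x, gradient k x⟫) = 0 := by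
  have hw := contDiff_relDensity (p := p) hc hD hk hk0
  have hwt := contDiff_weight (E := 𝔼) hc hD (p - 1)
  have hZw : ContDiff ℝ 1 fun x => Z (relDensity c D p x (k x)) := by
    rw [contDiff_iff_contDiffAt]
    intro x
    exact (contDiffAt_of_hasDerivAt hZ hZ' (relDensity_pos hc hD x (hk0 x))).comp x
      (hw.of_le (by simp)).contDiffAt
  have hF : ContDiff ℝ 1 fun x => χ x ^ 2 * Z (relDensity c D p x (k x)) * weight c D (p - 1) x :=
    (((hχ.of_le (by simp)).pow 2).mul hZw).mul (hwt.of_le (by simp))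
  have hFc : HasCompactSupport fun x =>
      χ x ^ 2 * Z (relDensity c D p x (k x)) * weight c D (p - 1) x :=
    (HasCompactSupport.mul_right (hχc.comp_left (g := fun t : ℝ => t ^ 2) (by simp))).mul_right
  refine Eq.trans ?_ (integral_euler_eq_zero_of_hasCompactSupport hF hFc)
  congr 1; ext x
  have d1 := (hχ.differentiable (by simp) x).hasFDerivAt
  have d2 := (hZ _ (relDensity_pos hc hD x (hk0 x))).comp_hasFDerivAt x
    (hasFDerivAt_relDensity (p := p) hc hD (hk.differentiable (by simp) x).hasFDerivAt (hk0 x))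
  have d3 := (hwt.differentiable (by simp) x).hasFDerivAt
  have d4 : HasFDerivAt (fun x => χ x ^ 2 * Z (relDensity c D p x (k x)) * weight c D (p - 1) x)
    _ x := ((d1.pow 2).mul d2).mul d3
  rw [d4.fderiv]
  simp only [inner_smul_left, inner_gradient, finrank_euclideanSpace, Fintype.card_fin,
    add_apply, smul_apply, smul_eq_mul, innerSL_apply_apply, real_inner_self_eq_norm_sq,
    Function.comp_apply, conj_trivial, nsmul_eq_mul, Pi.mul_apply]
  push_cast
  ring

/-- The Euler identity for `χ² Z(w)`. -/
theorem IsSmoothApproximation.integral_euler {Z Z' : ℝ → ℝ}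
    (hZ : ∀ s, 0 < s → HasDerivAt Z (Z' s) s) (hZ' : ContinuousOn Z' (Ioi 0)) {χ : 𝔼 → ℝ}
    (hχ : ContDiff ℝ ∞ χ) (hχc : HasCompactSupport χ) {c₀ : ℝ} {k : 𝔼 → ℝ} {K : 𝔼 → 𝔼}
    {kn : ℕ → 𝔼 → ℝ} (h : IsSmoothApproximation c₀ k K kn) (hc₀ : 0 < c₀) {T : 𝔼 → ℝ}
    (hT : ∀ x, T x = ((d * χ x ^ 2 + 2 * χ x * fderiv ℝ χ x x) * Z (relDensity c D p x (k x)) *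
        weight c D (p - 1) x +
      χ x ^ 2 * Z (relDensity c D p x (k x)) * fderiv ℝ (weight c D (p - 1)) x x +
      χ x ^ 2 * weight c D (p - 1) x * Z' (relDensity c D p x (k x)) *
        (p * relDensity c D p x (k x) * (quad c D x)⁻¹ * (2 * c) * ‖x‖ ^ 2)) +
      ⟪(-(χ x ^ 2 * weight c D (p - 1) x * Z' (relDensity c D p x (k x)) *
        (p * relDensity c D p x (k x) * (k x)⁻¹))) • x, K x⟫) :
    Integrable T ∧ ∫ x, T x = 0 := by
  obtain ⟨R, hR⟩ := exists_radius_of_hasCompactSupport hχc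
  have hfst : ∀ {Y : Type} [TopologicalSpace Y] {f : 𝔼 → Y}, Continuous f →
      ContinuousOn (fun z : 𝔼 × ℝ => f z.1) (univ ×ˢ Ioi 0) := fun hf =>
    (hf.comp continuous_fst).continuousOn
  have hW := continuousOn_relDensity (p := p) (d := d) hc hD
  have hmaps : MapsTo (fun z : 𝔼 × ℝ => relDensity c D p z.1 z.2) (univ ×ˢ Ioi 0) (Ioi 0) :=
    fun z hz => relDensity_pos hc hD z.1 hz.2
  have hZc : ContinuousOn Z (Ioi 0) := fun s hs => (hZ s hs).continuousAt.continuousWithinAt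
  have c1 := hfst hχ.continuous
  have c2 := hfst ((hχ.continuous_fderiv (by simp)).clm_apply continuous_id)
  have c3 := hZc.comp hW hmaps
  have c4 := hZ'.comp hW hmaps
  have hwt := contDiff_weight (E := 𝔼) hc hD (p - 1)
  have c5 := hfst hwt.continuous
  have c6 := hfst ((hwt.continuous_fderiv (by simp)).clm_apply continuous_id)
  have c7 := hfst ((contDiff_quad (E := 𝔼) (c := c) (D := D)).continuous.inv₀
    fun x => (quad_pos hc hD x).ne')
  have c8 : ContinuousOn (fun z : 𝔼 × ℝ => z.2⁻¹) (univ ×ˢ Ioi 0) :=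
    continuousOn_snd.inv₀ fun z hz => (ne_of_gt hz.2)
  have c9 := hfst (continuous_id (X := 𝔼))
  -- The integrand is split into a part free of the gradient and a part linear in it, with
  -- coefficients continuous in `(x, s)` for `s > 0`.
  set A₀ : 𝔼 → ℝ → ℝ := fun x s => (d * χ x ^ 2 + 2 * χ x * fderiv ℝ χ x x) *
        Z (relDensity c D p x s) * weight c D (p - 1) x +
      χ x ^ 2 * Z (relDensity c D p x s) * fderiv ℝ (weight c D (p - 1)) x x +
      χ x ^ 2 * weight c D (p - 1) x * Z' (relDensity c D p x s) *
        (p * relDensity c D p x s * (quad c D x)⁻¹ * (2 * c) * ‖x‖ ^ 2) with hA₀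
  set A₁ : 𝔼 → ℝ → 𝔼 := fun x s => (-(χ x ^ 2 * weight c D (p - 1) x *
      Z' (relDensity c D p x s) * (p * relDensity c D p x s * s⁻¹))) • x with hA₁
  have cA₀ : ContinuousOn (fun z : 𝔼 × ℝ => A₀ z.1 z.2) (univ ×ˢ Ioi 0) := by
    refine ContinuousOn.add (ContinuousOn.add ?_ ?_) ?_
    · exact (((continuousOn_const.mul (c1.pow 2)).add ((continuousOn_const.mul c1).mul c2)).mul
        c3).mul c5
    · exact ((c1.pow 2).mul c3).mul c6
    · exact (((c1.pow 2).mul c5).mul c4).mul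
        ((((continuousOn_const.mul hW).mul c7).mul continuousOn_const).mul (c9.norm.pow 2))
  have cA₁ : ContinuousOn (fun z : 𝔼 × ℝ => A₁ z.1 z.2) (univ ×ˢ Ioi 0) :=
    ((((c1.pow 2).mul c5).mul c4).mul ((continuousOn_const.mul hW).mul c8)).neg.smul c9
  have main := h.tendsto_integral hc₀ (R := R) (a₀ := A₀) (a₁ := A₁) (a₂ := fun _ _ => 0)
    cA₀ cA₁ continuousOn_const
    (fun x s hx => by simp [hA₀, (hR x hx).1]) (fun x s hx => by simp [hA₁, (hR x hx).1])
    (fun x s hx => rfl)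
  simp only [zero_mul, add_zero] at main
  have hT' : T = fun x => A₀ x (k x) + ⟪A₁ x (k x), K x⟫ := funext hT
  rw [← hT'] at main
  refine ⟨main.1, ?_⟩
  have hz : ∀ n, ∫ x, (A₀ x (kn n x) + ⟪A₁ x (kn n x), gradient (kn n) x⟫) = 0 := fun n =>
    integral_euler_relDensity (p := p) hc hD hZ hZ' hχ hχc (h.contDiff n)
      fun x => hc₀.trans_le (h.lower n x)
  simp_rw [hz] at main
  exact tendsto_nhds_unique main.2 tendsto_const_nhds

theorem gradient_mul_relDensity {χ : 𝔼 → ℝ} (hχ : ContDiff ℝ ∞ χ) {k : 𝔼 → ℝ}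
    (hk : ContDiff ℝ ∞ k) (hk0 : ∀ x, 0 < k x) (x : 𝔼) :
    gradient (fun x => χ x * ((relDensity c D p x (k x) - 1) * quad c D x)) x =
      ((χ x * (relDensity c D p x (k x) - 1 + p * relDensity c D p x (k x)) * (2 * c)) • x +
        ((relDensity c D p x (k x) - 1) * quad c D x) • gradient χ x) +
      (-(χ x * (p * relDensity c D p x (k x) * quad c D x * (k x)⁻¹))) • gradient k x := by
  have hU := quad_pos hc hD x
  have d1 := (hχ.differentiable (by simp) x).hasFDerivAt
  have d2 := hasFDerivAt_relDensity (p := p) hc hD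
    (hk.differentiable (by simp) x).hasFDerivAt (hk0 x)
  have d3 := d1.mul ((d2.sub_const 1).mul (hasFDerivAt_quad (c := c) (D := D) x))
  have d4 : HasFDerivAt (fun x => χ x * ((relDensity c D p x (k x) - 1) * quad c D x)) _ x := d3
  refine ext_inner_left ℝ fun v => ?_
  rw [inner_gradient, d4.fderiv]
  simp only [inner_add_right, inner_smul_right, inner_gradient, add_apply, smul_apply, smul_eq_mul,
    innerSL_apply_apply, real_inner_comm v x, Pi.mul_apply]
  field_simp
  ring

/-- The Hardy-Poincaré inequality for the function `(w - 1) U`, cut off by `χ`. -/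
theorem IsSmoothApproximation.hardyPoincare_le {lam m θ : ℝ} {χ : 𝔼 → ℝ}
    (hχ : ContDiff ℝ ∞ χ) (hχc : HasCompactSupport χ) (hχ0 : (0 : 𝔼) ∉ tsupport χ)
    (hHP : ∀ h : 𝔼 → ℝ, IsTestFunction m h → lam * (∫ x, h x ^ 2 * weight c D (p + 1) x) ≤
      m * (∫ x, ‖fderiv ℝ h x‖ ^ 2 * weight c D p x) +
        θ * (∫ x, h x * weight c D (p + 1) x) ^ 2)
    {c₀ : ℝ} {k : 𝔼 → ℝ} {K : 𝔼 → 𝔼}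
    {kn : ℕ → 𝔼 → ℝ} (h : IsSmoothApproximation c₀ k K kn) (hc₀ : 0 < c₀) {H : 𝔼 → 𝔼}
    (hH : ∀ x, H x = ((χ x * (relDensity c D p x (k x) - 1 + p * relDensity c D p x (k x)) *
      (2 * c)) • x + ((relDensity c D p x (k x) - 1) * quad c D x) • gradient χ x) +
      (-(χ x * (p * relDensity c D p x (k x) * quad c D x * (k x)⁻¹))) • K x) :
    (Integrable fun x => ‖H x‖ ^ 2 * weight c D p x) ∧
    lam * (∫ x, (χ x * ((relDensity c D p x (k x) - 1) * quad c D x)) ^ 2 *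
      weight c D (p + 1) x) ≤ m * (∫ x, ‖H x‖ ^ 2 * weight c D p x) +
        θ * (∫ x, χ x * ((relDensity c D p x (k x) - 1) * quad c D x) *
          weight c D (p + 1) x) ^ 2 := by
  obtain ⟨R, hR⟩ := exists_radius_of_hasCompactSupport hχc
  have hfst : ∀ {Y : Type} [TopologicalSpace Y] {f : 𝔼 → Y}, Continuous f →
      ContinuousOn (fun z : 𝔼 × ℝ => f z.1) (univ ×ˢ Ioi 0) := fun hf =>
    (hf.comp continuous_fst).continuousOn
  have hW := continuousOn_relDensity (p := p) (d := d) hc hD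
  have c1 := hfst hχ.continuous
  have c2 := hfst (continuous_gradient (hχ.of_le (m := 1) (by simp)))
  have c3 := hfst (contDiff_quad (E := 𝔼) (c := c) (D := D)).continuous
  have c5 := hfst (contDiff_weight (E := 𝔼) hc hD (p + 1)).continuous
  have c6 := hfst (contDiff_weight (E := 𝔼) hc hD p).continuous
  have c8 : ContinuousOn (fun z : 𝔼 × ℝ => z.2⁻¹) (univ ×ˢ Ioi 0) :=
    continuousOn_snd.inv₀ fun z hz => (ne_of_gt hz.2)
  have c9 := hfst (continuous_id (X := 𝔼))
  set A : 𝔼 → ℝ → 𝔼 := fun x s => (χ x * (relDensity c D p x s - 1 + p * relDensity c D p x s) *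
      (2 * c)) • x + ((relDensity c D p x s - 1) * quad c D x) • gradient χ x with hA
  set B : 𝔼 → ℝ → ℝ := fun x s => -(χ x * (p * relDensity c D p x s * quad c D x * s⁻¹)) with hB
  have cA : ContinuousOn (fun z : 𝔼 × ℝ => A z.1 z.2) (univ ×ˢ Ioi 0) :=
    (((c1.mul ((hW.sub continuousOn_const).add (continuousOn_const.mul hW))).mul
      continuousOn_const).smul c9).add (((hW.sub continuousOn_const).mul c3).smul c2)
  have cB : ContinuousOn (fun z : 𝔼 × ℝ => B z.1 z.2) (univ ×ˢ Ioi 0) :=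
    (c1.mul (((continuousOn_const.mul hW).mul c3).mul c8)).neg
  have zA : ∀ x s, R < ‖x‖ → A x s = 0 := fun x s hx => by simp [hA, (hR x hx).1, (hR x hx).2.1]
  have zB : ∀ x s, R < ‖x‖ → B x s = 0 := fun x s hx => by simp [hB, (hR x hx).1]
  have hexp : ∀ (x : 𝔼) (s : ℝ) (y : 𝔼), ‖A x s + B x s • y‖ ^ 2 * weight c D p x =
      ‖A x s‖ ^ 2 * weight c D p x + ⟪(2 * B x s * weight c D p x) • A x s, y⟫ +
        B x s ^ 2 * weight c D p x * ‖y‖ ^ 2 := fun x s y => by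
    rw [norm_add_sq_real, inner_smul_right, inner_smul_left, norm_smul, mul_pow,
      Real.norm_eq_abs, sq_abs, conj_trivial]
    ring
  have m1 := h.tendsto_integral hc₀ (R := R)
    (a₀ := fun x s => ‖A x s‖ ^ 2 * weight c D p x)
    (a₁ := fun x s => (2 * B x s * weight c D p x) • A x s)
    (a₂ := fun x s => B x s ^ 2 * weight c D p x)
    ((cA.norm.pow 2).mul c6) (((continuousOn_const.mul cB).mul c6).smul cA) ((cB.pow 2).mul c6)
    (fun x s hx => by simp [zA x s hx]) (fun x s hx => by simp [zA x s hx])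
    (fun x s hx => by simp [zB x s hx])
  have m2 := h.tendsto_integral hc₀ (R := R)
    (a₀ := fun x s => (χ x * ((relDensity c D p x s - 1) * quad c D x)) ^ 2 *
      weight c D (p + 1) x) (a₁ := fun x s => 0) (a₂ := fun x s => 0)
    (((c1.mul ((hW.sub continuousOn_const).mul c3)).pow 2).mul c5) continuousOn_const
    continuousOn_const (fun x s hx => by simp [(hR x hx).1]) (fun x s hx => rfl)
    (fun x s hx => rfl)
  have m3 := h.tendsto_integral hc₀ (R := R)
    (a₀ := fun x s => χ x * ((relDensity c D p x s - 1) * quad c D x) *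
      weight c D (p + 1) x) (a₁ := fun x s => 0) (a₂ := fun x s => 0)
    ((c1.mul ((hW.sub continuousOn_const).mul c3)).mul c5) continuousOn_const
    continuousOn_const (fun x s hx => by simp [(hR x hx).1]) (fun x s hx => rfl)
    (fun x s hx => rfl)
  simp_rw [← hexp] at m1
  simp only [inner_zero_left, zero_mul, add_zero] at m2 m3
  have hH' : ∀ x, H x = A x (k x) + B x (k x) • K x := hH
  simp_rw [← hH'] at m1
  refine ⟨m1.1, le_of_tendsto_of_tendsto' (m2.2.const_mul lam)
    ((m1.2.const_mul m).add ((m3.2.pow 2).const_mul θ)) fun n => ?_⟩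
  have hk0 : ∀ x, 0 < kn n x := fun x => hc₀.trans_le (h.lower n x)
  have hw := contDiff_relDensity (p := p) hc hD (h.contDiff n) hk0
  have htest : IsTestFunction m
      (fun x => χ x * ((relDensity c D p x (kn n x) - 1) * quad c D x)) :=
    ⟨hχ.mul ((hw.sub contDiff_const).mul contDiff_quad), hχc.mul_right,
      fun _ h0 => hχ0 (tsupport_mul_subset_left h0)⟩
  have := hHP _ htest
  simp_rw [← norm_gradient_eq, gradient_mul_relDensity hc hD hχ (h.contDiff n) hk0] at this
  exact this

end Pressure

/-! ### The linearized inequality -/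

section Linearized

theorem gradient_quad {c D : ℝ} (x : 𝔼) : gradient (quad c D) x = (2 * c) • x := by
  refine ext_inner_left ℝ fun v => ?_
  rw [inner_gradient, (hasFDerivAt_quad x).fderiv, inner_smul_right]
  simp [real_inner_comm]

/-- This inverts the change of variable `k = w^(m-1) U`. -/
theorem relDensity_rpow_mul_quad {c D m : ℝ} (hm1 : m < 1) (hc : 0 < c) (hD : 0 < D) {s : ℝ}
    (hs : 0 < s) (x : 𝔼) :
    relDensity c D (1 / (1 - m)) x (s ^ (m - 1) * quad c D x) = s := by
  have : 1 - m ≠ 0 := by linarith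
  rw [relDensity, mul_div_cancel_right₀ _ (quad_pos hc hD x).ne', ← Real.rpow_mul hs.le]
  rw [show (m - 1) * -(1 / (1 - m)) = 1 by field_simp; ring, Real.rpow_one]

theorem add_sq_le_young (a b : ℝ) {η : ℝ} (hη : 0 < η) :
    (a + b) ^ 2 ≤ (1 + η) * a ^ 2 + (1 + η⁻¹) * b ^ 2 := by
  have h0 : 0 ≤ η⁻¹ * (η * a - b) ^ 2 := by positivity
  have h1 : η⁻¹ * (η * a - b) ^ 2 = η * a ^ 2 - 2 * a * b + η⁻¹ * b ^ 2 := by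
    field_simp
    ring
  linarith [add_sq a b]

set_option maxHeartbeats 800000 in
/-- The pointwise estimate behind the comparison of the Fisher informations, for a cutoff `χ`. -/
theorem norm_sq_mul_weight_le_fisher {c D m p s κ ζ z z' η χ : ℝ} (hm1 : m < 1) (hc : 0 < c)
    (hD : 0 < D) (hp : p = 1 / (1 - m)) (hp1 : 1 ≤ p) (hs : 0 < s) (hκ : 0 ≤ κ) (hη : 0 < η)
    (hχ0 : 0 ≤ χ) (hχ1 : χ ≤ 1) (x G g : 𝔼) (e : ℝ) {k : ℝ} (hk : k = s ^ (m - 1) * quad c D x)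
    (hz : 0 ≤ z) (hzζ : z ≤ ζ * (s - 1) ^ 2)
    (hcomp : ∀ X Y : 𝔼, ‖X + (s - 1) • Y‖ ^ 2 ≤
      κ * s * ‖s ^ (m - 2) • X + pressure m s • Y‖ ^ 2 - z' * ⟪X, Y⟫)
    {T : ℝ} (hT : T = ((d * χ ^ 2 + 2 * χ * e) * z * weight c D (p - 1) x +
      χ ^ 2 * z * fderiv ℝ (weight c D (p - 1)) x x +
      χ ^ 2 * weight c D (p - 1) x * z' * (p * s * (quad c D x)⁻¹ * (2 * c) * ‖x‖ ^ 2)) +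
      ⟪(-(χ ^ 2 * weight c D (p - 1) x * z' * (p * s * k⁻¹))) • x, G + (2 * c) • x⟫)
    {H : 𝔼} (hH : H = ((χ * (s - 1 + p * s) * (2 * c)) • x + ((s - 1) * quad c D x) • g) +
      (-(χ * (p * s * quad c D x * k⁻¹))) • (G + (2 * c) • x)) :
    ‖H‖ ^ 2 * weight c D p x ≤ (1 + η) * (κ * p ^ 2 * (‖G‖ ^ 2 * s * weight c D p x) -
        2 * c * T + 2 * c * d * ζ * ((s - 1) ^ 2 * weight c D (p - 1) x) +
        4 * c * ζ * (|e| * ((s - 1) ^ 2 * weight c D (p - 1) x))) +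
      (1 + η⁻¹) * (‖g‖ ^ 2 * quad c D x * ((s - 1) ^ 2 * weight c D (p - 1) x)) := by
  have hU := quad_pos hc hD x
  have hV := weight_pos hc hD p x
  have h1m : 1 - m ≠ 0 := by linarith
  have hm1' : m - 1 ≠ 0 := by linarith
  have hsm : 0 < s ^ (m - 1) := Real.rpow_pos_of_pos hs _
  have hk0 : 0 < k := by rw [hk]; positivity
  have hwt : weight c D (p - 1) x = weight c D p x * quad c D x := weight_sub_one hc hD p x
  have hd1 : fderiv ℝ (weight c D (p - 1)) x x =
      -(2 * (p - 1)) * (weight c D p x * (quad c D x - D)) := by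
    rw [fderiv_weight_self hc hD, sub_add_cancel, hwt]; ring
  have e3 : s ^ (m - 2) * s = s ^ (m - 1) := by
    rw [← Real.rpow_add_one hs.ne']; congr 1; ring
  have eD : D ≤ quad c D x := le_quad hc hD x
  set U := quad c D x
  set V := weight c D p x
  set K := G + (2 * c) • x with hK
  -- With `s = w` and `K = ∇k`, the vector `X` is `U∇w` written in terms of the pressure variable,
  -- `Y` is `∇U`, and `H₀` is `∇((w-1)U)`.
  set X : 𝔼 := (-(p * s * U * k⁻¹)) • K + (p * s * (2 * c)) • x with hX
  set Y : 𝔼 := (2 * c) • x with hY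
  set H₀ : 𝔼 := X + (s - 1) • Y with hH₀
  have hHeq : H = χ • H₀ + ((s - 1) * U) • g := by
    rw [hH, hH₀, hX, hY]; module
  -- The vector in the comparison inequality is a multiple of the gradient `G` of the Fisher
  -- information.
  have hGeq : s ^ (m - 2) • X + pressure m s • Y = (-p) • G := by
    have c1 : s ^ (m - 2) * -(p * s * U * k⁻¹) = -p := by
      rw [hk, ← e3]
      have := (Real.rpow_pos_of_pos hs (m - 2)).ne'
      field_simp
    have c2 : s ^ (m - 2) * (p * s * (2 * c)) + pressure m s * (2 * c) = 2 * c * p := by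
      have : pressure m s = -p * (s ^ (m - 1) - 1) := by
        rw [pressure, hp, div_eq_iff hm1']
        field_simp
        ring
      rw [this, ← e3]; ring
    calc s ^ (m - 2) • X + pressure m s • Y
        = (s ^ (m - 2) * -(p * s * U * k⁻¹)) • K +
          (s ^ (m - 2) * (p * s * (2 * c)) + pressure m s * (2 * c)) • x := by
          rw [hX, hY]; module
      _ = (-p) • G := by rw [c1, c2, hK]; module
  have hXY : ⟪X, Y⟫ = 2 * c * (p * s * (2 * c) * ‖x‖ ^ 2 - p * s * U * k⁻¹ * ⟪x, K⟫) := by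
    rw [hX, hY, inner_add_left, inner_smul_left, inner_smul_left, inner_smul_right,
      inner_smul_right, real_inner_self_eq_norm_sq, real_inner_comm]
    simp only [conj_trivial]
    ring
  -- `T` is the divergence of `χ² Z(w) V U x`. Hence the cross term `χ² V Z'(w)⟨X,Y⟩` equals `2cT`
  -- up to terms in which `Z` is not differentiated.
  have hTe : 2 * c * T = 2 * c * ((d * χ ^ 2 + 2 * χ * e) * z * (V * U)) -
      2 * c * (χ ^ 2 * z * (2 * (p - 1)) * (V * (U - D))) + χ ^ 2 * V * (z' * ⟪X, Y⟫) := by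
    rw [hT, hXY, inner_smul_left, hd1, hwt]
    simp only [conj_trivial]
    field_simp
    ring
  have hmain := hcomp X Y
  rw [hGeq, norm_smul, mul_pow, norm_neg, Real.norm_eq_abs, sq_abs] at hmain
  have hχ2 : χ ^ 2 ≤ 1 := pow_le_one₀ hχ0 hχ1
  have b1 : χ ^ 2 * V * ‖H₀‖ ^ 2 ≤
      χ ^ 2 * V * (κ * s * (p ^ 2 * ‖G‖ ^ 2) - z' * ⟪X, Y⟫) := by gcongr
  have b2 : χ ^ 2 * (V * (κ * s * (p ^ 2 * ‖G‖ ^ 2))) ≤ 1 * (V * (κ * s * (p ^ 2 * ‖G‖ ^ 2))) := by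
    gcongr
  have hVU : 0 ≤ V * U := by positivity
  have hζ : 0 ≤ ζ * (s - 1) ^ 2 := hz.trans hzζ
  have b3 : (d * χ ^ 2 + 2 * χ * e) * z * (V * U) ≤
      (d + 2 * |e|) * (ζ * (s - 1) ^ 2) * (V * U) := by
    have f1 : χ * e ≤ |e| := by
      calc χ * e ≤ |χ * e| := le_abs_self _
        _ = χ * |e| := by rw [abs_mul, abs_of_nonneg hχ0]
        _ ≤ |e| := mul_le_of_le_one_left (abs_nonneg _) hχ1
    have f2 : (d : ℝ) * χ ^ 2 ≤ d := mul_le_of_le_one_right (by positivity) hχ2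
    have f3 : (d * χ ^ 2 + 2 * χ * e) ≤ d + 2 * |e| := by linarith
    have f4 : 0 ≤ (d : ℝ) + 2 * |e| := by positivity
    gcongr ?_ * _
    calc (d * χ ^ 2 + 2 * χ * e) * z ≤ (d + 2 * |e|) * z := by gcongr
      _ ≤ _ := by gcongr
  -- This is the contribution of `x·∇(V U) ≤ 0`, a consequence of `p ≥ 1`. It has the favourable
  -- sign and is dropped.
  have b4 : 0 ≤ χ ^ 2 * z * (2 * (p - 1)) * (V * (U - D)) := by
    have f1 : 0 ≤ p - 1 := by linarith
    have f2 : 0 ≤ U - D := by linarith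
    positivity
  have hfish : χ ^ 2 * V * ‖H₀‖ ^ 2 ≤ κ * p ^ 2 * (‖G‖ ^ 2 * s * V) - 2 * c * T +
      2 * c * d * ζ * ((s - 1) ^ 2 * (V * U)) + 4 * c * ζ * (|e| * ((s - 1) ^ 2 * (V * U))) := by
    have b3' := mul_le_mul_of_nonneg_left b3 (show 0 ≤ 2 * c by positivity)
    have b4' := mul_nonneg (show 0 ≤ 2 * c by positivity) b4
    linarith
  -- The gradient of the cutoff is separated at the price of a factor `1 + η` on the main term; `η`
  -- tends to `0` after the cutoff is removed.
  have hyoung : ‖H‖ ^ 2 ≤ (1 + η) * (χ ^ 2 * ‖H₀‖ ^ 2) +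
      (1 + η⁻¹) * (((s - 1) * U) ^ 2 * ‖g‖ ^ 2) := by
    have n1 : ‖H‖ ≤ χ * ‖H₀‖ + |(s - 1) * U| * ‖g‖ := by
      rw [hHeq]
      refine (norm_add_le _ _).trans (le_of_eq ?_)
      rw [norm_smul, norm_smul, Real.norm_of_nonneg hχ0, Real.norm_eq_abs]
    have n2 : ‖H‖ ^ 2 ≤ (χ * ‖H₀‖ + |(s - 1) * U| * ‖g‖) ^ 2 := by gcongr
    refine n2.trans ((add_sq_le_young _ _ hη).trans (le_of_eq ?_))
    rw [mul_pow, mul_pow, sq_abs]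
  rw [hwt]
  calc ‖H‖ ^ 2 * V ≤ ((1 + η) * (χ ^ 2 * ‖H₀‖ ^ 2) +
      (1 + η⁻¹) * (((s - 1) * U) ^ 2 * ‖g‖ ^ 2)) * V := by gcongr
    _ = (1 + η) * (χ ^ 2 * V * ‖H₀‖ ^ 2) +
      (1 + η⁻¹) * (‖g‖ ^ 2 * U * ((s - 1) ^ 2 * (V * U))) := by ring
    _ ≤ _ := by gcongr

end Linearized

/-! ### The linearized inequality with a fixed cutoff -/

section Estimate

/-- On compact sets `w` and the weight are bounded below by positive constants, so finite Fisher
information makes `G` locally square integrable. Adding `∇U = 2cx` turns `G` into the weak gradient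
of `k = w^(m-1) U`, whose mollifications inherit the lower bound `b^(m-1) D`. -/
theorem isSmoothApproximation_pressure {c D q m a b : ℝ} (hm1 : m < 1) (hc : 0 < c) (hD : 0 < D)
    (ha0 : 0 < a) (hb0 : 0 < b) {w : 𝔼 → ℝ} (hw : ∀ x, w x ∈ Icc a b) {G : 𝔼 → 𝔼}
    (hG : IsWeakGradient (fun x => (w x ^ (m - 1) - 1) * quad c D x) G)
    (hI : Integrable fun x => ‖G x‖ ^ 2 * w x * weight c D q x) :
    ∃ kn, IsSmoothApproximation (b ^ (m - 1) * D) (fun x => w x ^ (m - 1) * quad c D x)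
      (fun x => G x + (2 * c) • x) kn := by
  have hk : IsWeakGradient (fun x => w x ^ (m - 1) * quad c D x) (fun x => G x + (2 * c) • x) := by
    have := hG.add_contDiff (contDiff_quad (E := 𝔼) (c := c) (D := D) |>.of_le (m := 1) (by simp))
    simp_rw [gradient_quad] at this
    convert this using 2 with x
    ring
  have hpow : ∀ x, b ^ (m - 1) ≤ w x ^ (m - 1) ∧ w x ^ (m - 1) ≤ a ^ (m - 1) := fun x =>
    ⟨Real.rpow_le_rpow_of_nonpos (ha0.trans_le (hw x).1) (hw x).2 (by linarith),
      Real.rpow_le_rpow_of_nonpos ha0 (hw x).1 (by linarith)⟩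
  have hGm : AEStronglyMeasurable G volume := hG.2.1.aestronglyMeasurable
  have hG2 : LocallyIntegrable fun x => ‖G x‖ ^ 2 := by
    rw [locallyIntegrable_iff]
    intro S hS
    have h1 : IntegrableOn (fun x => ‖G x‖ ^ 2 * w x * weight c D q x * (a⁻¹ * weight c D (-q) x)) S :=
      hI.integrableOn.mul_continuousOn
        ((contDiff_weight (E := 𝔼) hc hD (-q)).continuous.const_smul a⁻¹).continuousOn hS
    refine Integrable.mono' h1 (hGm.norm.pow 2).restrict (ae_of_all _ fun x => ?_)
    have e : weight c D q x * weight c D (-q) x = 1 := by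
      rw [← weight_add hc hD]; simp [weight]
    rw [Real.norm_of_nonneg (by positivity)]
    have h2 : 1 ≤ w x * a⁻¹ := by
      rw [← div_eq_mul_inv, le_div_iff₀ ha0, one_mul]; exact (hw x).1
    calc ‖G x‖ ^ 2 = ‖G x‖ ^ 2 * 1 := (mul_one _).symm
      _ ≤ ‖G x‖ ^ 2 * (w x * a⁻¹) := by gcongr
      _ = ‖G x‖ ^ 2 * (w x * a⁻¹) * (weight c D q x * weight c D (-q) x) := by rw [e, mul_one]
      _ = _ := by ring
  have hK2 : LocallyIntegrable fun x : 𝔼 => ‖G x + (2 * c) • x‖ ^ 2 := by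
    have hx : LocallyIntegrable fun x : 𝔼 => ‖(2 * c) • x‖ ^ 2 := by
      have : Continuous fun x : 𝔼 => ‖(2 * c) • x‖ ^ 2 := by fun_prop
      exact this.locallyIntegrable
    refine ((hG2.add hx).smul (2 : ℝ)).mono
      ((hGm.add (by fun_prop)).norm.pow 2) (ae_of_all _ fun x => ?_)
    simp only [Pi.smul_apply, Pi.add_apply, smul_eq_mul, Real.norm_eq_abs]
    rw [abs_of_nonneg (by positivity), abs_of_nonneg (by positivity)]
    calc ‖G x + (2 * c) • x‖ ^ 2 ≤ (‖G x‖ + ‖(2 * c) • x‖) ^ 2 := by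
          gcongr; exact norm_add_le _ _
      _ ≤ _ := by nlinarith [sq_nonneg (‖G x‖ - ‖(2 * c) • x‖)]
  refine ⟨_, hk.isSmoothApproximation hK2 (fun x => ?_) fun R => ?_⟩
  · have := Real.rpow_nonneg hb0.le (m - 1)
    exact mul_le_mul (hpow x).1 (le_quad hc hD x) hD.le (this.trans (hpow x).1)
  · refine ⟨a ^ (m - 1) * (D + c * R ^ 2), fun x hx => ?_⟩
    refine mul_le_mul (hpow x).2 ?_ (quad_pos hc hD x).le (Real.rpow_nonneg ha0.le _)
    unfold quad
    gcongr

theorem integral_linear_combination {α : Type*} [MeasurableSpace α] {μ : Measure α}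
    {f₁ f₂ f₃ f₄ f₅ : α → ℝ} (h₁ : Integrable f₁ μ) (h₂ : Integrable f₂ μ) (h₃ : Integrable f₃ μ)
    (h₄ : Integrable f₄ μ) (h₅ : Integrable f₅ μ) (a b c₁ c₂ c₃ c₄ : ℝ) :
    (Integrable (fun x => a * (c₁ * f₁ x - c₂ * f₂ x + c₃ * f₃ x + c₄ * f₄ x) + b * f₅ x) μ) ∧
    ∫ x, (a * (c₁ * f₁ x - c₂ * f₂ x + c₃ * f₃ x + c₄ * f₄ x) + b * f₅ x) ∂μ =
      a * (c₁ * (∫ x, f₁ x ∂μ) - c₂ * (∫ x, f₂ x ∂μ) + c₃ * (∫ x, f₃ x ∂μ) +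
        c₄ * (∫ x, f₄ x ∂μ)) + b * ∫ x, f₅ x ∂μ := by
  have k₁ : Integrable (fun x => c₁ * f₁ x - c₂ * f₂ x) μ := (h₁.const_mul _).sub (h₂.const_mul _)
  have k₂ : Integrable (fun x => c₁ * f₁ x - c₂ * f₂ x + c₃ * f₃ x) μ := k₁.add (h₃.const_mul _)
  have k₃ : Integrable (fun x => c₁ * f₁ x - c₂ * f₂ x + c₃ * f₃ x + c₄ * f₄ x) μ :=
    k₂.add (h₄.const_mul _)
  refine ⟨(k₃.const_mul a).add (h₅.const_mul b), ?_⟩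
  rw [integral_add (k₃.const_mul a) (h₅.const_mul b), integral_const_mul, integral_const_mul,
    integral_add k₂ (h₄.const_mul _), integral_add k₁ (h₃.const_mul _),
    integral_sub (h₁.const_mul _) (h₂.const_mul _)]
  simp only [integral_const_mul]

/-- The linearized inequality, localized by a cutoff `χ`. -/
theorem hardyPoincare_le_fisher_of_cutoff {c D p m a b lam θ : ℝ} (hm0 : 0 < m) (hm1 : m < 1)
    (hp : p = 1 / (1 - m)) (hc : 0 < c) (hD : 0 < D)
    (ha0 : 0 < a) (ha : a ≤ 1) (hb : 1 ≤ b) {w : 𝔼 → ℝ} (hw : ∀ x, w x ∈ Icc a b)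
    {G : 𝔼 → 𝔼} (hG : IsWeakGradient (fun x => (w x ^ (m - 1) - 1) * quad c D x) G)
    (hI : Integrable fun x => ‖G x‖ ^ 2 * w x * weight c D p x)
    (hr : Integrable fun x => (w x - 1) ^ 2 * weight c D (p - 1) x)
    (hHP : ∀ h : 𝔼 → ℝ, IsTestFunction m h → lam * (∫ x, h x ^ 2 * weight c D (p + 1) x) ≤
      m * (∫ x, ‖fderiv ℝ h x‖ ^ 2 * weight c D p x) +
        θ * (∫ x, h x * weight c D (p + 1) x) ^ 2)
    {χ : 𝔼 → ℝ} (hχ : ContDiff ℝ ∞ χ) (hχc : HasCompactSupport χ) (hχ0 : (0 : 𝔼) ∉ tsupport χ)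
    (hχn : ∀ x, 0 ≤ χ x) (hχ1 : ∀ x, χ x ≤ 1) {η : ℝ} (hη : 0 < η) :
    lam * (∫ x, χ x ^ 2 * ((w x - 1) ^ 2 * weight c D (p - 1) x)) ≤
      m * ((1 + η) * (b ^ (2 * (2 - m)) / a * p ^ 2 * (∫ x, ‖G x‖ ^ 2 * w x * weight c D p x) +
        2 * c * d * ((b / a) ^ (2 * (2 - m)) - 1) *
          (∫ x, (w x - 1) ^ 2 * weight c D (p - 1) x) +
        4 * c * ((b / a) ^ (2 * (2 - m)) - 1) *
          (∫ x, |fderiv ℝ χ x x| * ((w x - 1) ^ 2 * weight c D (p - 1) x))) +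
        (1 + η⁻¹) * (∫ x, ‖gradient χ x‖ ^ 2 * quad c D x *
          ((w x - 1) ^ 2 * weight c D (p - 1) x))) +
      θ * (∫ x, χ x * ((w x - 1) * weight c D p x)) ^ 2 := by
  have hb0 : 0 < b := by linarith
  have hp1 : 1 ≤ p := by
    rw [hp, le_div_iff₀ (by linarith)]; linarith
  obtain ⟨kn, hkn⟩ := isSmoothApproximation_pressure hm1 hc hD ha0 hb0 hw hG hI
  have hc₀ : 0 < b ^ (m - 1) * D := by positivity
  obtain ⟨Z, Z', hZ, hZ', hZb, hcomp⟩ := exists_fisher_comparison (E := 𝔼) hm0 hm1 ha0 ha hb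
  set κ := b ^ (2 * (2 - m)) / a
  set ζ := (b / a) ^ (2 * (2 - m)) - 1
  have hdens : ∀ x, relDensity c D p x (w x ^ (m - 1) * quad c D x) = w x := fun x => by
    rw [hp]; exact relDensity_rpow_mul_quad hm1 hc hD (ha0.trans_le (hw x).1) x
  obtain ⟨hTi, hT0⟩ := hkn.integral_euler (p := p) hc hD hZ hZ' hχ hχc hc₀ fun x => rfl
  obtain ⟨hHi, hHle⟩ := hkn.hardyPoincare_le (p := p) hc hD hχ hχc hχ0 hHP hc₀ fun x => rfl
  simp only [hdens] at hTi hT0 hHi hHle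
  have hpt := fun x => norm_sq_mul_weight_le_fisher (d := d) hm1 hc hD hp hp1
    (ha0.trans_le (hw x).1) (show 0 ≤ κ by positivity) hη (hχn x) (hχ1 x) x (G x)
    (gradient χ x) (fderiv ℝ χ x x) rfl (hZb _ (hw x)).1 (hZb _ (hw x)).2
    (hcomp _ (hw x)) rfl rfl
  have i1 : Integrable fun x => |fderiv ℝ χ x x| * ((w x - 1) ^ 2 * weight c D (p - 1) x) := by
    refine hr.locallyIntegrable.integrable_smul_left_of_hasCompactSupport
      ((hχ.continuous_fderiv (by simp)).clm_apply continuous_id).abs ?_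
    refine (hχc.fderiv ℝ).mono fun x hx => ?_
    simp only [Function.mem_support, ne_eq] at hx ⊢
    intro h0
    simp [h0] at hx
  have i2 : Integrable fun x => ‖gradient χ x‖ ^ 2 * quad c D x *
      ((w x - 1) ^ 2 * weight c D (p - 1) x) := by
    have hcont : Continuous fun x => ‖gradient χ x‖ ^ 2 * quad c D x :=
      ((continuous_gradient (hχ.of_le (by simp))).norm.pow 2).mul
        (contDiff_quad (E := 𝔼) (c := c) (D := D)).continuous
    have hcs : HasCompactSupport fun x => ‖gradient χ x‖ ^ 2 * quad c D x :=
      HasCompactSupport.mul_right ((hasCompactSupport_gradient hχc).comp_left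
        (g := fun y : 𝔼 => ‖y‖ ^ 2) (by simp))
    exact hr.locallyIntegrable.integrable_smul_left_of_hasCompactSupport hcont hcs
  have hlin := integral_linear_combination hI hTi hr i1 i2 (1 + η) (1 + η⁻¹) (κ * p ^ 2) (2 * c)
    (2 * c * d * ζ) (4 * c * ζ)
  have hmono := integral_mono hHi hlin.1 hpt
  -- Here the exact divergence drops out.
  rw [hlin.2, hT0, mul_zero, sub_zero] at hmono
  have hcomp2 : ∫ x, ((χ x * ((w x - 1) * quad c D x)) ^ 2 * weight c D (p + 1) x) =
      ∫ x, χ x ^ 2 * ((w x - 1) ^ 2 * weight c D (p - 1) x) := by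
    congr 1; ext x
    have := quad_pos hc hD x
    rw [weight_sub_one hc hD, weight_add_one hc hD]
    field_simp
  have hcomp3 : ∫ x, (χ x * ((w x - 1) * quad c D x) * weight c D (p + 1) x) =
      ∫ x, χ x * ((w x - 1) * weight c D p x) := by
    congr 1; ext x
    have := quad_pos hc hD x
    rw [weight_add_one hc hD]
    field_simp
  rw [hcomp2, hcomp3] at hHle
  refine hHle.trans ?_
  gcongr

end Estimate

/-! ### Removal of the cutoff -/

section Limit

/-- In polar coordinates the integrand is `r^(d-1)/r² ≤ 1` on `(0,1)`, because `d ≥ 3`. It dominates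
the squared cutoff gradients near the origin. -/
theorem integrable_indicator_inv_norm_sq (hd : 3 ≤ d) :
    Integrable fun x : 𝔼 => (Iio (1 : ℝ)).indicator (fun y => (y ^ 2)⁻¹) ‖x‖ := by
  have : Nontrivial 𝔼 := by
    have : Nonempty (Fin d) := ⟨⟨0, by omega⟩⟩
    infer_instance
  rw [integrable_fun_norm_addHaar volume (f := (Iio (1 : ℝ)).indicator (fun y => (y ^ 2)⁻¹))]
  have hb : Integrable ((Ioo (0 : ℝ) 1).indicator fun _ => (1 : ℝ)) := by
    rw [integrable_indicator_iff measurableSet_Ioo]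
    exact integrableOn_const (by simp)
  refine (hb.integrableOn (s := Ioi 0)).mono' ?_ ?_
  · apply Measurable.aestronglyMeasurable
    have : Measurable ((Iio (1 : ℝ)).indicator fun y => (y ^ 2)⁻¹) :=
      (by fun_prop : Measurable fun y : ℝ => (y ^ 2)⁻¹).indicator measurableSet_Iio
    fun_prop
  · refine (ae_restrict_iff' measurableSet_Ioi).2 (ae_of_all _ fun y hy => ?_)
    have hy0 : 0 < y := hy
    by_cases h1 : y < 1
    · rw [indicator_of_mem (show y ∈ Iio 1 from h1), indicator_of_mem (show y ∈ Ioo 0 1 from ⟨hy0, h1⟩),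
        norm_smul, Real.norm_of_nonneg (by positivity), Real.norm_of_nonneg (by positivity)]
      rw [← div_eq_mul_inv, div_le_one (by positivity)]
      exact pow_le_pow_of_le_one hy0.le h1.le (by simp; omega)
    · rw [indicator_of_notMem (show y ∉ Iio 1 from h1),
        indicator_of_notMem (show y ∉ Ioo 0 1 from fun h => h1 h.2)]
      simp

/-- Dominated convergence for sequences that are eventually constant away from the origin. -/
theorem tendsto_integral_of_eventually_eq (hd : 3 ≤ d) {F : ℕ → 𝔼 → ℝ} {f bound : 𝔼 → ℝ}
    (hF : ∀ n, AEStronglyMeasurable (F n) volume) (hb : Integrable bound)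
    (hle : ∀ n x, x ≠ 0 → |F n x| ≤ bound x)
    (hev : ∀ x, x ≠ 0 → ∀ᶠ n in atTop, F n x = f x) :
    Tendsto (fun n => ∫ x, F n x) atTop (𝓝 (∫ x, f x)) := by
  have : Nontrivial 𝔼 := by
    have : Nonempty (Fin d) := ⟨⟨0, by omega⟩⟩
    infer_instance
  have hne : ∀ᵐ x : 𝔼, x ≠ 0 := by simp [ae_iff]
  refine tendsto_integral_of_dominated_convergence bound hF hb (fun n => ?_) ?_
  · filter_upwards [hne] with x hx using hle n x hx
  · filter_upwards [hne] with x hx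
    exact tendsto_const_nhds.congr' ((hev x hx).mono fun n h => h.symm)

/-- The linearized inequality. -/
theorem hardyPoincare_le_fisher {c D p m a b lam θ M : ℝ} (hd : 3 ≤ d) (hm0 : 0 < m) (hm1 : m < 1)
    (hp : p = 1 / (1 - m)) (hc : 0 < c) (hD : 0 < D)
    (ha0 : 0 < a) (ha : a ≤ 1) (hb : 1 ≤ b) {w : 𝔼 → ℝ} (hw : ∀ x, w x ∈ Icc a b)
    {G : 𝔼 → 𝔼} (hG : IsWeakGradient (fun x => (w x ^ (m - 1) - 1) * quad c D x) G)
    (hI : Integrable fun x => ‖G x‖ ^ 2 * w x * weight c D p x)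
    (hr : Integrable fun x => (w x - 1) ^ 2 * weight c D (p - 1) x)
    (hl : Integrable fun x => (w x - 1) * weight c D p x)
    (hM : ∀ x, |w x - 1| * quad c D x ≤ M)
    (hθ : θ = 0 ∨ ∫ x, (w x - 1) * weight c D p x = 0)
    (hHP : ∀ h : 𝔼 → ℝ, IsTestFunction m h → lam * (∫ x, h x ^ 2 * weight c D (p + 1) x) ≤
      m * (∫ x, ‖fderiv ℝ h x‖ ^ 2 * weight c D p x) +
        θ * (∫ x, h x * weight c D (p + 1) x) ^ 2) :
    lam * (∫ x, (w x - 1) ^ 2 * weight c D (p - 1) x) ≤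
      m * (b ^ (2 * (2 - m)) / a * p ^ 2 * (∫ x, ‖G x‖ ^ 2 * w x * weight c D p x) +
        2 * c * d * ((b / a) ^ (2 * (2 - m)) - 1) *
          (∫ x, (w x - 1) ^ 2 * weight c D (p - 1) x)) := by
  obtain ⟨C, hC0, hC⟩ := exists_bound_fderiv_cutoff (E := 𝔼)
  have hn : ∀ n : ℕ, (0 : ℝ) < (n : ℝ) + 1 := fun n => by positivity
  have htop : Tendsto (fun n : ℕ => (n : ℝ) + 1) atTop atTop :=
    tendsto_atTop_add_const_right _ _ tendsto_natCast_atTop_atTop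
  set χ : ℕ → 𝔼 → ℝ := fun n => cutoff ((n : ℝ) + 1) with hχ
  have hχs : ∀ n, ContDiff ℝ ∞ (χ n) := fun n => contDiff_cutoff _
  have hχn : ∀ n x, 0 ≤ χ n x := fun n x => cutoff_nonneg _ _
  have hχ1 : ∀ n x, χ n x ≤ 1 := fun n x => cutoff_le_one _ _
  have hχC : ∀ n x, ‖x‖ * ‖fderiv ℝ (χ n) x‖ ≤ C := fun n x => hC _ (hn n) x
  have hχev : ∀ x, x ≠ 0 → ∀ᶠ n in atTop, χ n x = 1 ∧ fderiv ℝ (χ n) x = 0 := fun x hx => by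
    filter_upwards [htop.eventually (eventually_cutoff_eq_one hx)] with n h
    refine ⟨h.self_of_nhds, ?_⟩
    simp only [hχ]
    rw [h.fderiv_eq]
    simp
  set r : 𝔼 → ℝ := fun x => (w x - 1) ^ 2 * weight c D (p - 1) x with hr'
  have hr0 : ∀ x, 0 ≤ r x := fun x => mul_nonneg (sq_nonneg _) (weight_pos hc hD _ x).le
  set l : 𝔼 → ℝ := fun x => (w x - 1) * weight c D p x with hl'
  have hrm := hr.aestronglyMeasurable
  have hlm := hl.aestronglyMeasurable
  have t1 : Tendsto (fun n => ∫ x, χ n x ^ 2 * r x) atTop (𝓝 (∫ x, r x)) := by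
    refine tendsto_integral_of_eventually_eq hd
      (fun n => ((hχs n).continuous.pow 2).aestronglyMeasurable.mul hrm) hr (fun n x _ => ?_)
      fun x hx => (hχev x hx).mono fun n h => by rw [h.1]; ring
    rw [abs_of_nonneg (mul_nonneg (sq_nonneg _) (hr0 x))]
    exact mul_le_of_le_one_left (hr0 x) (pow_le_one₀ (hχn n x) (hχ1 n x))
  have t2 : Tendsto (fun n => ∫ x, |fderiv ℝ (χ n) x x| * r x) atTop (𝓝 (∫ _ : 𝔼, (0 : ℝ))) := by
    refine tendsto_integral_of_eventually_eq hd (bound := fun x => C * r x)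
      (fun n => (((hχs n).continuous_fderiv (by simp)).clm_apply
        continuous_id).abs.aestronglyMeasurable.mul hrm) (hr.const_mul C) (fun n x _ => ?_)
      fun x hx => (hχev x hx).mono fun n h => by rw [h.2]; simp
    rw [abs_of_nonneg (mul_nonneg (abs_nonneg _) (hr0 x))]
    refine mul_le_mul_of_nonneg_right ?_ (hr0 x)
    refine le_trans ((fderiv ℝ (χ n) x).le_opNorm x) ?_
    rw [mul_comm]
    exact hχC n x
  -- The squared gradient is at most `C²/‖x‖²`. For `‖x‖ < 1` the product `U r = (|w-1|U)² U^(-p)`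
  -- is bounded; for `‖x‖ ≥ 1` one has `U/‖x‖² ≤ D + c`, and `r` is integrable.
  have t3 : Tendsto (fun n => ∫ x, ‖gradient (χ n) x‖ ^ 2 * quad c D x * r x) atTop
      (𝓝 (∫ _ : 𝔼, (0 : ℝ))) := by
    refine tendsto_integral_of_eventually_eq hd
      (bound := fun x => C ^ 2 * ((D + c) * r x + M ^ 2 * D ^ (-p) *
        (Iio (1 : ℝ)).indicator (fun y => (y ^ 2)⁻¹) ‖x‖))
      (fun n => ?_) (((hr.const_mul _).add
        ((integrable_indicator_inv_norm_sq hd).const_mul _)).const_mul _) (fun n x hx => ?_)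
      fun x hx => (hχev x hx).mono fun n h => by rw [norm_gradient_eq, h.2]; simp
    · have hcont : Continuous fun x => ‖gradient (χ n) x‖ ^ 2 * quad c D x :=
        ((continuous_gradient ((hχs n).of_le (by simp))).norm.pow 2).mul
          (contDiff_quad (E := 𝔼) (c := c) (D := D)).continuous
      exact hcont.aestronglyMeasurable.mul hrm
    · have hU := quad_pos hc hD x
      have hx0 : 0 < ‖x‖ := norm_pos_iff.2 hx
      have hg : ‖gradient (χ n) x‖ ^ 2 ≤ C ^ 2 * (‖x‖ ^ 2)⁻¹ := by
        rw [← div_eq_mul_inv, le_div_iff₀ (by positivity), norm_gradient_eq, ← mul_pow, mul_comm]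
        exact pow_le_pow_left₀ (by positivity) (hχC n x) 2
      have hrx := hr0 x
      rw [abs_of_nonneg (by positivity)]
      calc ‖gradient (χ n) x‖ ^ 2 * quad c D x * r x
          ≤ C ^ 2 * (‖x‖ ^ 2)⁻¹ * quad c D x * r x := by gcongr
        _ = C ^ 2 * ((‖x‖ ^ 2)⁻¹ * quad c D x * r x) := by ring
        _ ≤ _ := ?_
      gcongr C ^ 2 * ?_
      by_cases h1 : ‖x‖ < 1
      · rw [indicator_of_mem (show ‖x‖ ∈ Iio 1 from h1)]
        have e1 : quad c D x * r x ≤ M ^ 2 * D ^ (-p) := by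
          have : quad c D x * r x = (|w x - 1| * quad c D x) ^ 2 * weight c D p x := by
            simp only [hr']
            rw [weight_sub_one hc hD, mul_pow, sq_abs]; ring
          rw [this]
          have h0 : 0 ≤ p := by
            rw [hp]; have : 0 < 1 - m := by linarith
            positivity
          have := weight_pos hc hD p x
          exact mul_le_mul (pow_le_pow_left₀ (by positivity) (hM x) 2) (weight_le hc hD p h0 x)
            this.le (sq_nonneg _)
        have e2 : 0 ≤ (D + c) * r x := by positivity
        calc (‖x‖ ^ 2)⁻¹ * quad c D x * r x = (quad c D x * r x) * (‖x‖ ^ 2)⁻¹ := by ring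
          _ ≤ M ^ 2 * D ^ (-p) * (‖x‖ ^ 2)⁻¹ := by gcongr
          _ ≤ _ := by linarith
      · rw [indicator_of_notMem (show ‖x‖ ∉ Iio 1 from h1), mul_zero, add_zero]
        gcongr
        rw [inv_mul_le_iff₀ (by positivity)]
        have : 1 ≤ ‖x‖ ^ 2 := by
          have := not_lt.1 h1
          nlinarith
        unfold quad
        nlinarith
  have t4 : Tendsto (fun n => θ * (∫ x, χ n x * l x) ^ 2) atTop (𝓝 0) := by
    rcases hθ with h0 | h0
    · simp [h0]
    · have : Tendsto (fun n => ∫ x, χ n x * l x) atTop (𝓝 (∫ x, l x)) := by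
        refine tendsto_integral_of_eventually_eq hd (bound := fun x => |l x|)
          (fun n => (hχs n).continuous.aestronglyMeasurable.mul hlm) hl.abs (fun n x _ => ?_)
          fun x hx => (hχev x hx).mono fun n h => by rw [h.1]; ring
        rw [abs_mul, abs_of_nonneg (hχn n x)]
        exact mul_le_of_le_one_left (abs_nonneg _) (hχ1 n x)
      rw [h0] at this
      simpa using (this.pow 2).const_mul θ
  rw [integral_zero] at t2 t3
  set I := ∫ x, ‖G x‖ ^ 2 * w x * weight c D p x
  set J := ∫ x, r x
  set κ := b ^ (2 * (2 - m)) / a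
  set ζ := (b / a) ^ (2 * (2 - m)) - 1
  -- The limit in `n` is taken for fixed `η`, since the error carries the factor `1 + η⁻¹`; only
  -- then does `η` tend to `0`.
  have hη : ∀ η : ℝ, 0 < η → lam * J ≤ m * ((1 + η) * (κ * p ^ 2 * I + 2 * c * d * ζ * J)) := by
    intro η hη
    have hlim := (((((t2.const_mul (4 * c * ζ)).const_add (κ * p ^ 2 * I + 2 * c * d * ζ * J)).const_mul
      (1 + η)).add (t3.const_mul (1 + η⁻¹))).const_mul m).add t4
    have := le_of_tendsto_of_tendsto' (t1.const_mul lam) hlim fun n =>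
      hardyPoincare_le_fisher_of_cutoff hm0 hm1 hp hc hD ha0 ha hb hw hG hI hr hHP (hχs n)
        (hasCompactSupport_cutoff (hn n)) (zero_notMem_tsupport_cutoff _) (hχn n) (hχ1 n) hη
    simpa using this
  have hcont : Tendsto (fun η : ℝ => m * ((1 + η) * (κ * p ^ 2 * I + 2 * c * d * ζ * J)))
      (𝓝[>] 0) (𝓝 (m * ((1 + 0) * (κ * p ^ 2 * I + 2 * c * d * ζ * J)))) := by
    apply Tendsto.mono_left _ nhdsWithin_le_nhds
    exact Continuous.tendsto (by fun_prop) 0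
  rw [add_zero, one_mul] at hcont
  exact ge_of_tendsto hcont (eventually_nhdsWithin_of_forall fun η h => hη η h)

end Limit

/-! ### Quotients of Barenblatt profiles -/

section Ratio

variable {m : ℝ} (hm0 : 0 < m) (hm1 : m < 1)
include hm0 hm1

theorem barenblatt_div {D D' : ℝ} (hD : 0 < D) (hD' : 0 < D') (x : 𝔼) :
    barenblatt m D' x / barenblatt m D x =
      (quad ((1 - m) / (2 * m)) D x / quad ((1 - m) / (2 * m)) D' x) ^ (1 / (1 - m)) := by
  have h1m : 0 < 1 - m := by linarith
  have hc : 0 < (1 - m) / (2 * m) := by positivity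
  have hq := quad_pos hc hD x
  have hq' := quad_pos hc hD' x
  rw [barenblatt_eq_weight, barenblatt_eq_weight, weight, weight, Real.rpow_neg hq.le,
    Real.rpow_neg hq'.le, Real.div_rpow hq.le hq'.le]
  field_simp

omit hm0 hm1 in
theorem quad_div_quad_le {c D D' : ℝ} (hc : 0 < c) (hD' : 0 < D') (h : D' ≤ D) (x : 𝔼) :
    quad c D x / quad c D' x ≤ D / D' := by
  rw [div_le_div_iff₀ (quad_pos hc hD' x) hD']
  have : 0 ≤ c * ‖x‖ ^ 2 := by positivity
  unfold quad
  nlinarith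

theorem barenblatt_div_le_one {D D' : ℝ} (hD : 0 < D) (h : D ≤ D') (x : 𝔼) :
    barenblatt m D' x / barenblatt m D x ≤ 1 := by
  have h1m : 0 < 1 - m := by linarith
  have hc : 0 < (1 - m) / (2 * m) := by positivity
  rw [barenblatt_div hm0 hm1 hD (hD.trans_le h)]
  refine Real.rpow_le_one (div_nonneg (quad_pos hc hD x).le (quad_pos hc (hD.trans_le h) x).le) ?_
    (by positivity)
  rw [div_le_one (quad_pos hc (hD.trans_le h) x)]
  unfold quad
  linarith

theorem one_le_barenblatt_div {D D' : ℝ} (hD' : 0 < D') (h : D' ≤ D) (x : 𝔼) :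
    1 ≤ barenblatt m D' x / barenblatt m D x := by
  have h1m : 0 < 1 - m := by linarith
  have hc : 0 < (1 - m) / (2 * m) := by positivity
  rw [barenblatt_div hm0 hm1 (hD'.trans_le h) hD']
  refine Real.one_le_rpow ?_ (by positivity)
  rw [one_le_div (quad_pos hc hD' x)]
  unfold quad
  linarith

theorem barenblatt_div_le {D D' : ℝ} (hD' : 0 < D') (h : D' ≤ D) (x : 𝔼) :
    barenblatt m D' x / barenblatt m D x ≤ (D / D') ^ (1 / (1 - m)) := by
  have h1m : 0 < 1 - m := by linarith
  have hc : 0 < (1 - m) / (2 * m) := by positivity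
  rw [barenblatt_div hm0 hm1 (hD'.trans_le h) hD']
  exact Real.rpow_le_rpow (div_nonneg (quad_pos hc (hD'.trans_le h) x).le (quad_pos hc hD' x).le)
    (quad_div_quad_le hc hD' h x) (by positivity)

theorem le_barenblatt_div {D D' : ℝ} (hD : 0 < D) (h : D ≤ D') (x : 𝔼) :
    (D / D') ^ (1 / (1 - m)) ≤ barenblatt m D' x / barenblatt m D x := by
  have h1m : 0 < 1 - m := by linarith
  have hc : 0 < (1 - m) / (2 * m) := by positivity
  have hD' := hD.trans_le h
  rw [barenblatt_div hm0 hm1 hD hD']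
  refine Real.rpow_le_rpow (by positivity) ?_ (by positivity)
  rw [← inv_div, ← inv_div (quad _ D' x)]
  exact inv_anti₀ (div_pos (quad_pos hc hD' x) (quad_pos hc hD x))
    (quad_div_quad_le hc hD h x)

theorem bddBelow_barenblatt_div {D D' : ℝ} (hD : 0 < D) (h : D ≤ D') :
    BddBelow (range fun x : 𝔼 => barenblatt m D' x / barenblatt m D x) :=
  ⟨_, forall_mem_range.2 (le_barenblatt_div hm0 hm1 hD h)⟩

theorem bddAbove_barenblatt_div {D D' : ℝ} (hD' : 0 < D') (h : D' ≤ D) :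
    BddAbove (range fun x : 𝔼 => barenblatt m D' x / barenblatt m D x) :=
  ⟨_, forall_mem_range.2 (barenblatt_div_le hm0 hm1 hD' h)⟩

theorem lowerRatio_pos {D D₀ : ℝ} (hD : 0 < D) (h : D ≤ D₀) : 0 < lowerRatio d m D D₀ :=
  (Real.rpow_pos_of_pos (div_pos hD (hD.trans_le h)) _).trans_le
    (le_ciInf (le_barenblatt_div hm0 hm1 hD h))

theorem lowerRatio_le_one {D D₀ : ℝ} (hD : 0 < D) (h : D ≤ D₀) : lowerRatio d m D D₀ ≤ 1 :=
  (ciInf_le (bddBelow_barenblatt_div hm0 hm1 hD h) 0).trans (barenblatt_div_le_one hm0 hm1 hD h 0)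

theorem one_le_upperRatio {D D₁ : ℝ} (hD₁ : 0 < D₁) (h : D₁ ≤ D) : 1 ≤ upperRatio d m D D₁ :=
  (one_le_barenblatt_div hm0 hm1 hD₁ h 0).trans
    (le_ciSup (f := fun x : 𝔼 => barenblatt m D₁ x / barenblatt m D x)
      (bddAbove_barenblatt_div hm0 hm1 hD₁ h) 0)

/-- Bernoulli's inequality with exponent `1/(1-m) ≥ 1`, applied to `U_D/U_{D'} = 1 - (D'-D)/U_{D'}`.
It shows that the quotients tend to `1` at least as fast as `1/U`. -/
theorem one_sub_barenblatt_div_mul_quad_le {D D' : ℝ} (hD : 0 < D) (h : D ≤ D') (x : 𝔼) :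
    (1 - barenblatt m D' x / barenblatt m D x) * quad ((1 - m) / (2 * m)) D' x ≤
      1 / (1 - m) * (D' - D) := by
  have h1m : 0 < 1 - m := by linarith
  have hc : 0 < (1 - m) / (2 * m) := by positivity
  have hq := quad_pos hc hD x
  have hq' := quad_pos hc (hD.trans_le h) x
  rw [barenblatt_div hm0 hm1 hD (hD.trans_le h)]
  have hp : 1 ≤ 1 / (1 - m) := by rw [one_le_div h1m]; linarith
  have hs : quad ((1 - m) / (2 * m)) D x / quad ((1 - m) / (2 * m)) D' x =
      1 + -((D' - D) / quad ((1 - m) / (2 * m)) D' x) := by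
    rw [eq_comm, ← sub_eq_add_neg, eq_div_iff hq'.ne', sub_mul, div_mul_cancel₀ _ hq'.ne']
    unfold quad
    ring
  have hB := one_add_mul_self_le_rpow_one_add
    (s := -((D' - D) / quad ((1 - m) / (2 * m)) D' x)) (by
      have : 0 < quad ((1 - m) / (2 * m)) D x / quad ((1 - m) / (2 * m)) D' x := div_pos hq hq'
      linarith) hp
  rw [← hs] at hB
  calc _ ≤ (1 / (1 - m) * ((D' - D) / quad ((1 - m) / (2 * m)) D' x)) *
        quad ((1 - m) / (2 * m)) D' x := by
        gcongr
        linarith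
    _ = _ := by rw [mul_assoc, div_mul_cancel₀ _ hq'.ne']

end Ratio

/-! ### Consequences of admissibility and the entropy inequality -/

section Admissible

variable {m : ℝ} (hm0 : 0 < m) (hm1 : m < 1)
include hm0 hm1

variable {D D₀ D₁ : ℝ} {w : EuclideanSpace ℝ (Fin d) → ℝ}

theorem IsAdmissible.mem_Icc (hw : IsAdmissible d m D D₀ D₁ w) (hD₁ : 0 < D₁) (h₁ : D₁ ≤ D)
    (h₀ : D ≤ D₀) (x : EuclideanSpace ℝ (Fin d)) : w x ∈ Icc (lowerRatio d m D D₀) (upperRatio d m D D₁) :=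
  ⟨(ciInf_le (bddBelow_barenblatt_div hm0 hm1 (hD₁.trans_le h₁) h₀) x).trans (hw.lower x),
    (hw.upper x).trans (le_ciSup (f := fun x : EuclideanSpace ℝ (Fin d) => barenblatt m D₁ x / barenblatt m D x)
      (bddAbove_barenblatt_div hm0 hm1 hD₁ h₁) x)⟩

/-- Where `w ≤ 1` the lower profile gives the bound directly. Where `w ≥ 1` the same estimate is
applied to the inverse of the upper quotient, which costs a factor bounded by `K`. -/
theorem IsAdmissible.exists_abs_sub_one_mul_quad_le (hw : IsAdmissible d m D D₀ D₁ w)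
    (hD₁ : 0 < D₁) (h₁ : D₁ ≤ D) (h₀ : D ≤ D₀) :
    ∃ M, ∀ x, |w x - 1| * quad ((1 - m) / (2 * m)) D x ≤ M := by
  have h1m : 0 < 1 - m := by linarith
  have hc : 0 < (1 - m) / (2 * m) := by positivity
  have hD := hD₁.trans_le h₁
  set p := 1 / (1 - m) with hp
  have hp0 : 0 < p := by positivity
  set K := (D / D₁) ^ p
  have hK : 0 ≤ K := Real.rpow_nonneg (by positivity) _
  refine ⟨max (p * (D₀ - D)) (K * (p * (D - D₁))), fun x => ?_⟩
  have hq := quad_pos hc hD x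
  rcases le_total (w x) 1 with h | h
  · refine le_max_of_le_left ?_
    rw [abs_of_nonpos (by linarith)]
    refine le_trans ?_ (one_sub_barenblatt_div_mul_quad_le hm0 hm1 hD h₀ x)
    have := hw.lower x
    have hqq : quad ((1 - m) / (2 * m)) D x ≤ quad ((1 - m) / (2 * m)) D₀ x := by
      unfold quad; linarith
    have := barenblatt_div_le_one hm0 hm1 hD h₀ x
    apply mul_le_mul <;> linarith
  · refine le_max_of_le_right ?_
    rw [abs_of_nonneg (by linarith)]
    have hr := one_sub_barenblatt_div_mul_quad_le hm0 hm1 hD₁ h₁ x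
    set r := barenblatt m D₁ x / barenblatt m D x with hrdef
    have hr1 : 1 ≤ r := one_le_barenblatt_div hm0 hm1 hD₁ h₁ x
    have hrK : r ≤ K := barenblatt_div_le hm0 hm1 hD₁ h₁ x
    have hinv : barenblatt m D x / barenblatt m D₁ x = r⁻¹ := by rw [hrdef, inv_div]
    rw [hinv] at hr
    have hr0 : 0 < r := by linarith
    calc (w x - 1) * quad ((1 - m) / (2 * m)) D x
        ≤ (r - 1) * quad ((1 - m) / (2 * m)) D x := by
          gcongr
          exact hw.upper x
      _ = r * ((1 - r⁻¹) * quad ((1 - m) / (2 * m)) D x) := by field_simp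
      _ ≤ r * (p * (D - D₁)) := by gcongr
      _ ≤ K * (p * (D - D₁)) := by
          have : 0 ≤ D - D₁ := by linarith
          gcongr

theorem IsAdmissible.integrable_sub_one_mul (hw : IsAdmissible d m D D₀ D₁ w) (hD : 0 < D) :
    Integrable fun x => (w x - 1) * barenblatt m D x := by
  have h1m : 0 < 1 - m := by linarith
  have hc : 0 < (1 - m) / (2 * m) := by positivity
  obtain ⟨f, hf, hwf⟩ := hw.perturbation
  refine hf.congr (.of_forall fun x => ?_)
  have : barenblatt m D x ≠ 0 := (weight_pos hc hD _ x).ne'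
  simp only [hwf x]
  field_simp
  ring

/-- Split `(w-1)² U V` into the bounded factor `|w-1|U` and the integrable factor `|w-1|V`. -/
theorem IsAdmissible.integrable_sub_one_sq_mul (hw : IsAdmissible d m D D₀ D₁ w)
    (hD₁ : 0 < D₁) (h₁ : D₁ ≤ D) (h₀ : D ≤ D₀) :
    Integrable fun x => (w x - 1) ^ 2 * weight ((1 - m) / (2 * m)) D (1 / (1 - m) - 1) x := by
  have h1m : 0 < 1 - m := by linarith
  have hc : 0 < (1 - m) / (2 * m) := by positivity
  have hD := hD₁.trans_le h₁
  obtain ⟨M, hM⟩ := hw.exists_abs_sub_one_mul_quad_le hm0 hm1 hD₁ h₁ h₀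
  refine ((hw.integrable_sub_one_mul hm0 hm1 hD).norm.const_mul M).mono' ?_ ?_
  · exact ((hw.locallyIntegrable.aestronglyMeasurable.sub aestronglyMeasurable_const).pow 2).mul
      (contDiff_weight hc hD _).continuous.aestronglyMeasurable
  · refine .of_forall fun x => ?_
    have hv := weight_pos hc hD (1 / (1 - m)) x
    rw [weight_sub_one hc hD, barenblatt_eq_weight, norm_mul, norm_mul, norm_mul, norm_pow,
      Real.norm_eq_abs, Real.norm_eq_abs, Real.norm_eq_abs, abs_of_pos hv,
      abs_of_pos (quad_pos hc hD x)]
    calc _ = (|w x - 1| * quad ((1 - m) / (2 * m)) D x) *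
          (|w x - 1| * weight ((1 - m) / (2 * m)) D (1 / (1 - m)) x) := by ring
      _ ≤ _ := by
          gcongr
          exact hM x

theorem barenblatt_rpow_self (hD : 0 < D) (x : EuclideanSpace ℝ (Fin d)) :
    barenblatt m D x ^ m = weight ((1 - m) / (2 * m)) D (1 / (1 - m) - 1) x := by
  have : 1 - m ≠ 0 := by linarith
  rw [barenblatt_rpow hm0 hm1 hD]
  congr 1
  field_simp
  ring

theorem barenblatt_rpow_sub_one (hD : 0 < D) (x : EuclideanSpace ℝ (Fin d)) :
    barenblatt m D x ^ (m - 1) = quad ((1 - m) / (2 * m)) D x := by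
  have h1m : 0 < 1 - m := by linarith
  have hc : 0 < (1 - m) / (2 * m) := by positivity
  rw [barenblatt_rpow hm0 hm1 hD, ← weight_neg_one hc hD]
  congr 1
  field_simp
  ring

theorem IsAdmissible.entropy_bound (hw : IsAdmissible d m D D₀ D₁ w)
    (hD₁ : 0 < D₁) (h₁ : D₁ ≤ D) (h₀ : D ≤ D₀) :
    Integrable (entropyDensity m D w) ∧ 0 ≤ relativeEntropy m D w ∧
      relativeEntropy m D w ≤ lowerRatio d m D D₀ ^ (m - 2) / 2 *
        ∫ x, (w x - 1) ^ 2 * weight ((1 - m) / (2 * m)) D (1 / (1 - m) - 1) x := by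
  have h1m : 0 < 1 - m := by linarith
  have hc : 0 < (1 - m) / (2 * m) := by positivity
  have hD := hD₁.trans_le h₁
  have hJ := hw.integrable_sub_one_sq_mul hm0 hm1 hD₁ h₁ h₀
  have hb : ∀ x, 0 ≤ 1 / (1 - m) * entropyDensity m D w x ∧ 1 / (1 - m) * entropyDensity m D w x ≤
      lowerRatio d m D D₀ ^ (m - 2) / 2 *
        ((w x - 1) ^ 2 * weight ((1 - m) / (2 * m)) D (1 / (1 - m) - 1) x) := fun x => by
    have hv := weight_pos hc hD (1 / (1 - m) - 1) x
    obtain ⟨h1, h2⟩ := entropy_bounds hm0 hm1 (lowerRatio_pos hm0 hm1 hD h₀)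
      (lowerRatio_le_one hm0 hm1 hD h₀) (one_le_upperRatio hm0 hm1 hD₁ h₁)
      (hw.mem_Icc hm0 hm1 hD₁ h₁ h₀ x)
    rw [entropyDensity, barenblatt_rpow_self hm0 hm1 hD, ← mul_assoc, ← mul_assoc]
    exact ⟨mul_nonneg h1 hv.le, by gcongr⟩
  have hwm := hw.locallyIntegrable.aestronglyMeasurable
  have hint : Integrable fun x => 1 / (1 - m) * entropyDensity m D w x := by
    refine (hJ.const_mul _).mono' ?_
      (.of_forall fun x => by rw [Real.norm_of_nonneg (hb x).1]; exact (hb x).2)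
    have hV : AEStronglyMeasurable (fun x : EuclideanSpace ℝ (Fin d) => barenblatt m D x ^ m) := by
      simp only [barenblatt_rpow_self hm0 hm1 hD]
      exact (contDiff_weight hc hD _).continuous.aestronglyMeasurable
    have hwp : AEStronglyMeasurable fun x => w x ^ m :=
      (hwm.aemeasurable.pow_const m).aestronglyMeasurable
    exact (((hwm.sub aestronglyMeasurable_const).sub
      ((hwp.sub aestronglyMeasurable_const).const_mul _)).mul hV).const_mul _
  have hF : relativeEntropy m D w = ∫ x, 1 / (1 - m) * entropyDensity m D w x :=
    (integral_const_mul _ _).symm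
  refine ⟨?_, ?_, ?_⟩
  · refine (hint.const_mul (1 - m)).congr (.of_forall fun x => ?_)
    field_simp
  · rw [hF]
    exact integral_nonneg fun x => (hb x).1
  · rw [hF, ← integral_const_mul]
    exact integral_mono hint (hJ.const_mul _) fun x => (hb x).2

/-- The Fisher information is an infimum over weak gradients, so it suffices to treat each one; a
gradient of infinite energy satisfies the inequality trivially. -/
theorem IsAdmissible.rateBound_mul_entropy_le_fisher (hd : 3 ≤ d) (hm : m ≠ mStar d)
    (hw : IsAdmissible d m D D₀ D₁ w) (hD₁ : 0 < D₁) (h₁ : D₁ ≤ D) (h₀ : D ≤ D₀)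
    (h : 0 ≤ rateBound d m (m / hardyPoincare d m D) (lowerRatio d m D D₀)
      (upperRatio d m D D₁)) :
    ENNReal.ofReal (rateBound d m (m / hardyPoincare d m D) (lowerRatio d m D D₀)
      (upperRatio d m D D₁) * relativeEntropy m D w) ≤ relativeFisher m D w := by
  have h1m : 0 < 1 - m := by linarith
  have hc : 0 < (1 - m) / (2 * m) := by positivity
  have hD := hD₁.trans_le h₁
  have hlam := hardyPoincare_pos hd hm0 hm1 hm hD
  obtain ⟨θ, -, hθ, hHP⟩ := exists_hardyPoincare_expanded hd hm0 hm1 hm hD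
  obtain ⟨M, hM⟩ := hw.exists_abs_sub_one_mul_quad_le hm0 hm1 hD₁ h₁ h₀
  obtain ⟨-, -, hFle⟩ := hw.entropy_bound hm0 hm1 hD₁ h₁ h₀
  have ha0 := lowerRatio_pos (d := d) hm0 hm1 hD h₀
  have hmass : θ = 0 ∨
      ∫ x, (w x - 1) * weight ((1 - m) / (2 * m)) D (1 / (1 - m)) x = 0 := by
    by_cases hmm : mStar d < m
    · exact Or.inr (hw.mass hmm)
    · exact Or.inl (hθ hmm)
  refine le_iInf₂ fun G hG => ?_
  simp only [barenblatt_rpow_sub_one hm0 hm1 hD] at hG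
  have hnn : ∀ x, 0 ≤ m / (m - 1) ^ 2 * (‖G x‖ ^ 2 * w x * barenblatt m D x) := fun x => by
    have := hw.nonneg x
    have : 0 ≤ barenblatt m D x := (weight_pos hc hD _ x).le
    positivity
  have hmeas : AEStronglyMeasurable
      fun x => m / (m - 1) ^ 2 * (‖G x‖ ^ 2 * w x * barenblatt m D x) :=
    (((hG.2.1.aestronglyMeasurable.norm.pow 2).mul hw.locallyIntegrable.aestronglyMeasurable).mul
      (contDiff_weight hc hD _).continuous.aestronglyMeasurable).const_mul _
  by_cases htop : ∫⁻ x, ENNReal.ofReal (m / (m - 1) ^ 2 *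
      (‖G x‖ ^ 2 * w x * barenblatt m D x)) = ⊤
  · rw [htop]
    exact le_top
  have hI' := (lintegral_ofReal_ne_top_iff_integrable hmeas (.of_forall hnn)).1 htop
  rw [← ofReal_integral_eq_lintegral_ofReal hI' (.of_forall hnn), integral_const_mul]
  have hI : Integrable fun x => ‖G x‖ ^ 2 * w x *
      weight ((1 - m) / (2 * m)) D (1 / (1 - m)) x := by
    have h2 : m / (m - 1) ^ 2 ≠ 0 := div_ne_zero hm0.ne' (pow_ne_zero 2 (by linarith))
    refine (hI'.const_mul (m / (m - 1) ^ 2)⁻¹).congr (.of_forall fun x => ?_)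
    exact inv_mul_cancel_left₀ h2 _
  refine ENNReal.ofReal_le_ofReal ?_
  have hkey := hardyPoincare_le_fisher hd hm0 hm1 rfl hc hD ha0
    (lowerRatio_le_one hm0 hm1 hD h₀) (one_le_upperRatio hm0 hm1 hD₁ h₁)
    (hw.mem_Icc hm0 hm1 hD₁ h₁ h₀) hG hI (hw.integrable_sub_one_sq_mul hm0 hm1 hD₁ h₁ h₀)
    (hw.integrable_sub_one_mul hm0 hm1 hD) hM hmass hHP
  have hb0 : 0 < upperRatio d m D D₁ :=
    one_pos.trans_le (one_le_upperRatio hm0 hm1 hD₁ h₁)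
  refine (mul_le_mul_of_nonneg_left hFle h).trans ?_
  simp only [barenblatt_eq_weight]
  generalize (∫ x, (w x - 1) ^ 2 * weight ((1 - m) / (2 * m)) D (1 / (1 - m) - 1) x) = J at *
  generalize (∫ x, ‖G x‖ ^ 2 * w x * weight ((1 - m) / (2 * m)) D (1 / (1 - m)) x) = I at *
  generalize hardyPoincare d m D = lam at *
  generalize lowerRatio d m D D₀ = a at *
  generalize upperRatio d m D D₁ = b at *
  rw [rateBound]
  have hB : 0 < b ^ (2 * (2 - m)) := Real.rpow_pos_of_pos hb0 _
  have hA : 0 < a ^ (m - 3) := Real.rpow_pos_of_pos ha0 _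
  -- The entropy bound carries `a^(m-2)`; the extra factor `a` cancels the denominator of `κ`, which
  -- is why the rate contains `W₀^(m-3)`.
  have haa : a ^ (m - 2) = a ^ (m - 3) * a := by
    rw [← Real.rpow_add_one ha0.ne']
    ring_nf
  rw [haa]
  generalize b ^ (2 * (2 - m)) = B at *
  generalize a ^ (m - 3) = A at *
  generalize (b / a) ^ (2 * (2 - m)) - 1 = ζ at *
  have hmm : (m - 1) ^ 2 = (1 - m) ^ 2 := by ring
  calc _ = a / B * (lam * J - d * (1 - m) * ζ * J) := by
        field_simp
    _ ≤ a / B * (m * (B / a * (1 / (1 - m)) ^ 2 * I)) := by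
        gcongr
        have : m * (2 * ((1 - m) / (2 * m)) * d * ζ * J) = d * (1 - m) * ζ * J := by
          field_simp
        linarith
    _ = m / (m - 1) ^ 2 * I := by
        rw [hmm]
        field_simp

end Admissible

/-! ### Positivity of the rate -/

theorem rateBound_eq {d : ℕ} {m lam a b : ℝ} (hm0 : 0 < m) (hlam : 0 < lam) :
    rateBound d m (m / lam) a b =
      2 * (lam - d * (1 - m) * ((b / a) ^ (2 * (2 - m)) - 1)) /
        (a ^ (m - 3) * b ^ (2 * (2 - m))) := by
  rw [rateBound]
  field_simp

/-- The rate is bounded below when the ratio is close to `1`. -/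
theorem exists_le_rateBound {d : ℕ} {m lam : ℝ} (hm0 : 0 < m) (hm1 : m < 1) (hlam : 0 < lam) :
    ∃ ε : ℝ, 0 < ε ∧ ∃ γ : ℝ, 0 < γ ∧ ∀ a b : ℝ, 0 < a → 1 ≤ b → 1 - a < ε → b - 1 < ε →
      γ ≤ rateBound d m (m / lam) a b := by
  -- The penalty is nondecreasing in `b/a`, so it suffices to control it at `a = 1 - ε`, `b = 1 +
  -- ε`, where it tends to `0` with `ε`.
  have hcont : ContinuousAt (fun e : ℝ =>
      (d : ℝ) * (1 - m) * (((1 + e) / (1 - e)) ^ (2 * (2 - m)) - 1)) 0 := by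
    refine ContinuousAt.mul continuousAt_const (ContinuousAt.sub ?_ continuousAt_const)
    refine ContinuousAt.rpow_const ?_ (Or.inl (by norm_num))
    exact ContinuousAt.div (by fun_prop) (by fun_prop) (by norm_num)
  have h0 : (d : ℝ) * (1 - m) * (((1 + 0) / (1 - 0)) ^ (2 * (2 - m)) - 1) < lam / 2 := by
    simpa using hlam
  obtain ⟨δ, hδ, hδ'⟩ := Metric.eventually_nhds_iff.1 (hcont.eventually (gt_mem_nhds h0))
  set ε := min (δ / 2) (1 / 2) with hε
  have hε0 : 0 < ε := lt_min (by linarith) (by norm_num)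
  have hε1 : ε ≤ 1 / 2 := min_le_right _ _
  have hεδ : ε < δ := (min_le_left _ _).trans_lt (by linarith)
  have hsmall := hδ' (y := ε) (by simpa [abs_of_pos hε0] using hεδ)
  -- With the penalty below `lam / 2`, twice the remaining numerator is at least `lam`; the
  -- denominator is largest at `a = 1/2`, `b = 3/2`.
  refine ⟨ε, hε0, lam / ((1 / 2) ^ (m - 3) * (3 / 2) ^ (2 * (2 - m))), by positivity, ?_⟩
  intro a b ha hb h1 h2
  have hd : (0 : ℝ) ≤ d := d.cast_nonneg
  have h1m : 0 < 1 - m := by linarith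
  have hζ : (b / a) ^ (2 * (2 - m)) ≤ ((1 + ε) / (1 - ε)) ^ (2 * (2 - m)) := by
    refine Real.rpow_le_rpow (by positivity) ?_ (by linarith)
    apply div_le_div₀ <;> linarith
  have hζ' : (d : ℝ) * (1 - m) * ((b / a) ^ (2 * (2 - m)) - 1) < lam / 2 :=
    lt_of_le_of_lt (by gcongr) hsmall
  rw [rateBound_eq hm0 hlam]
  refine div_le_div₀ (by linarith) (by linarith)
    (mul_pos (Real.rpow_pos_of_pos ha _) (Real.rpow_pos_of_pos (by linarith) _)) ?_
  refine mul_le_mul (Real.rpow_le_rpow_of_nonpos (by norm_num) (by linarith) (by linarith))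
    (Real.rpow_le_rpow (by linarith) (by linarith) (by linarith)) (by positivity) (by positivity)

/-- The smallness condition is the positivity of the numerator, solved for `b / a`. -/
theorem rateBound_pos {d : ℕ} {m lam a b : ℝ} (hd : 0 < d) (hm0 : 0 < m) (hm1 : m < 1)
    (hlam : 0 < lam) (ha : 0 < a) (hb : 0 < b)
    (h : b / a < (1 + lam / (d * (1 - m))) ^ (1 / (2 * (2 - m)))) :
    0 < rateBound d m (m / lam) a b := by
  have h1m : 0 < 1 - m := by linarith
  have hd' : (0 : ℝ) < d := by exact_mod_cast hd
  have he : 0 < 2 * (2 - m) := by linarith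
  have hs : 0 ≤ 1 + lam / (d * (1 - m)) := by positivity
  have hz : (b / a) ^ (2 * (2 - m)) < 1 + lam / (d * (1 - m)) := by
    have := Real.rpow_lt_rpow (by positivity) h he
    rwa [← Real.rpow_mul hs, one_div, inv_mul_cancel₀ he.ne', Real.rpow_one] at this
  rw [rateBound_eq hm0 hlam]
  have hnum : 0 < lam - d * (1 - m) * ((b / a) ^ (2 * (2 - m)) - 1) := by
    have := (lt_div_iff₀ (by positivity : 0 < (d : ℝ) * (1 - m))).1 (sub_lt_iff_lt_add'.2 hz)
    linarith
  have := Real.rpow_pos_of_pos ha (m - 3)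
  have := Real.rpow_pos_of_pos hb (2 * (2 - m))
  positivity

end EuclideanSpace

end FastDiffusion

end

/-! ### Assembly of the theorem -/

theorem mainTheorem7 (d : ℕ) (hd : 3 ≤ d) (m : ℝ) (hm0 : 0 < m) (hm1 : m < 1)
    (hm : m ≠ FastDiffusion.mStar d) :
    ∃ lam : ℝ, 0 < lam ∧ (∀ D : ℝ, 0 < D → FastDiffusion.hardyPoincare d m D = lam) ∧
      -- the inequality when `W₀` and `W₁` are close enough to `1`
      (∃ ε : ℝ, 0 < ε ∧ ∃ γ : ℝ, 0 < γ ∧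
        ∀ Dstar D₀ D₁ : ℝ, 0 < D₁ → D₁ < D₀ → Dstar ∈ Set.Icc D₁ D₀ →
          1 - FastDiffusion.lowerRatio d m Dstar D₀ < ε →
          FastDiffusion.upperRatio d m Dstar D₁ - 1 < ε →
          ∀ w : EuclideanSpace ℝ (Fin d) → ℝ, FastDiffusion.IsAdmissible d m Dstar D₀ D₁ w →
            MeasureTheory.Integrable (FastDiffusion.entropyDensity m Dstar w)
              MeasureTheory.volume ∧
            ENNReal.ofReal (γ * FastDiffusion.relativeEntropy m Dstar w) ≤
              FastDiffusion.relativeFisher m Dstar w) ∧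
      -- the explicit smallness condition and the explicit lower bound on `γ`
      (∀ Dstar D₀ D₁ : ℝ, 0 < D₁ → D₁ < D₀ → Dstar ∈ Set.Icc D₁ D₀ →
        FastDiffusion.upperRatio d m Dstar D₁ / FastDiffusion.lowerRatio d m Dstar D₀ <
          (1 + lam / (d * (1 - m))) ^ (1 / (2 * (2 - m))) →
        0 < FastDiffusion.rateBound d m (m / lam) (FastDiffusion.lowerRatio d m Dstar D₀)
              (FastDiffusion.upperRatio d m Dstar D₁) ∧
        ∃ γ : ℝ, FastDiffusion.rateBound d m (m / lam) (FastDiffusion.lowerRatio d m Dstar D₀)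
              (FastDiffusion.upperRatio d m Dstar D₁) ≤ γ ∧
          ∀ w : EuclideanSpace ℝ (Fin d) → ℝ, FastDiffusion.IsAdmissible d m Dstar D₀ D₁ w →
            MeasureTheory.Integrable (FastDiffusion.entropyDensity m Dstar w)
              MeasureTheory.volume ∧
            ENNReal.ofReal (γ * FastDiffusion.relativeEntropy m Dstar w) ≤
              FastDiffusion.relativeFisher m Dstar w) := by
  have hD (D : ℝ) (hD : 0 < D) :
      FastDiffusion.hardyPoincare d m D = FastDiffusion.hardyPoincare d m 1 :=
    FastDiffusion.hardyPoincare_congr hm0 hm1 hD one_pos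
  have hlam : 0 < FastDiffusion.hardyPoincare d m 1 :=
    FastDiffusion.hardyPoincare_pos hd hm0 hm1 hm one_pos
  refine ⟨FastDiffusion.hardyPoincare d m 1, hlam, hD, ?_, ?_⟩
  · obtain ⟨ε, hε, γ, hγ, hrate⟩ := FastDiffusion.exists_le_rateBound (d := d) hm0 hm1 hlam
    refine ⟨ε, hε, γ, hγ, fun D D₀ D₁ h₁ _ hDD hW₀ hW₁ w hw => ?_⟩
    have hDpos := h₁.trans_le hDD.1
    obtain ⟨hint, hF, -⟩ := hw.entropy_bound hm0 hm1 h₁ hDD.1 hDD.2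
    have hr := hrate _ _ (FastDiffusion.lowerRatio_pos (d := d) hm0 hm1 hDpos hDD.2)
      (FastDiffusion.one_le_upperRatio (d := d) hm0 hm1 h₁ hDD.1) hW₀ hW₁
    -- Nonnegativity of the entropy allows the uniform `γ` to be replaced by the larger explicit
    -- rate.
    refine ⟨hint, (ENNReal.ofReal_le_ofReal (mul_le_mul_of_nonneg_right hr hF)).trans ?_⟩
    rw [← hD D hDpos] at hr ⊢
    exact hw.rateBound_mul_entropy_le_fisher hm0 hm1 hd hm h₁ hDD.1 hDD.2 (hγ.le.trans hr)
  · intro D D₀ D₁ h₁ _ hDD hsmall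
    have hDpos := h₁.trans_le hDD.1
    have hr := FastDiffusion.rateBound_pos (by omega) hm0 hm1 hlam
      (FastDiffusion.lowerRatio_pos (d := d) hm0 hm1 hDpos hDD.2)
      (one_pos.trans_le (FastDiffusion.one_le_upperRatio (d := d) hm0 hm1 h₁ hDD.1)) hsmall
    -- The explicit rate itself serves as `γ`.
    refine ⟨hr, _, le_rfl, fun w hw => ⟨(hw.entropy_bound hm0 hm1 h₁ hDD.1 hDD.2).1, ?_⟩⟩
    rw [← hD D hDpos] at hr ⊢
    exact hw.rateBound_mul_entropy_le_fisher hm0 hm1 hd hm h₁ hDD.1 hDD.2 hr.le
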